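/- **Setting.** The finite types are generated by: $0$ is a type, and if $\sigma,\tau$ are types then so is $\sigma\to\tau$; write $1$ for $0\to 0$. The language $\mathsf{L}_\omega$ of higher-order arithmetic has variables of every finite type, the relation symbols $=_0,<_0$ on type $0$, and the constants $0,1,+_0,\times_0$, the combinators $\Pi,\Sigma$ and the recursors $\mathbf{R}_\sigma$; equality at higher types is defined by $x=_\tau y :\equiv (\forall z_1\dots z_k)(xz_1\dots z_k=_0 yz_1\dots z_k)$. Logic is classical many-sorted predicate logic with equality at type $0$. The system $\mathsf{RCA}_0^\omega$ has as axioms: the axioms stating that $0,1,<_0,+_0,\times_0$ form a discretely ordered commutative semiring with least element $0$; $\Pi xy=x$ and $\Sigma xyz=xz(yz)$; $\mathbf{R}_0(f,m,0)=m$ and $\mathbf{R}_0(f,m,n+1)=f(n,\mathbf{R}_0(f,m,n))$; extensionality $x=_\rho y\to \varphi(x)=_\tau\varphi(y)$ for all types $\rho,\tau$; induction for quantifier-free formulas; and $\mathsf{QF\text{-}AC}^{1,0}$. Here $\mathsf{QF\text{-}AC}^{\sigma,\tau}$ is the schema $$(\forall x^\sigma)(\exists y^\tau)A(x,y)\to(\exists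 Y^{\sigma\to\tau})(\forall x^\sigma)A(x,Y(x))$$ for quantifier-free $A$ (parameters of all finite types are allowed in quantifier-free formulas). Rationals are coded by natural numbers. A real is a sequence $x^1$ of (codes of) rationals with $(\forall n,i)(|x(n)-x(n+i)|<2^{-n})$; $x=_{\mathbb R}y$ means $(\forall n)(|x(n)-y(n)|\le 2^{-n+1})$, and $x<_{\mathbb R}y$ means $(\exists n)(y(n)-x(n)>2^{-n+1})$. A function from $D\subseteq\mathbb R$ to $\mathbb R$ is given by an object of type $1\to1$ that maps (representatives of) elements of $D$ to reals and $=_{\mathbb R}$-equal ones to $=_{\mathbb R}$-equal reals. Let $I=[0,1]$ and $I_y^{\psi}=(y-\psi(y),\,y+\psi(y))$, which is empty if $\psi(y)\le 0$. Let $\mathsf{HBU}$ (Heine-Borel for canonical covers) be the sentence $$(\forall \Psi:\mathbb R\to\mathbb R^+)(\exists y_1,\dots,y_k\in I)(\forall x\in I)(\exists i\le k)(x\in I^{\Psi}_{y_i}),$$ and let $\mathsf{HBT}$ (Heine-Borel for covers with possibly empty intervals) be the sentence $$(\forall \psi:I\to\mathbb R)\big[(\forall x\in I)(\exists y\in I)(x\in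 I_y^{\psi})\to(\exists y_1,\dots,y_k\in I)(\forall x\in I)(\exists i\le k)(x\in I_{y_i}^{\psi})\big].$$ **Theorem.** The system $\mathsf{RCA}_0^\omega+\mathsf{QF\text{-}AC}^{1,1}$ proves $\mathsf{HBU}\leftrightarrow\mathsf{HBT}$. -/

import Mathlib

/-! # Higher-order arithmetic: finite types, terms, formulas, provability -/

namespace HOA

/-- The finite types: `nat` is the type `0`, and `σ ⇒ τ` is the type of maps from `σ` to `τ`. -/
inductive Ty : Type
  | nat : Ty
  | arr : Ty → Ty → Ty

infixr:60 " ⇒ " => Ty.arr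

/-- The type `1` of maps from numbers to numbers. -/
abbrev Ty.one : Ty := Ty.nat ⇒ Ty.nat

/-- Contexts list the types of the free variables (de Bruijn indices, most recent first). -/
abbrev Ctx : Type := List Ty

/-- `Var Γ τ`: the variables of type `τ` in the context `Γ`. -/
inductive Var : Ctx → Ty → Type
  | z {Γ : Ctx} {τ : Ty} : Var (τ :: Γ) τ
  | s {Γ : Ctx} {σ τ : Ty} : Var Γ τ → Var (σ :: Γ) τ

/-- The constants of `L_ω`: `0`, `1`, `+`, `×`, the combinators `Π` and `Σ`, and the recursors. -/
inductive Con : Ty → Type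
  | zero : Con Ty.nat
  | one : Con Ty.nat
  | add : Con (Ty.nat ⇒ Ty.nat ⇒ Ty.nat)
  | mul : Con (Ty.nat ⇒ Ty.nat ⇒ Ty.nat)
  | proj (σ τ : Ty) : Con (σ ⇒ τ ⇒ σ)
  | comb (ρ σ τ : Ty) : Con ((ρ ⇒ σ ⇒ τ) ⇒ (ρ ⇒ σ) ⇒ ρ ⇒ τ)
  | recur (σ : Ty) : Con ((Ty.nat ⇒ σ ⇒ σ) ⇒ σ ⇒ Ty.nat ⇒ σ)

/-- The terms of `L_ω`: variables, constants and application. -/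
inductive Tm (Γ : Ctx) : Ty → Type
  | var {τ : Ty} : Var Γ τ → Tm Γ τ
  | con {τ : Ty} : Con τ → Tm Γ τ
  | app {σ τ : Ty} : Tm Γ (σ ⇒ τ) → Tm Γ σ → Tm Γ τ

/-- The formulas of `L_ω`.  The prime formulas are equations and inequalities between terms of
type `0`; negation, conjunction, disjunction and existence are defined classically below. -/
inductive Fm : Ctx → Type
  | eq {Γ : Ctx} : Tm Γ Ty.nat → Tm Γ Ty.nat → Fm Γ
  | lt {Γ : Ctx} : Tm Γ Ty.nat → Tm Γ Ty.nat → Fm Γ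
  | bot {Γ : Ctx} : Fm Γ
  | imp {Γ : Ctx} : Fm Γ → Fm Γ → Fm Γ
  | all {Γ : Ctx} (σ : Ty) : Fm (σ :: Γ) → Fm Γ

/-! ## Renaming and substitution -/

/-- Extend a renaming under a binder. -/
def liftRen {Γ Δ : Ctx} (r : ∀ τ : Ty, Var Γ τ → Var Δ τ) (σ : Ty) :
    ∀ τ : Ty, Var (σ :: Γ) τ → Var (σ :: Δ) τ
  | _, Var.z => Var.z
  | _, Var.s x => Var.s (r _ x)

def Tm.rename {Γ Δ : Ctx} (r : ∀ τ : Ty, Var Γ τ → Var Δ τ) : ∀ {τ : Ty}, Tm Γ τ → Tm Δ τ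
  | _, Tm.var x => Tm.var (r _ x)
  | _, Tm.con c => Tm.con c
  | _, Tm.app f a => Tm.app (f.rename r) (a.rename r)

def Fm.rename : ∀ {Γ Δ : Ctx}, (∀ τ : Ty, Var Γ τ → Var Δ τ) → Fm Γ → Fm Δ
  | _, _, r, Fm.eq s t => Fm.eq (s.rename r) (t.rename r)
  | _, _, r, Fm.lt s t => Fm.lt (s.rename r) (t.rename r)
  | _, _, _, Fm.bot => Fm.bot
  | _, _, r, Fm.imp A B => Fm.imp (A.rename r) (B.rename r)
  | _, _, r, Fm.all σ A => Fm.all σ (A.rename (liftRen r σ))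

/-- Weakening: the same term in a context with one more variable. -/
def Tm.wk {Γ : Ctx} {σ τ : Ty} (t : Tm Γ τ) : Tm (σ :: Γ) τ := t.rename (fun _ x => Var.s x)

/-- Weakening: the same formula in a context with one more variable. -/
def Fm.wk {Γ : Ctx} {σ : Ty} (A : Fm Γ) : Fm (σ :: Γ) := A.rename (fun _ x => Var.s x)

/-- Extend a substitution under a binder. -/
def liftSub {Γ Δ : Ctx} (θ : ∀ τ : Ty, Var Γ τ → Tm Δ τ) (σ : Ty) :
    ∀ τ : Ty, Var (σ :: Γ) τ → Tm (σ :: Δ) τ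
  | _, Var.z => Tm.var Var.z
  | _, Var.s x => (θ _ x).wk

def Tm.subst {Γ Δ : Ctx} (θ : ∀ τ : Ty, Var Γ τ → Tm Δ τ) : ∀ {τ : Ty}, Tm Γ τ → Tm Δ τ
  | _, Tm.var x => θ _ x
  | _, Tm.con c => Tm.con c
  | _, Tm.app f a => Tm.app (f.subst θ) (a.subst θ)

/-- Simultaneous capture-avoiding substitution. -/
def Fm.subst : ∀ {Γ Δ : Ctx}, (∀ τ : Ty, Var Γ τ → Tm Δ τ) → Fm Γ → Fm Δ
  | _, _, θ, Fm.eq s t => Fm.eq (s.subst θ) (t.subst θ)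
  | _, _, θ, Fm.lt s t => Fm.lt (s.subst θ) (t.subst θ)
  | _, _, _, Fm.bot => Fm.bot
  | _, _, θ, Fm.imp A B => Fm.imp (A.subst θ) (B.subst θ)
  | _, _, θ, Fm.all σ A => Fm.all σ (A.subst (liftSub θ σ))

/-- The substitution that replaces the most recent variable by `t` and fixes the others. -/
def instSub {Γ : Ctx} {σ : Ty} (t : Tm Γ σ) : ∀ τ : Ty, Var (σ :: Γ) τ → Tm Γ τ
  | _, Var.z => t
  | _, Var.s x => Tm.var x

/-- `A.inst t` is `A[t]`: the most recent variable of `A` is replaced by `t`. -/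
def Fm.inst {Γ : Ctx} {σ : Ty} (A : Fm (σ :: Γ)) (t : Tm Γ σ) : Fm Γ := A.subst (instSub t)

/-! ## Defined connectives, equality at all types, quantifier-free formulas -/

def Fm.neg {Γ : Ctx} (A : Fm Γ) : Fm Γ := A.imp Fm.bot
def Fm.and {Γ : Ctx} (A B : Fm Γ) : Fm Γ := (A.imp B.neg).neg
def Fm.or {Γ : Ctx} (A B : Fm Γ) : Fm Γ := A.neg.imp B
def Fm.iff {Γ : Ctx} (A B : Fm Γ) : Fm Γ := (A.imp B).and (B.imp A)
def Fm.ex {Γ : Ctx} (σ : Ty) (A : Fm (σ :: Γ)) : Fm Γ := (Fm.all σ A.neg).neg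

/-- The most recent variable, and the ones before it. -/
abbrev v0 {Γ : Ctx} {a : Ty} : Tm (a :: Γ) a := Tm.var Var.z
abbrev v1 {Γ : Ctx} {a b : Ty} : Tm (b :: a :: Γ) a := Tm.var (Var.s Var.z)
abbrev v2 {Γ : Ctx} {a b c : Ty} : Tm (c :: b :: a :: Γ) a := Tm.var (Var.s (Var.s Var.z))
abbrev v3 {Γ : Ctx} {a b c d : Ty} : Tm (d :: c :: b :: a :: Γ) a :=
  Tm.var (Var.s (Var.s (Var.s Var.z)))

/-- Equality `s =_τ t`, defined from `=_0` by `(∀ z₁ … z_k) s z₁ … z_k =_0 t z₁ … z_k`. -/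
def eqT : ∀ (τ : Ty) {Γ : Ctx}, Tm Γ τ → Tm Γ τ → Fm Γ
  | Ty.nat, _, s, t => Fm.eq s t
  | Ty.arr σ τ, _, s, t => Fm.all σ (eqT τ (Tm.app s.wk v0) (Tm.app t.wk v0))

/-- Quantifier-free formulas; variables (parameters) of all finite types are allowed. -/
def Fm.QF : ∀ {Γ : Ctx}, Fm Γ → Prop
  | _, Fm.eq _ _ => True
  | _, Fm.lt _ _ => True
  | _, Fm.bot => True
  | _, Fm.imp A B => A.QF ∧ B.QF
  | _, Fm.all _ _ => False

/-! ## Provability -/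

/-- A theory: the axioms, given as formulas whose free variables are read universally. -/
abbrev Theory : Type := ∀ Γ : Ctx, Fm Γ → Prop

/-- Natural deduction for classical many-sorted predicate logic with equality at type `0`:
`Prf T H A` says that the formula `A` is derivable from the axioms of `T` and the finitely many
open assumptions `H`. -/
inductive Prf (T : Theory) : ∀ {Γ : Ctx}, List (Fm Γ) → Fm Γ → Prop
  | ax {Γ : Ctx} {H : List (Fm Γ)} {A : Fm Γ} : T Γ A → Prf T H A
  | hyp {Γ : Ctx} {H : List (Fm Γ)} {A : Fm Γ} : A ∈ H → Prf T H A
  | impI {Γ : Ctx} {H : List (Fm Γ)} {A B : Fm Γ} : Prf T (A :: H) B → Prf T H (A.imp B)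
  | impE {Γ : Ctx} {H : List (Fm Γ)} {A B : Fm Γ} : Prf T H (A.imp B) → Prf T H A → Prf T H B
  | raa {Γ : Ctx} {H : List (Fm Γ)} {A : Fm Γ} : Prf T (A.neg :: H) Fm.bot → Prf T H A
  | allI {Γ : Ctx} {H : List (Fm Γ)} {σ : Ty} {A : Fm (σ :: Γ)} :
      Prf T (H.map Fm.wk) A → Prf T H (Fm.all σ A)
  | allE {Γ : Ctx} {H : List (Fm Γ)} {σ : Ty} {A : Fm (σ :: Γ)} (t : Tm Γ σ) :
      Prf T H (Fm.all σ A) → Prf T H (A.inst t)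
  | eqRefl {Γ : Ctx} {H : List (Fm Γ)} (t : Tm Γ Ty.nat) : Prf T H (Fm.eq t t)
  | eqSubst {Γ : Ctx} {H : List (Fm Γ)} {s t : Tm Γ Ty.nat} (A : Fm (Ty.nat :: Γ)) :
      Prf T H (Fm.eq s t) → Prf T H (A.inst s) → Prf T H (A.inst t)

/-- The theory `T` proves the sentence `A`. -/
def Theory.Proves (T : Theory) (A : Fm []) : Prop := Prf T [] A

/-! ## The axioms -/

section Terms

variable {Γ : Ctx}

def zero : Tm Γ Ty.nat := Tm.con Con.zero
def one : Tm Γ Ty.nat := Tm.con Con.one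
def add (s t : Tm Γ Ty.nat) : Tm Γ Ty.nat := Tm.app (Tm.app (Tm.con Con.add) s) t
def mul (s t : Tm Γ Ty.nat) : Tm Γ Ty.nat := Tm.app (Tm.app (Tm.con Con.mul) s) t

/-- `R_0(f, m, n)`. -/
def rec0 (f : Tm Γ (Ty.nat ⇒ Ty.nat ⇒ Ty.nat)) (m n : Tm Γ Ty.nat) : Tm Γ Ty.nat :=
  Tm.app (Tm.app (Tm.app (Tm.con (Con.recur Ty.nat)) f) m) n

/-- The term `Π x y`. -/
def projApp {σ τ : Ty} (x : Tm Γ σ) (y : Tm Γ τ) : Tm Γ σ :=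
  Tm.app (Tm.app (Tm.con (Con.proj σ τ)) x) y

/-- The term `Σ x y z`. -/
def combApp {ρ σ τ : Ty} (x : Tm Γ (ρ ⇒ σ ⇒ τ)) (y : Tm Γ (ρ ⇒ σ)) (z : Tm Γ ρ) : Tm Γ τ :=
  Tm.app (Tm.app (Tm.app (Tm.con (Con.comb ρ σ τ)) x) y) z

end Terms

/-- The substitution `n ↦ n + 1` for the most recent variable `n`. -/
def succSub {Γ : Ctx} : ∀ τ : Ty, Var (Ty.nat :: Γ) τ → Tm (Ty.nat :: Γ) τ
  | _, Var.z => add v0 one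
  | _, Var.s x => Tm.var (Var.s x)

/-- The formula `A(n + 1)`, for `A` with most recent variable `n`. -/
def Fm.succ {Γ : Ctx} (A : Fm (Ty.nat :: Γ)) : Fm (Ty.nat :: Γ) := A.subst succSub

/-- The substitution `y ↦ Y x`, `x ↦ x`, from the variables `x, y` to the variables `Y, x`. -/
def choiceSub {Γ : Ctx} {σ τ : Ty} :
    ∀ ρ : Ty, Var (τ :: σ :: Γ) ρ → Tm (σ :: (σ ⇒ τ) :: Γ) ρ
  | _, Var.z => Tm.app v1 v0
  | _, Var.s Var.z => v0
  | _, Var.s (Var.s x) => Tm.var (Var.s (Var.s x))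

/-- The formula `A(x, Y x)`, for `A(x, y)` with `y` the most recent variable and `x` the one
before it. -/
def Fm.choiceInst {Γ : Ctx} {σ τ : Ty} (A : Fm (τ :: σ :: Γ)) : Fm (σ :: (σ ⇒ τ) :: Γ) :=
  A.subst choiceSub

/-- The schema `QF-AC^{σ,τ}`:
`(∀ x^σ)(∃ y^τ) A(x, y) → (∃ Y^{σ ⇒ τ})(∀ x^σ) A(x, Y x)` for quantifier-free `A`. -/
inductive QFAC (σ τ : Ty) : Theory
  | mk {Γ : Ctx} (A : Fm (τ :: σ :: Γ)) : A.QF →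
      QFAC σ τ Γ ((Fm.all σ (Fm.ex τ A)).imp (Fm.ex (σ ⇒ τ) (Fm.all σ A.choiceInst)))

/-- The axioms of `RCA_0^ω`. The arithmetical ones say that the objects of type `0` form a discretely
ordered commutative semiring with least element `0`. -/
inductive RCA0 : Theory
  | add_assoc {Γ : Ctx} (a b c : Tm Γ Ty.nat) :
      RCA0 Γ (Fm.eq (add (add a b) c) (add a (add b c)))
  | add_comm {Γ : Ctx} (a b : Tm Γ Ty.nat) : RCA0 Γ (Fm.eq (add a b) (add b a))
  | add_zero {Γ : Ctx} (a : Tm Γ Ty.nat) : RCA0 Γ (Fm.eq (add a zero) a)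
  | mul_assoc {Γ : Ctx} (a b c : Tm Γ Ty.nat) :
      RCA0 Γ (Fm.eq (mul (mul a b) c) (mul a (mul b c)))
  | mul_comm {Γ : Ctx} (a b : Tm Γ Ty.nat) : RCA0 Γ (Fm.eq (mul a b) (mul b a))
  | mul_one {Γ : Ctx} (a : Tm Γ Ty.nat) : RCA0 Γ (Fm.eq (mul a one) a)
  | mul_zero {Γ : Ctx} (a : Tm Γ Ty.nat) : RCA0 Γ (Fm.eq (mul a zero) zero)
  | mul_add {Γ : Ctx} (a b c : Tm Γ Ty.nat) :
      RCA0 Γ (Fm.eq (mul a (add b c)) (add (mul a b) (mul a c)))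
  | lt_irrefl {Γ : Ctx} (a : Tm Γ Ty.nat) : RCA0 Γ (Fm.lt a a).neg
  | lt_trans {Γ : Ctx} (a b c : Tm Γ Ty.nat) :
      RCA0 Γ ((Fm.lt a b).imp ((Fm.lt b c).imp (Fm.lt a c)))
  | lt_total {Γ : Ctx} (a b : Tm Γ Ty.nat) :
      RCA0 Γ ((Fm.lt a b).or ((Fm.eq a b).or (Fm.lt b a)))
  | add_lt_add {Γ : Ctx} (a b c : Tm Γ Ty.nat) :
      RCA0 Γ ((Fm.lt a b).imp (Fm.lt (add a c) (add b c)))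
  | mul_lt_mul {Γ : Ctx} (a b c : Tm Γ Ty.nat) :
      RCA0 Γ ((Fm.lt a b).imp ((Fm.lt zero c).imp (Fm.lt (mul a c) (mul b c))))
  | zero_lt_one {Γ : Ctx} : RCA0 Γ (Fm.lt zero one)
  | not_lt_zero {Γ : Ctx} (a : Tm Γ Ty.nat) : RCA0 Γ (Fm.lt a zero).neg
  | lt_add_one {Γ : Ctx} (a b : Tm Γ Ty.nat) :
      RCA0 Γ ((Fm.lt a (add b one)).imp ((Fm.lt a b).or (Fm.eq a b)))
  | proj {Γ : Ctx} {σ τ : Ty} (x : Tm Γ σ) (y : Tm Γ τ) : RCA0 Γ (eqT σ (projApp x y) x)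
  | comb {Γ : Ctx} {ρ σ τ : Ty} (x : Tm Γ (ρ ⇒ σ ⇒ τ)) (y : Tm Γ (ρ ⇒ σ)) (z : Tm Γ ρ) :
      RCA0 Γ (eqT τ (combApp x y z) (Tm.app (Tm.app x z) (Tm.app y z)))
  | rec_zero {Γ : Ctx} (f : Tm Γ (Ty.nat ⇒ Ty.nat ⇒ Ty.nat)) (m : Tm Γ Ty.nat) :
      RCA0 Γ (Fm.eq (rec0 f m zero) m)
  | rec_succ {Γ : Ctx} (f : Tm Γ (Ty.nat ⇒ Ty.nat ⇒ Ty.nat)) (m n : Tm Γ Ty.nat) :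
      RCA0 Γ (Fm.eq (rec0 f m (add n one)) (Tm.app (Tm.app f n) (rec0 f m n)))
  | ext {Γ : Ctx} {ρ τ : Ty} (x y : Tm Γ ρ) (f : Tm Γ (ρ ⇒ τ)) :
      RCA0 Γ ((eqT ρ x y).imp (eqT τ (Tm.app f x) (Tm.app f y)))
  | ind {Γ : Ctx} (A : Fm (Ty.nat :: Γ)) : A.QF →
      RCA0 Γ ((A.inst zero).imp ((Fm.all Ty.nat (A.imp A.succ)).imp (Fm.all Ty.nat A)))
  | choice {Γ : Ctx} (A : Fm Γ) : QFAC Ty.one Ty.nat Γ A → RCA0 Γ A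

/-- The union of two theories. -/
def Theory.plus (T U : Theory) : Theory := fun Γ A => T Γ A ∨ U Γ A

/-! ## Primitive recursive operations on numbers -/

/-- `λ`-abstraction of the most recent variable, by means of the combinators `Π` and `Σ`. -/
def lam {Γ : Ctx} {σ : Ty} : ∀ {τ : Ty}, Tm (σ :: Γ) τ → Tm Γ (σ ⇒ τ)
  | _, Tm.var Var.z =>
      Tm.app (Tm.app (Tm.con (Con.comb σ (σ ⇒ σ) σ)) (Tm.con (Con.proj σ (σ ⇒ σ))))
        (Tm.con (Con.proj σ σ))
  | τ, Tm.var (Var.s x) => Tm.app (Tm.con (Con.proj τ σ)) (Tm.var x)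
  | τ, Tm.con c => Tm.app (Tm.con (Con.proj τ σ)) (Tm.con c)
  | _, Tm.app f a => Tm.app (Tm.app (Tm.con (Con.comb _ _ _)) (lam f)) (lam a)

section Arithmetic

variable {Γ : Ctx}

/-- `h(n)` for `h(0) = m`, `h(k + 1) = f(k, h(k))`; in `f`, the variable `v1` is `k` and `v0` is
`h(k)`. -/
def primRec (f : Tm (Ty.nat :: Ty.nat :: Γ) Ty.nat) (m n : Tm Γ Ty.nat) : Tm Γ Ty.nat :=
  rec0 (lam (lam f)) m n

def succ (n : Tm Γ Ty.nat) : Tm Γ Ty.nat := add n one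
def two : Tm Γ Ty.nat := add one one

/-- The predecessor `n ∸ 1`. -/
def pred (n : Tm Γ Ty.nat) : Tm Γ Ty.nat := primRec v1 zero n

/-- Truncated subtraction `m ∸ n`. -/
def sub (m n : Tm Γ Ty.nat) : Tm Γ Ty.nat := primRec (pred v0) m n

/-- `2 ^ n`. -/
def pow2 (n : Tm Γ Ty.nat) : Tm Γ Ty.nat := primRec (add v0 v0) one n

/-- `n` modulo `2`. -/
def parity (n : Tm Γ Ty.nat) : Tm Γ Ty.nat := primRec (sub one v0) zero n

/-- The integer part of `n / 2`. -/
def half (n : Tm Γ Ty.nat) : Tm Γ Ty.nat := primRec (sub v1 v0) zero n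

/-- The triangular number `n (n + 1) / 2`. -/
def tri (n : Tm Γ Ty.nat) : Tm Γ Ty.nat := primRec (add v0 (succ v1)) zero n

/-- The largest `w` with `tri w ≤ z`. -/
def triRoot (z : Tm Γ Ty.nat) : Tm Γ Ty.nat :=
  primRec (add v0 (sub one (sub (tri (succ v0)) (succ v1)))) zero z

/-- The Cantor pairing function and its two inverse functions. -/
def pair (x y : Tm Γ Ty.nat) : Tm Γ Ty.nat := add (tri (add x y)) x
def fst (z : Tm Γ Ty.nat) : Tm Γ Ty.nat := sub z (tri (triRoot z))
def snd (z : Tm Γ Ty.nat) : Tm Γ Ty.nat := sub (triRoot z) (fst z)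

/-! ## Rational numbers

The code `pair s d` stands for `(s / 2) / (d + 1)` if `s` is even, and for
`- ((s + 1) / 2) / (d + 1)` if `s` is odd. Every number codes exactly one rational. -/

/-- The positive part of the numerator of the rational coded by `q`. -/
def numPos (q : Tm Γ Ty.nat) : Tm Γ Ty.nat :=
  mul (sub one (parity (fst q))) (half (fst q))

/-- The negative part of the numerator of the rational coded by `q`. -/
def numNeg (q : Tm Γ Ty.nat) : Tm Γ Ty.nat :=
  mul (parity (fst q)) (succ (half (fst q)))

/-- The denominator of the rational coded by `q`. -/
def den (q : Tm Γ Ty.nat) : Tm Γ Ty.nat := succ (snd q)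

/-- A code of the rational `(p - m) / d`, for `d > 0`. -/
def mkRat (p m d : Tm Γ Ty.nat) : Tm Γ Ty.nat :=
  pair (add (mul two (sub p m)) (pred (mul two (sub m p)))) (pred d)

def ratAdd (q r : Tm Γ Ty.nat) : Tm Γ Ty.nat :=
  mkRat (add (mul (numPos q) (den r)) (mul (numPos r) (den q)))
    (add (mul (numNeg q) (den r)) (mul (numNeg r) (den q))) (mul (den q) (den r))

def ratNeg (q : Tm Γ Ty.nat) : Tm Γ Ty.nat := mkRat (numNeg q) (numPos q) (den q)
def ratSub (q r : Tm Γ Ty.nat) : Tm Γ Ty.nat := ratAdd q (ratNeg r)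
def ratAbs (q : Tm Γ Ty.nat) : Tm Γ Ty.nat := mkRat (add (numPos q) (numNeg q)) zero (den q)

/-- `q <_ℚ r`, cross-multiplied. -/
def ratLt (q r : Tm Γ Ty.nat) : Fm Γ :=
  Fm.lt (add (mul (numPos q) (den r)) (mul (numNeg r) (den q)))
    (add (mul (numPos r) (den q)) (mul (numNeg q) (den r)))

def ratLe (q r : Tm Γ Ty.nat) : Fm Γ := (ratLt r q).neg

/-- The rational `m / 2 ^ n`. -/
def dyadic (m n : Tm Γ Ty.nat) : Tm Γ Ty.nat := mkRat m zero (pow2 n)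

/-! ## Real numbers -/

/-- `x ∈ ℝ`: the type `1` object `x` is a sequence of rationals with
`|x(n) - x(n + i)| < 2 ^ (-n)` for all `n, i`. -/
def isReal (x : Tm Γ Ty.one) : Fm Γ :=
  Fm.all Ty.nat (Fm.all Ty.nat
    (ratLt (ratAbs (ratSub (Tm.app x.wk.wk v1) (Tm.app x.wk.wk (add v1 v0)))) (dyadic one v1)))

/-- `x =_ℝ y`: `|x(n) - y(n)| ≤ 2 ^ (-n + 1)` for all `n`. -/
def realEq (x y : Tm Γ Ty.one) : Fm Γ :=
  Fm.all Ty.nat (ratLe (ratAbs (ratSub (Tm.app x.wk v0) (Tm.app y.wk v0))) (dyadic two v0))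

/-- `x <_ℝ y`: `y(n) - x(n) > 2 ^ (-n + 1)` for some `n`. -/
def realLt (x y : Tm Γ Ty.one) : Fm Γ :=
  Fm.ex Ty.nat (ratLt (dyadic two v0) (ratSub (Tm.app y.wk v0) (Tm.app x.wk v0)))

def realLe (x y : Tm Γ Ty.one) : Fm Γ := (realLt y x).neg

/-- The real number given by a natural number. -/
def realOfNat (m : Tm Γ Ty.nat) : Tm Γ Ty.one := lam (mkRat m.wk zero one)

/-- `x + y` is the sequence `n ↦ x(n + 1) + y(n + 1)`. -/
def realAdd (x y : Tm Γ Ty.one) : Tm Γ Ty.one :=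
  lam (ratAdd (Tm.app x.wk (succ v0)) (Tm.app y.wk (succ v0)))

def realNeg (x : Tm Γ Ty.one) : Tm Γ Ty.one := lam (ratNeg (Tm.app x.wk v0))
def realSub (x y : Tm Γ Ty.one) : Tm Γ Ty.one := realAdd x (realNeg y)

/-- `x ∈ I`, where `I` is the unit interval `[0, 1]`. -/
def inI (x : Tm Γ Ty.one) : Fm Γ :=
  (isReal x).and ((realLe (realOfNat zero) x).and (realLe x (realOfNat one)))

/-- The functionals that represent functions from `ℝ` to `ℝ`. -/
abbrev Ty.fn : Ty := Ty.one ⇒ Ty.one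

/-- `F : D → ℝ`, for a set `D` of reals: `F` maps representatives of elements of `D` to reals, and
equal ones to equal reals. -/
def isFunOn (D : ∀ {Δ : Ctx}, Tm Δ Ty.one → Fm Δ) (F : Tm Γ Ty.fn) : Fm Γ :=
  (Fm.all Ty.one ((D v0).imp (isReal (Tm.app F.wk v0)))).and
    (Fm.all Ty.one (Fm.all Ty.one ((D v1).imp ((D v0).imp
      ((realEq v1 v0).imp (realEq (Tm.app F.wk.wk v1) (Tm.app F.wk.wk v0)))))))

/-- `F(x) >_ℝ 0` for all `x ∈ ℝ`. -/
def isPos (F : Tm Γ Ty.fn) : Fm Γ :=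
  Fm.all Ty.one ((isReal v0).imp (realLt (realOfNat zero) (Tm.app F.wk v0)))

/-- `x ∈ I_y^F`, where `I_y^F` is the open interval `(y - F(y), y + F(y))`. -/
def inBall (F : Tm Γ Ty.fn) (y x : Tm Γ Ty.one) : Fm Γ :=
  (realLt (realSub y (Tm.app F y)) x).and (realLt x (realAdd y (Tm.app F y)))

/-- The intervals `I_y^F` for `y ∈ I` cover `I`. -/
def covers (F : Tm Γ Ty.fn) : Fm Γ :=
  Fm.all Ty.one ((inI v0).imp (Fm.ex Ty.one ((inI v0).and (inBall F.wk.wk v0 v1))))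

/-- `(∃ y_1, …, y_k ∈ I)(∀ x ∈ I)(∃ i ≤ k)(x ∈ I_{y_i}^F)`. The finite sequence is given by its
length `k` and an object `y` of type `0 ⇒ 1`, of which the values `y(i)` for `i < k` count. -/
def finiteSubcover (F : Tm Γ Ty.fn) : Fm Γ :=
  Fm.ex Ty.nat (Fm.ex (Ty.nat ⇒ Ty.one)
    ((Fm.all Ty.nat ((Fm.lt v0 v2).imp (inI (Tm.app v1 v0)))).and
      (Fm.all Ty.one ((inI v0).imp
        (Fm.ex Ty.nat ((Fm.lt v0 v3).and
          (inBall F.wk.wk.wk.wk (Tm.app v2 v0) v1)))))))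

end Arithmetic

/-! ## The two covering principles and the base theory -/

/-- Heine-Borel for canonical covers: for every `Ψ : ℝ → ℝ⁺`, finitely many of the intervals
`I_y^Ψ` with `y ∈ I` cover `I`. -/
def HBU : Fm [] :=
  Fm.all Ty.fn (((isFunOn isReal v0).and (isPos v0)).imp (finiteSubcover v0))

/-- Heine-Borel for covers with possibly empty intervals: for every `ψ : I → ℝ`, if the intervals
`I_y^ψ` with `y ∈ I` cover `I`, then finitely many of them do. -/
def HBT : Fm [] :=
  Fm.all Ty.fn ((isFunOn inI v0).imp ((covers v0).imp (finiteSubcover v0)))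

/-- `RCA_0^ω + QF-AC^{1,1}`. -/
def baseTheory : Theory := RCA0.plus (QFAC Ty.one Ty.one)

end HOA

/-!
# Heine-Borel for canonical covers and for covers with possibly empty intervals

The equivalence is proved semantically. Henkin's construction gives the completeness theorem
`Theory.proves_of_models`: a sentence that is true in all extensional models of the base theory is
provable. The rest of the argument takes place in an arbitrary model `𝓜` of the base theory. Its
numbers need not be standard, and induction holds only for quantifier-free formulas
(`qf_induction`), with objects of the model as parameters.

To calculate with the reals of a model, its numbers are embedded in an ordered field `𝓜.F`, an
ultrapower of their field of fractions along an ultrafilter that contains all final segments. A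
sequence `x` that represents a real then has a limit `limVal x` in this field, with
`|x(n) - limVal x| ≤ 2 ^ (-n)`. The equality and the order of reals become the relations `Near` and
`FarLt` between limits, and estimates become linear arithmetic in an ordered field.

Covers with possibly empty intervals include the canonical ones, since `x` lies in its own interval
if the interval is not empty (`sat_HBU_of_sat_HBT`). Conversely, let the intervals given by
`F : I → ℝ` cover `I`. It suffices to find a canonical cover `Ψ` such that each interval of `Ψ` lies
in an interval of `F` whose centre depends on it by an operation of the model
(`hasFiniteSubcover_of_refinement`). For `x` in the interval of `F` around `c`, the distance from
`x` to the complement of that interval is `F(c) - |x - c|`; an interval around `x` with at most this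
radius lies in the interval around `c`. There are two cases.

* Every point of `I` lies in an interval of `F` with a rational centre. Then let `Ψ(x)` be half of
  the supremum over the rationals `q_n` in `I` of the distances of `x` to the complements of their
  intervals, where the `n`-th distance is restricted to `[0, 2 ^ (-n)]`. The restriction makes the
  supremum computable from approximations (`IsHalfSup`), and the supremum does not depend on the
  representative of `x`. Some `q_n` has a distance greater than half of the supremum; it can be
  found by search, which is an application of `QF-AC` (`hasFiniteSubcover_of_unitConst`).
* Some `x` lies in an interval of `F`, but in none with a rational centre. Then `F` is
  discontinuous, and Grilliot's trick yields a functional that finds a zero of every sequence that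
  has one (`exists_isMu`). With this functional, arithmetical formulas are equivalent to
  quantifier-free ones (`exists_charTerm`). So `QF-AC^{1,1}` gives a choice of a centre for every
  `x`, and a canonical representative of every real can be defined, so that the choice respects the
  equality of reals. Then `Ψ(x)` is the distance of `x` to the complement of the interval of the
  chosen centre (`hasFiniteSubcover_of_isMu`).
-/

namespace HOA

/-! ### Renaming and substitution -/

/-- Renamings of the variables of `Γ` by variables of `Δ`. -/
abbrev Ren (Γ Δ : Ctx) : Type := ∀ τ : Ty, Var Γ τ → Var Δ τ

/-- Substitutions of terms in the context `Δ` for the variables of `Γ`. -/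
abbrev Sub (Γ Δ : Ctx) : Type := ∀ τ : Ty, Var Γ τ → Tm Δ τ

theorem liftRen_comp {Γ Δ Ε : Ctx} (r : Ren Γ Δ) (r' : Ren Δ Ε) (σ : Ty) :
    (fun τ x => liftRen r' σ τ (liftRen r σ τ x)) = liftRen (fun τ x => r' τ (r τ x)) σ := by
  funext τ x; cases x <;> rfl

theorem liftRen_id {Γ : Ctx} (σ : Ty) :
    liftRen (fun τ (x : Var Γ τ) => x) σ = fun _ x => x := by
  funext τ x; cases x <;> rfl

theorem Tm.rename_rename {Γ Δ Ε : Ctx} (r : Ren Γ Δ) (r' : Ren Δ Ε) {τ : Ty} (t : Tm Γ τ) :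
    (t.rename r).rename r' = t.rename fun τ x => r' τ (r τ x) := by
  induction t <;> simp_all [Tm.rename]

theorem Fm.rename_rename : ∀ {Γ Δ Ε : Ctx} (A : Fm Γ) (r : Ren Γ Δ) (r' : Ren Δ Ε),
    (A.rename r).rename r' = A.rename fun τ x => r' τ (r τ x)
  | _, _, _, Fm.eq s t, r, r' => by simp [Fm.rename, Tm.rename_rename]
  | _, _, _, Fm.lt s t, r, r' => by simp [Fm.rename, Tm.rename_rename]
  | _, _, _, Fm.bot, r, r' => rfl
  | _, _, _, Fm.imp A B, r, r' => by
      simp [Fm.rename, Fm.rename_rename A, Fm.rename_rename B]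
  | _, _, _, Fm.all σ A, r, r' => by
      simp [Fm.rename, Fm.rename_rename A, liftRen_comp]

theorem Tm.rename_id {Γ : Ctx} {τ : Ty} (t : Tm Γ τ) : t.rename (fun _ x => x) = t := by
  induction t <;> simp_all [Tm.rename]

theorem Fm.rename_id : ∀ {Γ : Ctx} (A : Fm Γ), A.rename (fun _ x => x) = A
  | _, Fm.eq s t => by simp [Fm.rename, Tm.rename_id]
  | _, Fm.lt s t => by simp [Fm.rename, Tm.rename_id]
  | _, Fm.bot => rfl
  | _, Fm.imp A B => by simp [Fm.rename, Fm.rename_id A, Fm.rename_id B]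
  | _, Fm.all σ A => by simp [Fm.rename, liftRen_id, Fm.rename_id A]

theorem Tm.wk_rename {Γ Δ : Ctx} (r : Ren Γ Δ) {σ τ : Ty} (t : Tm Γ τ) :
    (t.wk (σ := σ)).rename (liftRen r σ) = (t.rename r).wk := by
  simp [Tm.wk, Tm.rename_rename, liftRen]

theorem Fm.wk_rename {Γ Δ : Ctx} (r : Ren Γ Δ) {σ : Ty} (A : Fm Γ) :
    (A.wk (σ := σ)).rename (liftRen r σ) = (A.rename r).wk := by
  simp [Fm.wk, Fm.rename_rename, liftRen]

theorem Tm.subst_rename {Γ Δ Ε : Ctx} (θ : Sub Γ Δ) (r : Ren Δ Ε) {τ : Ty} (t : Tm Γ τ) :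
    (t.subst θ).rename r = t.subst fun τ x => (θ τ x).rename r := by
  induction t <;> simp_all [Tm.rename, Tm.subst]

theorem Tm.rename_subst {Γ Δ Ε : Ctx} (r : Ren Γ Δ) (θ : Sub Δ Ε) {τ : Ty} (t : Tm Γ τ) :
    (t.rename r).subst θ = t.subst fun τ x => θ τ (r τ x) := by
  induction t <;> simp_all [Tm.rename, Tm.subst]

theorem Fm.subst_rename : ∀ {Γ Δ Ε : Ctx} (A : Fm Γ) (θ : Sub Γ Δ) (r : Ren Δ Ε),
    (A.subst θ).rename r = A.subst fun τ x => (θ τ x).rename r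
  | _, _, _, Fm.eq s t, θ, r => by simp [Fm.rename, Fm.subst, Tm.subst_rename]
  | _, _, _, Fm.lt s t, θ, r => by simp [Fm.rename, Fm.subst, Tm.subst_rename]
  | _, _, _, Fm.bot, θ, r => rfl
  | _, _, _, Fm.imp A B, θ, r => by
      simp [Fm.rename, Fm.subst, Fm.subst_rename A, Fm.subst_rename B]
  | _, _, _, Fm.all σ A, θ, r => by
      simp only [Fm.rename, Fm.subst, Fm.subst_rename A]
      congr 2
      funext τ x
      cases x with
      | z => rfl
      | s x => exact Tm.wk_rename _ _

theorem Fm.rename_subst : ∀ {Γ Δ Ε : Ctx} (A : Fm Γ) (r : Ren Γ Δ) (θ : Sub Δ Ε),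
    (A.rename r).subst θ = A.subst fun τ x => θ τ (r τ x)
  | _, _, _, Fm.eq s t, r, θ => by simp [Fm.rename, Fm.subst, Tm.rename_subst]
  | _, _, _, Fm.lt s t, r, θ => by simp [Fm.rename, Fm.subst, Tm.rename_subst]
  | _, _, _, Fm.bot, r, θ => rfl
  | _, _, _, Fm.imp A B, r, θ => by
      simp [Fm.rename, Fm.subst, Fm.rename_subst A, Fm.rename_subst B]
  | _, _, _, Fm.all σ A, r, θ => by
      simp only [Fm.rename, Fm.subst, Fm.rename_subst A]
      congr 2
      funext τ x
      cases x <;> rfl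

theorem Tm.subst_var {Γ : Ctx} {τ : Ty} (t : Tm Γ τ) : t.subst (fun _ x => Tm.var x) = t := by
  induction t <;> simp_all [Tm.subst]

theorem Fm.subst_var : ∀ {Γ : Ctx} (A : Fm Γ), A.subst (fun _ x => Tm.var x) = A
  | _, Fm.eq s t => by simp [Fm.subst, Tm.subst_var]
  | _, Fm.lt s t => by simp [Fm.subst, Tm.subst_var]
  | _, Fm.bot => rfl
  | _, Fm.imp A B => by simp [Fm.subst, Fm.subst_var A, Fm.subst_var B]
  | Γ, Fm.all σ A => by
      have : liftSub (fun τ (x : Var Γ τ) => Tm.var x) σ = fun τ x => Tm.var x := by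
        funext τ x; cases x <;> rfl
      simp [Fm.subst, this, Fm.subst_var A]

theorem Fm.inst_rename {Γ Δ : Ctx} (r : Ren Γ Δ) {σ : Ty} (A : Fm (σ :: Γ)) (t : Tm Γ σ) :
    (A.inst t).rename r = (A.rename (liftRen r σ)).inst (t.rename r) := by
  simp only [Fm.inst, Fm.subst_rename, Fm.rename_subst]
  congr 1
  funext τ x
  cases x <;> rfl

theorem Tm.wk_inst {Γ : Ctx} {σ τ : Ty} (t : Tm Γ τ) (s : Tm Γ σ) :
    t.wk.subst (instSub s) = t := by
  simp only [Tm.wk, Tm.rename_subst, instSub, Tm.subst_var]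

/-- The number of connectives and quantifiers, which substitution does not change. -/
def Fm.size : ∀ {Γ : Ctx}, Fm Γ → ℕ
  | _, Fm.eq _ _ => 0
  | _, Fm.lt _ _ => 0
  | _, Fm.bot => 0
  | _, Fm.imp A B => A.size + B.size + 1
  | _, Fm.all _ A => A.size + 1

theorem Fm.size_rename : ∀ {Γ Δ : Ctx} (A : Fm Γ) (r : Ren Γ Δ), (A.rename r).size = A.size
  | _, _, Fm.eq _ _, _ => rfl
  | _, _, Fm.lt _ _, _ => rfl
  | _, _, Fm.bot, _ => rfl
  | _, _, Fm.imp A B, r => by simp [Fm.size, Fm.rename, Fm.size_rename A, Fm.size_rename B]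
  | _, _, Fm.all _ A, r => by simp [Fm.size, Fm.rename, Fm.size_rename A]

theorem Fm.size_subst : ∀ {Γ Δ : Ctx} (A : Fm Γ) (θ : Sub Γ Δ), (A.subst θ).size = A.size
  | _, _, Fm.eq _ _, _ => rfl
  | _, _, Fm.lt _ _, _ => rfl
  | _, _, Fm.bot, _ => rfl
  | _, _, Fm.imp A B, θ => by simp [Fm.size, Fm.subst, Fm.size_subst A, Fm.size_subst B]
  | _, _, Fm.all _ A, θ => by simp [Fm.size, Fm.subst, Fm.size_subst A]

theorem eqT_rename : ∀ (τ : Ty) {Γ Δ : Ctx} (s t : Tm Γ τ) (r : Ren Γ Δ),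
    (eqT τ s t).rename r = eqT τ (s.rename r) (t.rename r)
  | Ty.nat, _, _, _, _, _ => rfl
  | Ty.arr σ τ, _, _, s, t, r => by
      simp only [eqT, Fm.rename, eqT_rename τ, Tm.rename, Tm.wk_rename, liftRen]

theorem eqT_subst : ∀ (τ : Ty) {Γ Δ : Ctx} (s t : Tm Γ τ) (θ : Sub Γ Δ),
    (eqT τ s t).subst θ = eqT τ (s.subst θ) (t.subst θ)
  | Ty.nat, _, _, _, _, _ => rfl
  | Ty.arr σ τ, _, _, s, t, θ => by
      have h (u : Tm _ (σ ⇒ τ)) : (u.wk (σ := σ)).subst (liftSub θ σ) = (u.subst θ).wk := by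
        simp only [Tm.wk, Tm.rename_subst, Tm.subst_rename]; rfl
      simp only [eqT, Fm.subst, eqT_subst τ, Tm.subst, h, liftSub]

theorem Fm.QF.rename {Γ Δ : Ctx} {A : Fm Γ} (h : A.QF) (r : Ren Γ Δ) : (A.rename r).QF := by
  induction A generalizing Δ with
  | imp A B ihA ihB => exact ⟨ihA h.1 r, ihB h.2 r⟩
  | all σ A => exact h.elim
  | _ => trivial

/-! ### Structural properties of derivations -/

theorem Prf.weaken {T : Theory} {Γ : Ctx} {H : List (Fm Γ)} {A : Fm Γ} (h : Prf T H A) :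
    ∀ {H' : List (Fm Γ)}, H ⊆ H' → Prf T H' A := by
  induction h with
  | ax h => exact fun _ => Prf.ax h
  | hyp h => exact fun hs => Prf.hyp (hs h)
  | impI _ ih => exact fun hs => Prf.impI (ih (List.cons_subset_cons _ hs))
  | impE _ _ ih1 ih2 => exact fun hs => Prf.impE (ih1 hs) (ih2 hs)
  | raa _ ih => exact fun hs => Prf.raa (ih (List.cons_subset_cons _ hs))
  | allI _ ih => exact fun hs => Prf.allI (ih (List.map_subset _ hs))
  | allE t _ ih => exact fun hs => Prf.allE t (ih hs)
  | eqRefl t => exact fun _ => Prf.eqRefl t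
  | eqSubst A _ _ ih1 ih2 => exact fun hs => Prf.eqSubst A (ih1 hs) (ih2 hs)

/-- The theory `T` is closed under renaming of free variables. -/
def Theory.RenClosed (T : Theory) : Prop :=
  ∀ {Γ Δ : Ctx} (r : Ren Γ Δ) (A : Fm Γ), T Γ A → T Δ (A.rename r)

theorem Prf.rename {T : Theory} (hT : T.RenClosed) {Γ : Ctx} {H : List (Fm Γ)} {A : Fm Γ}
    (h : Prf T H A) : ∀ {Δ : Ctx} (r : Ren Γ Δ), Prf T (H.map (Fm.rename r)) (A.rename r) := by
  induction h with
  | ax h => exact fun r => Prf.ax (hT r _ h)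
  | hyp h => exact fun r => Prf.hyp (List.mem_map_of_mem h)
  | impI _ ih => exact fun r => Prf.impI (ih r)
  | impE _ _ ih1 ih2 => exact fun r => Prf.impE (ih1 r) (ih2 r)
  | raa _ ih => exact fun r => Prf.raa (ih r)
  | allI _ ih =>
    intro Δ r
    refine Prf.allI ?_
    have := ih (liftRen r _)
    simpa [List.map_map, Function.comp_def, Fm.wk_rename] using this
  | allE t _ ih => intro Δ r; rw [Fm.inst_rename]; exact Prf.allE _ (ih r)
  | eqRefl t => exact fun r => Prf.eqRefl _
  | eqSubst A _ _ ih1 ih2 =>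
    intro Δ r
    have h2 := ih2 r
    rw [Fm.inst_rename] at h2 ⊢
    exact Prf.eqSubst _ (ih1 r) h2

theorem Prf.cut {T : Theory} {Γ : Ctx} {H : List (Fm Γ)} {A B : Fm Γ} (h : Prf T (A :: H) B)
    (hA : Prf T H A) : Prf T H B :=
  Prf.impE (Prf.impI h) hA

theorem Prf.exfalso {T : Theory} {Γ : Ctx} {H : List (Fm Γ)} {A : Fm Γ} (h : Prf T H Fm.bot) :
    Prf T H A :=
  Prf.raa (h.weaken (List.subset_cons_self _ _))

/-- Every finite type has a closed term. -/
def closedTm {Γ : Ctx} : ∀ τ : Ty, Tm Γ τ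
  | Ty.nat => Tm.con Con.zero
  | Ty.arr σ τ => Tm.app (Tm.con (Con.proj τ σ)) (closedTm τ)

/-- Adding a fresh variable to the context keeps the assumptions consistent, since every type is
inhabited by a closed term. -/
theorem Prf.bot_of_wk {T : Theory} {Γ : Ctx} {H : List (Fm Γ)} {σ : Ty}
    (h : Prf T (H.map (Fm.wk (σ := σ))) Fm.bot) : Prf T H Fm.bot :=
  Prf.allE (A := Fm.bot) (closedTm σ) (Prf.allI h)

/-! ### The language is countable -/

/-- A Gödel number of a type. -/
def Ty.code : Ty → ℕ
  | Ty.nat => 0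
  | Ty.arr σ τ => Nat.pair σ.code τ.code + 1

theorem Ty.code_inj : ∀ {σ τ : Ty}, σ.code = τ.code → σ = τ
  | Ty.nat, Ty.nat, _ => rfl
  | Ty.nat, Ty.arr _ _, h => by simp [Ty.code] at h
  | Ty.arr _ _, Ty.nat, h => by simp [Ty.code] at h
  | Ty.arr σ τ, Ty.arr σ' τ', h => by
      simp only [Ty.code, Nat.add_right_cancel_iff, Nat.pair_eq_pair] at h
      rw [Ty.code_inj h.1, Ty.code_inj h.2]

/-- The de Bruijn index; within a fixed context it determines the variable and its type. -/
def Var.code : ∀ {Γ : Ctx} {τ : Ty}, Var Γ τ → ℕ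
  | _, _, Var.z => 0
  | _, _, Var.s x => x.code + 1

theorem Var.code_inj : ∀ {Γ : Ctx} {τ : Ty} {x y : Var Γ τ}, x.code = y.code → x = y
  | _, _, Var.z, Var.z, _ => rfl
  | _, _, Var.z, Var.s _, h => by simp [Var.code] at h
  | _, _, Var.s _, Var.z, h => by simp [Var.code] at h
  | _, _, Var.s x, Var.s y, h => by
      simp only [Var.code, Nat.add_right_cancel_iff] at h
      rw [Var.code_inj h]

/-- A Gödel number of a constant, which determines its type. -/
def Con.code : ∀ {τ : Ty}, Con τ → ℕ
  | _, Con.zero => Nat.pair 0 0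
  | _, Con.one => Nat.pair 1 0
  | _, Con.add => Nat.pair 2 0
  | _, Con.mul => Nat.pair 3 0
  | _, Con.proj σ τ => Nat.pair 4 (Nat.pair σ.code τ.code)
  | _, Con.comb ρ σ τ => Nat.pair 5 (Nat.pair ρ.code (Nat.pair σ.code τ.code))
  | _, Con.recur σ => Nat.pair 6 σ.code

theorem Con.code_inj {σ τ : Ty} {c : Con σ} {d : Con τ} (h : c.code = d.code) :
    (⟨σ, c⟩ : Σ τ, Con τ) = ⟨τ, d⟩ := by
  cases c <;> cases d <;> simp only [Con.code, Nat.pair_eq_pair] at h <;>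
    first
    | rfl
    | (exfalso; omega)
    | (obtain ⟨-, h1, h2, h3⟩ := h
       cases Ty.code_inj h1; cases Ty.code_inj h2; cases Ty.code_inj h3; rfl)
    | (obtain ⟨-, h1, h2⟩ := h; cases Ty.code_inj h1; cases Ty.code_inj h2; rfl)
    | (obtain ⟨-, h1⟩ := h; cases Ty.code_inj h1; rfl)

/-- A Gödel number of a term, for a given context and type. -/
def Tm.code {Γ : Ctx} : ∀ {τ : Ty}, Tm Γ τ → ℕ
  | _, Tm.var x => Nat.pair 0 x.code
  | _, Tm.con c => Nat.pair 1 c.code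
  | _, Tm.app (σ := σ) f a => Nat.pair 2 (Nat.pair σ.code (Nat.pair f.code a.code))

theorem Tm.code_inj {Γ : Ctx} : ∀ {τ : Ty} {s t : Tm Γ τ}, s.code = t.code → s = t
  | _, Tm.var x, t, h => by
      cases t <;> simp only [Tm.code, Nat.pair_eq_pair] at h
      · rw [Var.code_inj h.2]
      all_goals omega
  | _, Tm.con c, t, h => by
      cases t <;> simp only [Tm.code, Nat.pair_eq_pair] at h
      · omega
      · cases Con.code_inj h.2; rfl
      · omega
  | _, Tm.app f a, t, h => by
      cases t <;> simp only [Tm.code, Nat.pair_eq_pair] at h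
      · omega
      · omega
      · obtain ⟨-, h1, h2, h3⟩ := h
        cases Ty.code_inj h1
        rw [Tm.code_inj h2, Tm.code_inj h3]

/-- A Gödel number of a formula, for a given context. -/
def Fm.code : ∀ {Γ : Ctx}, Fm Γ → ℕ
  | _, Fm.eq s t => Nat.pair 0 (Nat.pair s.code t.code)
  | _, Fm.lt s t => Nat.pair 1 (Nat.pair s.code t.code)
  | _, Fm.bot => Nat.pair 2 0
  | _, Fm.imp A B => Nat.pair 3 (Nat.pair A.code B.code)
  | _, Fm.all σ A => Nat.pair 4 (Nat.pair σ.code A.code)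

theorem Fm.code_inj : ∀ {Γ : Ctx} {A B : Fm Γ}, A.code = B.code → A = B
  | _, Fm.eq s t, B, h => by
      cases B <;> simp only [Fm.code, Nat.pair_eq_pair] at h
      · rw [Tm.code_inj h.2.1, Tm.code_inj h.2.2]
      all_goals omega
  | _, Fm.lt s t, B, h => by
      cases B <;> simp only [Fm.code, Nat.pair_eq_pair] at h
      · omega
      · rw [Tm.code_inj h.2.1, Tm.code_inj h.2.2]
      all_goals omega
  | _, Fm.bot, B, h => by
      cases B <;> simp only [Fm.code, Nat.pair_eq_pair] at h
      all_goals first | rfl | omega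
  | _, Fm.imp A A', B, h => by
      cases B <;> simp only [Fm.code, Nat.pair_eq_pair] at h
      case imp => rw [Fm.code_inj h.2.1, Fm.code_inj h.2.2]
      all_goals omega
  | _, Fm.all σ A, B, h => by
      cases B <;> simp only [Fm.code, Nat.pair_eq_pair] at h
      case all =>
        cases Ty.code_inj h.2.1
        rw [Fm.code_inj h.2.2]
      all_goals omega

theorem Fm.exists_enum (Γ : Ctx) : ∃ f : ℕ → Fm Γ, Function.Surjective f := by
  have : Countable (Fm Γ) := Function.Injective.countable (f := Fm.code) fun _ _ => Fm.code_inj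
  have : Nonempty (Fm Γ) := ⟨Fm.bot⟩
  exact exists_surjective_nat _

/-- An enumeration of the formulas in the context `Γ`. -/
noncomputable def Fm.enum (Γ : Ctx) : ℕ → Fm Γ := (Fm.exists_enum Γ).choose

theorem Fm.enum_surjective (Γ : Ctx) : Function.Surjective (Fm.enum Γ) :=
  (Fm.exists_enum Γ).choose_spec

/-! ### Models -/

/-- Extensional models of the language: a domain for each finite type, with application,
interpretations of the constants, and an order relation on the domain of type `0`. -/
structure Model where
  M : Ty → Type
  app : ∀ {σ τ : Ty}, M (σ ⇒ τ) → M σ → M τ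
  con : ∀ {τ : Ty}, Con τ → M τ
  lt : M Ty.nat → M Ty.nat → Prop
  ext : ∀ {σ τ : Ty} {f g : M (σ ⇒ τ)}, (∀ a, app f a = app g a) → f = g

/-- Assignments of elements of the model to the variables of a context. -/
abbrev Env (𝓜 : Model) (Γ : Ctx) : Type := ∀ τ : Ty, Var Γ τ → 𝓜.M τ

/-- The assignment for the empty context. -/
def Env.nil {𝓜 : Model} : Env 𝓜 [] := fun _ x => nomatch x

/-- The assignment that gives the most recent variable the value `a`. -/
def Env.cons {𝓜 : Model} {Γ : Ctx} {σ : Ty} (a : 𝓜.M σ) (e : Env 𝓜 Γ) : Env 𝓜 (σ :: Γ)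
  | _, Var.z => a
  | _, Var.s x => e _ x

@[simp] theorem Env.cons_z {𝓜 : Model} {Γ : Ctx} {σ : Ty} (a : 𝓜.M σ) (e : Env 𝓜 Γ) :
    Env.cons a e σ Var.z = a := rfl

@[simp] theorem Env.cons_s {𝓜 : Model} {Γ : Ctx} {σ τ : Ty} (a : 𝓜.M σ) (e : Env 𝓜 Γ)
    (x : Var Γ τ) : Env.cons a e τ (Var.s x) = e τ x := rfl

/-- The value of a term. -/
def eval {𝓜 : Model} {Γ : Ctx} (e : Env 𝓜 Γ) : ∀ {τ : Ty}, Tm Γ τ → 𝓜.M τ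
  | _, Tm.var x => e _ x
  | _, Tm.con c => 𝓜.con c
  | _, Tm.app f a => 𝓜.app (eval e f) (eval e a)

/-- Truth of a formula. -/
def sat {𝓜 : Model} : ∀ {Γ : Ctx}, Env 𝓜 Γ → Fm Γ → Prop
  | _, e, Fm.eq s t => eval e s = eval e t
  | _, e, Fm.lt s t => 𝓜.lt (eval e s) (eval e t)
  | _, _, Fm.bot => False
  | _, e, Fm.imp A B => sat e A → sat e B
  | _, e, Fm.all σ A => ∀ a : 𝓜.M σ, sat (Env.cons a e) A

section Semantics

variable {𝓜 : Model} {Γ Δ : Ctx}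

@[simp] theorem eval_var (e : Env 𝓜 Γ) {τ : Ty} (x : Var Γ τ) : eval e (Tm.var x) = e τ x := rfl

@[simp] theorem eval_app (e : Env 𝓜 Γ) {σ τ : Ty} (f : Tm Γ (σ ⇒ τ)) (a : Tm Γ σ) :
    eval e (Tm.app f a) = 𝓜.app (eval e f) (eval e a) := rfl

theorem eval_rename (r : Ren Γ Δ) (e : Env 𝓜 Δ) {τ : Ty} (t : Tm Γ τ) :
    eval e (t.rename r) = eval (fun τ x => e τ (r τ x)) t := by
  induction t <;> simp_all [Tm.rename, eval]

theorem eval_subst (θ : Sub Γ Δ) (e : Env 𝓜 Δ) {τ : Ty} (t : Tm Γ τ) :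
    eval e (t.subst θ) = eval (fun τ x => eval e (θ τ x)) t := by
  induction t <;> simp_all [Tm.subst, eval]

@[simp] theorem eval_wk {σ : Ty} (a : 𝓜.M σ) (e : Env 𝓜 Γ) {τ : Ty} (t : Tm Γ τ) :
    eval (Env.cons a e) t.wk = eval e t := by
  simp [Tm.wk, eval_rename]

theorem Env.cons_liftRen (r : Ren Γ Δ) (e : Env 𝓜 Δ) {σ : Ty} (a : 𝓜.M σ) :
    (fun τ x => Env.cons a e τ (liftRen r σ τ x)) = Env.cons a fun τ x => e τ (r τ x) := by
  funext τ x; cases x <;> rfl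

theorem sat_rename : ∀ {Γ Δ : Ctx} (A : Fm Γ) (r : Ren Γ Δ) (e : Env 𝓜 Δ),
    sat e (A.rename r) ↔ sat (fun τ x => e τ (r τ x)) A
  | _, _, Fm.eq s t, r, e => by simp [Fm.rename, sat, eval_rename]
  | _, _, Fm.lt s t, r, e => by simp [Fm.rename, sat, eval_rename]
  | _, _, Fm.bot, r, e => by simp [Fm.rename, sat]
  | _, _, Fm.imp A B, r, e => by simp [Fm.rename, sat, sat_rename A, sat_rename B]
  | _, _, Fm.all σ A, r, e => by simp [Fm.rename, sat, sat_rename A, Env.cons_liftRen]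

theorem sat_subst : ∀ {Γ Δ : Ctx} (A : Fm Γ) (θ : Sub Γ Δ) (e : Env 𝓜 Δ),
    sat e (A.subst θ) ↔ sat (fun τ x => eval e (θ τ x)) A
  | _, _, Fm.eq s t, θ, e => by simp [Fm.subst, sat, eval_subst]
  | _, _, Fm.lt s t, θ, e => by simp [Fm.subst, sat, eval_subst]
  | _, _, Fm.bot, θ, e => by simp [Fm.subst, sat]
  | _, _, Fm.imp A B, θ, e => by simp [Fm.subst, sat, sat_subst A, sat_subst B]
  | _, _, Fm.all σ A, θ, e => by
      have (a : 𝓜.M σ) : (fun τ x => eval (Env.cons a e) (liftSub θ σ τ x)) =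
          Env.cons a fun τ x => eval e (θ τ x) := by
        funext τ x
        cases x with
        | z => rfl
        | s x => exact eval_wk _ _ _
      simp [Fm.subst, sat, sat_subst A, this]

theorem sat_inst {σ : Ty} (A : Fm (σ :: Γ)) (t : Tm Γ σ) (e : Env 𝓜 Γ) :
    sat e (A.inst t) ↔ sat (Env.cons (eval e t) e) A := by
  rw [Fm.inst, sat_subst]
  have : (fun τ x => eval e (instSub t τ x)) = Env.cons (eval e t) e := by
    funext τ x; cases x <;> rfl
  rw [this]

@[simp] theorem sat_eq (e : Env 𝓜 Γ) (s t : Tm Γ Ty.nat) :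
    sat e (Fm.eq s t) ↔ eval e s = eval e t := Iff.rfl

@[simp] theorem sat_bot (e : Env 𝓜 Γ) : sat e Fm.bot ↔ False := Iff.rfl

@[simp] theorem sat_imp (e : Env 𝓜 Γ) (A B : Fm Γ) :
    sat e (A.imp B) ↔ (sat e A → sat e B) := Iff.rfl

@[simp] theorem sat_all (e : Env 𝓜 Γ) {σ : Ty} (A : Fm (σ :: Γ)) :
    sat e (Fm.all σ A) ↔ ∀ a, sat (Env.cons a e) A := Iff.rfl

@[simp] theorem sat_neg (e : Env 𝓜 Γ) (A : Fm Γ) : sat e A.neg ↔ ¬ sat e A := Iff.rfl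

@[simp] theorem sat_and (e : Env 𝓜 Γ) (A B : Fm Γ) : sat e (A.and B) ↔ sat e A ∧ sat e B := by
  simp [Fm.and]

@[simp] theorem sat_or (e : Env 𝓜 Γ) (A B : Fm Γ) : sat e (A.or B) ↔ sat e A ∨ sat e B := by
  simp only [Fm.or, sat_imp, sat_neg]; tauto

@[simp] theorem sat_iff (e : Env 𝓜 Γ) (A B : Fm Γ) :
    sat e (A.iff B) ↔ (sat e A ↔ sat e B) := by
  simp only [Fm.iff, sat_and, sat_imp]; tauto

@[simp] theorem sat_ex (e : Env 𝓜 Γ) {σ : Ty} (A : Fm (σ :: Γ)) :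
    sat e (Fm.ex σ A) ↔ ∃ a, sat (Env.cons a e) A := by
  simp [Fm.ex]

/-- In an extensional model, the defined equality is equality. -/
theorem sat_eqT : ∀ (τ : Ty) {Γ : Ctx} (e : Env 𝓜 Γ) (s t : Tm Γ τ),
    sat e (eqT τ s t) ↔ eval e s = eval e t
  | Ty.nat, _, _, _, _ => Iff.rfl
  | Ty.arr σ τ, _, e, s, t => by
      simp only [eqT, sat_all, sat_eqT τ, eval_app, eval_wk, eval_var, Env.cons_z]
      exact ⟨fun h => 𝓜.ext h, fun h a => by rw [h]⟩

end Semantics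

/-! ### The completeness theorem -/

/-- The type of the quantifier, if `A` is a universal formula. -/
def Fm.witTy {Γ : Ctx} : Fm Γ → Ty
  | Fm.all σ _ => σ
  | _ => Ty.nat

/-- What is assumed of the fresh variable when `A` is found to fail: if `A` is universal, the
variable is a counterexample; otherwise, nothing. -/
def Fm.wit {Γ : Ctx} : (A : Fm Γ) → Fm (A.witTy :: Γ)
  | Fm.all _ B => B.neg
  | Fm.eq _ _ => Fm.bot.neg
  | Fm.lt _ _ => Fm.bot.neg
  | Fm.bot => Fm.bot.neg
  | Fm.imp _ _ => Fm.bot.neg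

/-- A stage of Henkin's construction: the variables introduced so far, the formulas assumed so far,
and an agenda of the formulas still to be decided. -/
structure Stage where
  Γ : Ctx
  H : List (Fm Γ)
  agenda : ℕ → Fm Γ

open Classical in
/-- At stage `n`, decide the `n`-th formula of the agenda. A variable is added to the context at
every step, so that passing to the next stage is always weakening by one variable. The agenda
lists at the positions `Nat.pair i j` the formulas in the context of stage `i`. -/
noncomputable def Stage.next (T : Theory) (n : ℕ) (s : Stage) : Stage where
  Γ := (s.agenda n).witTy :: s.Γ
  H := if Prf T (s.agenda n :: s.H) Fm.bot then
      (s.agenda n).wit :: ((s.agenda n).neg :: s.H).map Fm.wk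
    else (s.agenda n :: s.H).map Fm.wk
  agenda p := if (Nat.unpair p).1 = n + 1 then Fm.enum _ (Nat.unpair p).2 else (s.agenda p).wk

/-- The stages of Henkin's construction for the list `H₀` of sentences. -/
noncomputable def stage (T : Theory) (H₀ : List (Fm [])) : ℕ → Stage
  | 0 => ⟨[], H₀, fun p => Fm.enum _ (Nat.unpair p).2⟩
  | n + 1 => (stage T H₀ n).next T n

theorem Stage.next_consistent {T : Theory} {n : ℕ} {s : Stage} (h : ¬ Prf T s.H Fm.bot) :
    ¬ Prf T (s.next T n).H Fm.bot := by
  intro h'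
  by_cases hA : Prf T (s.agenda n :: s.H) Fm.bot
  · simp only [Stage.next, if_pos hA] at h'
    apply h
    refine Prf.cut (A := (s.agenda n).neg) ?_ (Prf.impI hA)
    generalize s.agenda n = A at h'
    have triv : Prf T (((A.neg :: s.H).map (Fm.wk (σ := A.witTy)))) Fm.bot →
        Prf T (A.neg :: s.H) Fm.bot := Prf.bot_of_wk
    have hb : Prf T (((A.neg :: s.H).map (Fm.wk (σ := A.witTy)))) Fm.bot.neg :=
      Prf.impI (Prf.hyp (List.mem_cons_self))
    cases A with
    | all σ B =>
      have h1 : Prf T (((Fm.all σ B).neg :: s.H).map (Fm.wk (σ := σ))) B := Prf.raa h'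
      exact Prf.impE (Prf.hyp List.mem_cons_self) (Prf.allI h1)
    | _ => exact triv (Prf.cut h' hb)
  · simp only [Stage.next, if_neg hA] at h'
    exact hA (Prf.bot_of_wk h')

section Henkin

variable (T : Theory) (H₀ : List (Fm []))

/-- The context of stage `n`. -/
noncomputable abbrev stageCtx (n : ℕ) : Ctx := (stage T H₀ n).Γ

/-- The inclusion of the variables of stage `n` in those of stage `m`. -/
noncomputable def up {n m : ℕ} (h : n ≤ m) : Ren (stageCtx T H₀ n) (stageCtx T H₀ m) :=
  fun τ => Nat.leRecOn (C := fun k => Var (stageCtx T H₀ k) τ) h fun x => Var.s x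

variable {T H₀}

theorem up_self (n : ℕ) : up T H₀ (le_refl n) = fun _ x => x := by
  funext τ x
  exact Nat.leRecOn_self (C := fun k => Var (stageCtx T H₀ k) τ) x

theorem up_succ {n m : ℕ} (h : n ≤ m) :
    up T H₀ (h.trans (Nat.le_succ m)) = fun τ x => Var.s (up T H₀ h τ x) := by
  funext τ x
  exact Nat.leRecOn_succ (C := fun k => Var (stageCtx T H₀ k) τ) h x

theorem up_up {n m k : ℕ} (h : n ≤ m) (h' : m ≤ k) :
    (fun τ x => up T H₀ h' τ (up T H₀ h τ x)) = up T H₀ (h.trans h') := by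
  funext τ x
  exact (Nat.leRecOn_trans (C := fun k => Var (stageCtx T H₀ k) τ) h h' x).symm

theorem rename_up_self {n : ℕ} (A : Fm (stageCtx T H₀ n)) :
    A.rename (up T H₀ (le_refl n)) = A := by
  rw [up_self, Fm.rename_id]

theorem rename_up_up {n m k : ℕ} (h : n ≤ m) (h' : m ≤ k) (A : Fm (stageCtx T H₀ n)) :
    (A.rename (up T H₀ h)).rename (up T H₀ h') = A.rename (up T H₀ (h.trans h')) := by
  rw [Fm.rename_rename, up_up]

theorem Tm.rename_up_up {n m k : ℕ} (h : n ≤ m) (h' : m ≤ k) {τ : Ty}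
    (t : Tm (stageCtx T H₀ n) τ) :
    (t.rename (up T H₀ h)).rename (up T H₀ h') = t.rename (up T H₀ (h.trans h')) := by
  rw [Tm.rename_rename, up_up]

theorem rename_up_succ {n m : ℕ} (h : n ≤ m) (A : Fm (stageCtx T H₀ n)) :
    A.rename (up T H₀ (h.trans (Nat.le_succ m))) = (A.rename (up T H₀ h)).wk := by
  rw [up_succ h, Fm.wk, Fm.rename_rename]
  rfl

theorem stage_consistent (h : ¬ Prf T H₀ Fm.bot) : ∀ n, ¬ Prf T (stage T H₀ n).H Fm.bot
  | 0 => h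
  | n + 1 => Stage.next_consistent (stage_consistent h n)

theorem stage_mono {n m : ℕ} (h : n ≤ m) {A : Fm (stageCtx T H₀ n)}
    (hA : A ∈ (stage T H₀ n).H) : A.rename (up T H₀ h) ∈ (stage T H₀ m).H := by
  induction m, h using Nat.le_induction with
  | base => rwa [rename_up_self]
  | succ m h ih =>
    rw [rename_up_succ h]
    simp only [stage, Stage.next]
    split_ifs
    · exact List.mem_cons_of_mem _ (List.mem_map_of_mem (List.mem_cons_of_mem _ ih))
    · exact List.mem_map_of_mem (List.mem_cons_of_mem _ ih)

theorem stage_agenda {n : ℕ} (A : Fm (stageCtx T H₀ n)) :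
    ∃ m, ∃ h : n ≤ m, (stage T H₀ m).agenda m = A.rename (up T H₀ h) := by
  obtain ⟨j, hj⟩ := Fm.enum_surjective _ A
  have key : ∀ m, ∀ h : n ≤ m,
      (stage T H₀ m).agenda (Nat.pair n j) = A.rename (up T H₀ h) := by
    intro m h
    induction m, h using Nat.le_induction with
    | base =>
      rw [rename_up_self]
      cases n with
      | zero =>
        change Fm.enum _ (Nat.unpair (Nat.pair 0 j)).2 = A
        rwa [Nat.unpair_pair]
      | succ n =>
        change (if (Nat.unpair (Nat.pair (n + 1) j)).1 = n + 1 then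
          Fm.enum _ (Nat.unpair (Nat.pair (n + 1) j)).2 else _) = A
        rw [Nat.unpair_pair]
        exact (if_pos rfl).trans hj
    | succ m h ih =>
      rw [rename_up_succ h, ← ih]
      have : n ≠ m + 1 := by omega
      simp [stage, Stage.next, this]
  exact ⟨Nat.pair n j, Nat.left_le_pair n j, key _ _⟩

/-- The formulas that hold in the limit of the stages. -/
def Holds {n : ℕ} (A : Fm (stageCtx T H₀ n)) : Prop :=
  ∃ m, ∃ h : n ≤ m, Prf T (stage T H₀ m).H (A.rename (up T H₀ h))

theorem prf_up (hT : T.RenClosed) {n m : ℕ} (h : n ≤ m) {A : Fm (stageCtx T H₀ n)}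
    (hA : Prf T (stage T H₀ n).H A) : Prf T (stage T H₀ m).H (A.rename (up T H₀ h)) := by
  refine (hA.rename hT (up T H₀ h)).weaken ?_
  intro B hB
  obtain ⟨C, hC, rfl⟩ := List.mem_map.1 hB
  exact stage_mono h hC

theorem holds_up (hT : T.RenClosed) {n m : ℕ} (h : n ≤ m) (A : Fm (stageCtx T H₀ n)) :
    Holds (A.rename (up T H₀ h)) ↔ Holds A := by
  constructor
  · rintro ⟨k, hk, h1⟩
    exact ⟨k, h.trans hk, by rwa [rename_up_up] at h1⟩
  · rintro ⟨k, hk, h1⟩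
    refine ⟨max k m, le_max_right _ _, ?_⟩
    have := prf_up hT (le_max_left k m) h1
    rwa [rename_up_up] at this ⊢

theorem holds_of_prf {n : ℕ} {A : Fm (stageCtx T H₀ n)} (h : Prf T [] A) :
    Holds A := by
  refine ⟨n, le_rfl, ?_⟩
  rw [rename_up_self]
  exact h.weaken (List.nil_subset _)

theorem holds_of_mem {n : ℕ} {A : Fm (stageCtx T H₀ n)} (h : A ∈ (stage T H₀ n).H) :
    Holds A :=
  ⟨n, le_rfl, by rw [rename_up_self]; exact Prf.hyp h⟩

theorem holds_mp (hT : T.RenClosed) {n : ℕ} {A B : Fm (stageCtx T H₀ n)}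
    (h : Holds (A.imp B)) (hA : Holds A) : Holds B := by
  obtain ⟨k, hk, h1⟩ := h
  obtain ⟨l, hl, h2⟩ := hA
  refine ⟨max k l, hk.trans (le_max_left _ _), ?_⟩
  have h1 := prf_up hT (le_max_left k l) h1
  have h2 := prf_up hT (le_max_right k l) h2
  rw [rename_up_up] at h1 h2
  exact Prf.impE h1 h2

theorem not_holds_bot (hc : ¬ Prf T H₀ Fm.bot) {n : ℕ} :
    ¬ Holds (Fm.bot : Fm (stageCtx T H₀ n)) := by
  rintro ⟨m, h, h1⟩
  exact stage_consistent hc m h1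

/-- Every formula is decided, and with a counterexample if it is universal and fails. -/
theorem holds_or (n : ℕ) (A : Fm (stageCtx T H₀ n)) :
    Holds A ∨ (Holds A.neg ∧ ∃ m, ∃ h : n ≤ m,
      (stage T H₀ m).agenda m = A.rename (up T H₀ h) ∧
      ((stage T H₀ m).agenda m).wit ∈ (stage T H₀ (m + 1)).H) := by
  obtain ⟨m, h, hm⟩ := stage_agenda A
  by_cases hA : Prf T ((stage T H₀ m).agenda m :: (stage T H₀ m).H) Fm.bot
  · right
    constructor
    · refine ⟨m, h, ?_⟩
      rw [hm] at hA
      exact Prf.impI hA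
    · refine ⟨m, h, hm, ?_⟩
      simp only [stage, Stage.next, if_pos hA]
      exact List.mem_cons_self
  · left
    refine ⟨m + 1, h.trans (Nat.le_succ m), Prf.hyp ?_⟩
    rw [rename_up_succ h, ← hm]
    simp only [stage, Stage.next, if_neg hA]
    exact List.mem_map_of_mem List.mem_cons_self

theorem holds_neg (hT : T.RenClosed) (hc : ¬ Prf T H₀ Fm.bot) {n : ℕ}
    (A : Fm (stageCtx T H₀ n)) : Holds A.neg ↔ ¬ Holds A := by
  constructor
  · exact fun h h' => not_holds_bot hc (holds_mp hT h h')
  · intro h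
    exact ((holds_or n A).resolve_left h).1

theorem holds_imp (hT : T.RenClosed) (hc : ¬ Prf T H₀ Fm.bot) {n : ℕ}
    (A B : Fm (stageCtx T H₀ n)) : Holds (A.imp B) ↔ (Holds A → Holds B) := by
  refine ⟨holds_mp hT, fun h => ?_⟩
  by_cases hA : Holds A
  · refine holds_mp hT (holds_of_prf ?_) (h hA)
    exact Prf.impI (Prf.impI (Prf.hyp (by simp)))
  · refine holds_mp hT (holds_of_prf ?_) ((holds_neg hT hc A).2 hA)
    exact Prf.impI (Prf.impI (Prf.exfalso (Prf.impE (A := A) (Prf.hyp (by simp [Fm.neg]))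
      (Prf.hyp (by simp)))))

theorem Fm.wit_all {Γ : Ctx} {σ : Ty} {B : Fm (σ :: Γ)} : ∀ {A : Fm Γ}, A = Fm.all σ B →
    ∃ v : Var (A.witTy :: Γ) σ,
      ((B.rename (liftRen (fun _ x => Var.s x) σ)).inst (Tm.var v)).neg = A.wit := by
  rintro _ rfl
  refine ⟨Var.z, ?_⟩
  have : (fun τ x => instSub (Tm.var (Var.z (Γ := Γ))) τ (liftRen (fun _ x => Var.s x) σ τ x)) =
      fun τ x => Tm.var x := by
    funext τ x; cases x <;> rfl
  simp only [Fm.wit, Fm.inst, Fm.rename_subst]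
  exact congrArg Fm.neg ((congrArg (fun θ => Fm.subst θ B) this).trans (Fm.subst_var B))

theorem holds_all (hT : T.RenClosed) (hc : ¬ Prf T H₀ Fm.bot) {n : ℕ} {σ : Ty}
    (A : Fm (σ :: stageCtx T H₀ n)) : Holds (Fm.all σ A) ↔
      ∀ m, ∀ h : n ≤ m, ∀ t : Tm (stageCtx T H₀ m) σ,
        Holds ((A.rename (liftRen (up T H₀ h) σ)).inst t) := by
  constructor
  · intro hA m h t
    rw [← holds_up hT h] at hA
    obtain ⟨k, hk, h1⟩ := hA
    refine ⟨k, hk, ?_⟩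
    rw [Fm.inst_rename]
    exact Prf.allE _ h1
  · intro hA
    refine (holds_or n (Fm.all σ A)).resolve_right ?_
    rintro ⟨-, m, h, hm, hw⟩
    obtain ⟨v, hv⟩ := Fm.wit_all hm
    rw [← hv] at hw
    have h1 := hA (m + 1) (h.trans (Nat.le_succ m)) (Tm.var v)
    rw [up_succ h] at h1
    rw [Fm.rename_rename, liftRen_comp] at hw
    exact (holds_neg hT hc _).1 (holds_of_mem hw) h1

end Henkin

/-! ### The term model -/

/-- The theory `T` contains the axioms of extensionality. -/
def Theory.HasExt (T : Theory) : Prop :=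
  ∀ {Γ : Ctx} {ρ τ : Ty} (x y : Tm Γ ρ) (f : Tm Γ (ρ ⇒ τ)),
    T Γ ((eqT ρ x y).imp (eqT τ (Tm.app f x) (Tm.app f y)))

section TermModel

variable {T : Theory} {H₀ : List (Fm [])}

theorem holds_eqT_arr (hT : T.RenClosed) (hc : ¬ Prf T H₀ Fm.bot) {n : ℕ} {σ τ : Ty}
    (f g : Tm (stageCtx T H₀ n) (σ ⇒ τ)) : Holds (eqT (σ ⇒ τ) f g) ↔
      ∀ m, ∀ h : n ≤ m, ∀ t : Tm (stageCtx T H₀ m) σ,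
        Holds (eqT τ (Tm.app (f.rename (up T H₀ h)) t) (Tm.app (g.rename (up T H₀ h)) t)) := by
  rw [eqT, holds_all hT hc]
  have (m : ℕ) (h : n ≤ m) (t : Tm (stageCtx T H₀ m) σ) :
      ((eqT τ (Tm.app f.wk v0) (Tm.app g.wk v0)).rename (liftRen (up T H₀ h) σ)).inst t =
        eqT τ (Tm.app (f.rename (up T H₀ h)) t) (Tm.app (g.rename (up T H₀ h)) t) := by
    simp only [eqT_rename, Fm.inst, eqT_subst, Tm.rename, Tm.subst, Tm.wk_rename, Tm.wk_inst]
    rfl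
  simp only [this]

theorem holds_eqT_refl (hT : T.RenClosed) (hc : ¬ Prf T H₀ Fm.bot) : ∀ (τ : Ty) {n : ℕ}
    (t : Tm (stageCtx T H₀ n) τ), Holds (eqT τ t t)
  | Ty.nat, _, t => holds_of_prf (Prf.eqRefl t)
  | Ty.arr σ τ, _, t => by
      rw [holds_eqT_arr hT hc]
      exact fun m h a => holds_eqT_refl hT hc τ _

theorem Prf.eq_trans {T : Theory} {Γ : Ctx} {H : List (Fm Γ)} {s t u : Tm Γ Ty.nat}
    (h1 : Prf T H (Fm.eq s t)) (h2 : Prf T H (Fm.eq s u)) : Prf T H (Fm.eq t u) := by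
  have h := Prf.eqSubst (Fm.eq v0 u.wk) h1
  simp only [Fm.inst, Fm.subst, Tm.subst, Tm.wk_inst] at h
  exact h h2

theorem Prf.lt_congr {T : Theory} {Γ : Ctx} {H : List (Fm Γ)} {s t u v : Tm Γ Ty.nat}
    (h1 : Prf T H (Fm.eq s t)) (h2 : Prf T H (Fm.eq u v)) (h3 : Prf T H (Fm.lt s u)) :
    Prf T H (Fm.lt t v) := by
  have h := Prf.eqSubst (Fm.lt v0 u.wk) h1
  simp only [Fm.inst, Fm.subst, Tm.subst, Tm.wk_inst] at h
  have h' := Prf.eqSubst (Fm.lt t.wk v0) h2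
  simp only [Fm.inst, Fm.subst, Tm.subst, Tm.wk_inst] at h'
  exact h' (h h3)

/-- Symmetry and transitivity of equality at once. -/
theorem holds_eqT_trans (hT : T.RenClosed) (hc : ¬ Prf T H₀ Fm.bot) : ∀ (τ : Ty) {n : ℕ}
    {s t u : Tm (stageCtx T H₀ n) τ},
    Holds (eqT τ s t) → Holds (eqT τ s u) → Holds (eqT τ t u)
  | Ty.nat, _, s, t, u => by
      intro h1 h2
      refine holds_mp hT (holds_mp hT (holds_of_prf ?_) h1) h2
      exact Prf.impI (Prf.impI (Prf.eq_trans (s := s) (Prf.hyp (by simp [eqT]))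
        (Prf.hyp (by simp [eqT]))))
  | Ty.arr σ τ, _, s, t, u => by
      simp only [holds_eqT_arr hT hc]
      exact fun h1 h2 m h a => holds_eqT_trans hT hc τ (h1 m h a) (h2 m h a)

theorem holds_eqT_app (hT : T.RenClosed) (hE : T.HasExt) (hc : ¬ Prf T H₀ Fm.bot) {σ τ : Ty}
    {n : ℕ} {f g : Tm (stageCtx T H₀ n) (σ ⇒ τ)} {a b : Tm (stageCtx T H₀ n) σ}
    (h1 : Holds (eqT (σ ⇒ τ) f g)) (h2 : Holds (eqT σ a b)) :
    Holds (eqT τ (Tm.app f a) (Tm.app g b)) := by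
  have h3 := (holds_eqT_arr hT hc f g).1 h1 n le_rfl a
  rw [up_self, Tm.rename_id, Tm.rename_id] at h3
  have h4 : Holds (eqT τ (Tm.app g a) (Tm.app g b)) :=
    holds_mp hT (holds_of_prf (Prf.ax (hE a b g))) h2
  exact holds_eqT_trans hT hc τ (holds_eqT_trans hT hc τ h3 (holds_eqT_refl hT hc τ _)) h4

variable (T H₀) in
/-- The terms of all stages; they name the elements of the term model. -/
abbrev PreElt (τ : Ty) : Type := Σ n : ℕ, Tm (stageCtx T H₀ n) τ

/-- Two terms name the same element if their equality holds at a common stage. -/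
def PreElt.Rel {τ : Ty} (a b : PreElt T H₀ τ) : Prop :=
  ∃ k, ∃ ha : a.1 ≤ k, ∃ hb : b.1 ≤ k,
    Holds (eqT τ (a.2.rename (up T H₀ ha)) (b.2.rename (up T H₀ hb)))

theorem PreElt.rel_iff (hT : T.RenClosed) {τ : Ty} {a b : PreElt T H₀ τ} {k : ℕ}
    (ha : a.1 ≤ k) (hb : b.1 ≤ k) : a.Rel b ↔
      Holds (eqT τ (a.2.rename (up T H₀ ha)) (b.2.rename (up T H₀ hb))) := by
  refine ⟨?_, fun h => ⟨k, ha, hb, h⟩⟩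
  rintro ⟨l, ha', hb', h⟩
  rw [← holds_up hT (le_max_left k l), eqT_rename, Tm.rename_up_up, Tm.rename_up_up]
  rwa [← holds_up hT (le_max_right k l), eqT_rename, Tm.rename_up_up, Tm.rename_up_up] at h

theorem PreElt.rel_equivalence (hT : T.RenClosed) (hc : ¬ Prf T H₀ Fm.bot) (τ : Ty) :
    Equivalence (PreElt.Rel (T := T) (H₀ := H₀) (τ := τ)) := by
  have refl : ∀ a : PreElt T H₀ τ, a.Rel a :=
    fun a => ⟨a.1, le_rfl, le_rfl, holds_eqT_refl hT hc τ _⟩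
  have trans : ∀ {a b c : PreElt T H₀ τ}, a.Rel b → a.Rel c → b.Rel c := by
    intro a b c h1 h2
    have ha : a.1 ≤ max a.1 (max b.1 c.1) := by omega
    have hb : b.1 ≤ max a.1 (max b.1 c.1) := by omega
    have hc' : c.1 ≤ max a.1 (max b.1 c.1) := by omega
    rw [PreElt.rel_iff hT ha hb] at h1
    rw [PreElt.rel_iff hT ha hc'] at h2
    rw [PreElt.rel_iff hT hb hc']
    exact holds_eqT_trans hT hc τ h1 h2
  exact ⟨refl, fun h => trans h (refl _), fun h1 h2 => trans (trans h1 (refl _)) h2⟩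

/-- The term model of the limit of the stages. -/
noncomputable def termModel (hT : T.RenClosed) (hE : T.HasExt) (hc : ¬ Prf T H₀ Fm.bot) :
    Model where
  M τ := Quotient ⟨PreElt.Rel (T := T) (H₀ := H₀) (τ := τ), PreElt.rel_equivalence hT hc τ⟩
  app {σ τ} := Quotient.map₂
    (fun f a => ⟨max f.1 a.1, Tm.app (f.2.rename (up T H₀ (le_max_left _ _)))
      (a.2.rename (up T H₀ (le_max_right _ _)))⟩) (by
    rintro f g ⟨k, hf, hg, h1⟩ a b ⟨l, ha, hb, h2⟩
    refine ⟨max k l, by simp only; omega, by simp only; omega, ?_⟩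
    rw [← holds_up hT (le_max_left k l), eqT_rename, Tm.rename_up_up, Tm.rename_up_up] at h1
    rw [← holds_up hT (le_max_right k l), eqT_rename, Tm.rename_up_up, Tm.rename_up_up] at h2
    simp only [Tm.rename, Tm.rename_up_up]
    exact holds_eqT_app hT hE hc h1 h2)
  con c := Quotient.mk _ ⟨0, Tm.con c⟩
  lt := Quotient.lift₂
    (fun a b => Holds (Fm.lt (a.2.rename (up T H₀ (le_max_left a.1 b.1)))
      (b.2.rename (up T H₀ (le_max_right a.1 b.1))))) (by
    have key : ∀ {a b a' b' : PreElt T H₀ Ty.nat}, a.Rel a' → b.Rel b' →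
        Holds (Fm.lt (a.2.rename (up T H₀ (le_max_left a.1 b.1)))
          (b.2.rename (up T H₀ (le_max_right a.1 b.1)))) →
        Holds (Fm.lt (a'.2.rename (up T H₀ (le_max_left a'.1 b'.1)))
          (b'.2.rename (up T H₀ (le_max_right a'.1 b'.1)))) := by
      intro a b a' b' h1 h2 h3
      let k := max (max a.1 b.1) (max a'.1 b'.1)
      have hk : max a.1 b.1 ≤ k := le_max_left _ _
      have hk' : max a'.1 b'.1 ≤ k := le_max_right _ _
      rw [PreElt.rel_iff hT ((le_max_left _ _).trans hk) ((le_max_left _ _).trans hk')] at h1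
      rw [PreElt.rel_iff hT ((le_max_right _ _).trans hk) ((le_max_right _ _).trans hk')] at h2
      rw [← holds_up hT hk] at h3
      rw [← holds_up hT hk']
      simp only [Fm.rename, Tm.rename_up_up] at h3 ⊢
      refine holds_mp hT (holds_mp hT (holds_mp hT (holds_of_prf ?_) h1) h2) h3
      exact Prf.impI (Prf.impI (Prf.impI (Prf.lt_congr
        (Prf.hyp (List.mem_cons_of_mem _ (List.mem_cons_of_mem _ List.mem_cons_self)))
        (Prf.hyp (List.mem_cons_of_mem _ List.mem_cons_self)) (Prf.hyp List.mem_cons_self))))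
    intro a b a' b' h1 h2
    have e := PreElt.rel_equivalence hT hc Ty.nat
    exact propext ⟨key h1 h2, key (e.symm h1) (e.symm h2)⟩)
  ext {σ τ} := by
    rintro ⟨f⟩ ⟨g⟩ h
    refine Quotient.sound ⟨max f.1 g.1, le_max_left _ _, le_max_right _ _, ?_⟩
    rw [holds_eqT_arr hT hc]
    intro m hm t
    have h1 := Quotient.exact (h (Quotient.mk _ ⟨m, t⟩))
    have hf : max f.1 m ≤ m := by omega
    have hg : max g.1 m ≤ m := by omega
    have h2 := (PreElt.rel_iff hT hf hg).1 h1
    simp only [Tm.rename, Tm.rename_up_up] at h2 ⊢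
    rwa [up_self, Tm.rename_id] at h2

variable (hT : T.RenClosed) (hE : T.HasExt) (hc : ¬ Prf T H₀ Fm.bot)

/-- The element of the term model that is named by a term of stage `n`. -/
noncomputable def termModel.mk {n : ℕ} {τ : Ty} (t : Tm (stageCtx T H₀ n) τ) :
    (termModel hT hE hc).M τ :=
  Quotient.mk _ ⟨n, t⟩

theorem termModel.mk_up {n m : ℕ} (h : n ≤ m) {τ : Ty} (t : Tm (stageCtx T H₀ n) τ) :
    termModel.mk hT hE hc (t.rename (up T H₀ h)) = termModel.mk hT hE hc t := by
  refine Quotient.sound ⟨m, le_rfl, h, ?_⟩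
  rw [Tm.rename_up_up]
  exact holds_eqT_refl hT hc τ _

theorem termModel.mk_eq {n : ℕ} {τ : Ty} (s t : Tm (stageCtx T H₀ n) τ) :
    termModel.mk hT hE hc s = termModel.mk hT hE hc t ↔ Holds (eqT τ s t) := by
  have : PreElt.Rel ⟨n, s⟩ ⟨n, t⟩ ↔ Holds (eqT τ s t) := by
    rw [PreElt.rel_iff hT (le_refl n) (le_refl n), up_self, Tm.rename_id, Tm.rename_id]
  exact ⟨fun h => this.1 (Quotient.exact h), fun h => Quotient.sound (this.2 h)⟩

theorem termModel.app_mk {n : ℕ} {σ τ : Ty} (f : Tm (stageCtx T H₀ n) (σ ⇒ τ))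
    (a : Tm (stageCtx T H₀ n) σ) :
    (termModel hT hE hc).app (termModel.mk hT hE hc f) (termModel.mk hT hE hc a) =
      termModel.mk hT hE hc (Tm.app f a) :=
  termModel.mk_up hT hE hc (le_max_left n n) (Tm.app f a)

theorem termModel.lt_mk {n : ℕ} (s t : Tm (stageCtx T H₀ n) Ty.nat) :
    (termModel hT hE hc).lt (termModel.mk hT hE hc s) (termModel.mk hT hE hc t) ↔
      Holds (Fm.lt s t) :=
  holds_up hT (le_max_left n n) (Fm.lt s t)

theorem termModel.exists_mk {τ : Ty} (a : (termModel hT hE hc).M τ) :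
    ∃ n, ∃ t : Tm (stageCtx T H₀ n) τ, termModel.mk hT hE hc t = a := by
  obtain ⟨⟨n, t⟩⟩ := a
  exact ⟨n, t, rfl⟩

/-- The assignment that lets every variable of stage `n` name itself. -/
noncomputable def termModel.env (n : ℕ) : Env (termModel hT hE hc) (stageCtx T H₀ n) :=
  fun _ x => termModel.mk hT hE hc (Tm.var x)

theorem termModel.eval_env {n : ℕ} {τ : Ty} (t : Tm (stageCtx T H₀ n) τ) :
    eval (termModel.env hT hE hc n) t = termModel.mk hT hE hc t := by
  induction t with
  | var x => rfl
  | con c => exact (termModel.mk_up hT hE hc (Nat.zero_le n) (Tm.con c)).symm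
  | app f a ihf iha => rw [eval_app, ihf, iha, termModel.app_mk]

/-- The truth lemma. The induction is on the size of the formula, since the instances of a universal
formula are not subformulas. -/
theorem termModel.sat_env (k : ℕ) : ∀ {n : ℕ} (A : Fm (stageCtx T H₀ n)), A.size ≤ k →
    (sat (termModel.env hT hE hc n) A ↔ Holds A) := by
  induction k with
  | zero =>
    intro n A hA
    cases A with
    | eq s t => rw [sat_eq, eval_env, eval_env, mk_eq]; rfl
    | lt s t => rw [← termModel.lt_mk hT hE hc, ← eval_env, ← eval_env]; rfl
    | bot => exact ⟨False.elim, not_holds_bot hc⟩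
    | imp A B => simp [Fm.size] at hA
    | all σ A => simp [Fm.size] at hA
  | succ k ih =>
    intro n A hA
    cases A with
    | eq s t => exact ih _ (Nat.zero_le _)
    | lt s t => exact ih _ (Nat.zero_le _)
    | bot => exact ih _ (Nat.zero_le _)
    | imp A B =>
      simp only [Fm.size] at hA
      rw [sat_imp, holds_imp hT hc, ih A (by omega), ih B (by omega)]
    | all σ B =>
      simp only [Fm.size] at hA
      have key : ∀ m, ∀ h : n ≤ m, ∀ t : Tm (stageCtx T H₀ m) σ,
          (Holds ((B.rename (liftRen (up T H₀ h) σ)).inst t) ↔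
            sat (Env.cons (termModel.mk hT hE hc t) (termModel.env hT hE hc n)) B) := by
        intro m h t
        rw [← ih _ (by rw [Fm.inst, Fm.size_subst, Fm.size_rename]; omega), sat_inst, sat_rename,
          Env.cons_liftRen, eval_env]
        have : (fun τ x => env hT hE hc m τ (up T H₀ h τ x)) = env hT hE hc n := by
          funext τ x
          exact termModel.mk_up hT hE hc h (Tm.var x)
        rw [this]
      rw [sat_all, holds_all hT hc]
      constructor
      · exact fun h m hm t => (key m hm t).2 (h _)
      · intro h a
        obtain ⟨m, t, rfl⟩ := termModel.exists_mk hT hE hc a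
        rw [← termModel.mk_up hT hE hc (le_max_right n m)]
        exact (key _ (le_max_left n m) _).1 (h _ _ _)

end TermModel

/-- The model `𝓜` satisfies the axioms of `T`. -/
def Model.Sat (𝓜 : Model) (T : Theory) : Prop :=
  ∀ {Γ : Ctx} {A : Fm Γ}, T Γ A → ∀ e : Env 𝓜 Γ, sat e A

theorem termModel.models {T : Theory} {H₀ : List (Fm [])} (hT : T.RenClosed) (hE : T.HasExt)
    (hc : ¬ Prf T H₀ Fm.bot) : (termModel hT hE hc).Sat T := by
  -- The values of an assignment are arbitrary, so the axiom is first closed by quantifiers.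
  have close : ∀ {Γ : Ctx} {A : Fm Γ}, Prf T [] A → ∀ e : Env (termModel hT hE hc) Γ, sat e A := by
    intro Γ
    induction Γ with
    | nil =>
      intro A h e
      have h0 : sat (termModel.env hT hE hc 0) A :=
        (termModel.sat_env hT hE hc _ (n := 0) A le_rfl).2 (holds_of_prf h)
      have : e = termModel.env hT hE hc 0 := by funext τ x; exact nomatch x
      rwa [this]
    | cons σ Γ ih =>
      intro A h e
      have h1 := ih (A := Fm.all σ A) (Prf.allI h) (fun τ x => e τ (Var.s x)) (e σ Var.z)
      have : Env.cons (e σ Var.z) (fun τ x => e τ (Var.s x)) = e := by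
        funext τ x; cases x <;> rfl
      rwa [this] at h1
  exact fun {Γ A} h e => close (Prf.ax h) e

/-- Gödel's completeness theorem: a sentence that is true in all extensional models of a theory with
extensionality is provable. -/
theorem Theory.proves_of_models {T : Theory} (hT : T.RenClosed) (hE : T.HasExt) {A : Fm []}
    (h : ∀ 𝓜 : Model, 𝓜.Sat T → sat (Env.nil : Env 𝓜 []) A) : T.Proves A := by
  by_contra hA
  have hc : ¬ Prf T [A.neg] Fm.bot := fun h => hA (Prf.raa h)
  have h1 := h _ (termModel.models hT hE hc)
  have h2 : Holds (H₀ := [A.neg]) (T := T) (n := 0) A.neg := holds_of_mem List.mem_cons_self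
  have h3 := (termModel.sat_env hT hE hc _ _ le_rfl).2 h2
  have : (Env.nil : Env (termModel hT hE hc) []) = termModel.env hT hE hc 0 := by
    funext τ x; exact nomatch x
  exact h3 (this ▸ h1)

/-! ### The base theory -/

theorem QFAC.rename {σ τ : Ty} {Γ Δ : Ctx} (r : Ren Γ Δ) {A : Fm Γ} (h : QFAC σ τ Γ A) :
    QFAC σ τ Δ (A.rename r) := by
  obtain ⟨A, hA⟩ := h
  have e : (A.choiceInst).rename (liftRen (liftRen r (σ ⇒ τ)) σ) =
      (A.rename (liftRen (liftRen r σ) τ)).choiceInst := by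
    simp only [Fm.choiceInst, Fm.subst_rename, Fm.rename_subst]
    congr 1
    funext ρ x
    rcases x with _ | x
    · rfl
    rcases x with _ | x <;> rfl
  have := QFAC.mk (σ := σ) (τ := τ) (A.rename (liftRen (liftRen r σ) τ)) (hA.rename _)
  rw [← e] at this
  exact this

theorem RCA0.rename {Γ Δ : Ctx} (r : Ren Γ Δ) {A : Fm Γ} (h : RCA0 Γ A) :
    RCA0 Δ (A.rename r) := by
  cases h with
  | proj x y => rw [eqT_rename]; exact RCA0.proj _ _
  | comb x y z => rw [eqT_rename]; exact RCA0.comb _ _ _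
  | ext x y f => rw [Fm.rename, eqT_rename, eqT_rename]; exact RCA0.ext _ _ _
  | ind A hA =>
    have e : A.succ.rename (liftRen r Ty.nat) = (A.rename (liftRen r Ty.nat)).succ := by
      simp only [Fm.succ, Fm.subst_rename, Fm.rename_subst]
      congr 1
      funext ρ x
      cases x <;> rfl
    have := RCA0.ind (A.rename (liftRen r Ty.nat)) (hA.rename _)
    rw [← e] at this
    simp only [Fm.rename, Fm.inst_rename]
    exact this
  | choice A h => exact RCA0.choice _ (h.rename r)
  | add_assoc a b c => exact RCA0.add_assoc _ _ _
  | add_comm a b => exact RCA0.add_comm _ _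
  | add_zero a => exact RCA0.add_zero _
  | mul_assoc a b c => exact RCA0.mul_assoc _ _ _
  | mul_comm a b => exact RCA0.mul_comm _ _
  | mul_one a => exact RCA0.mul_one _
  | mul_zero a => exact RCA0.mul_zero _
  | mul_add a b c => exact RCA0.mul_add _ _ _
  | lt_irrefl a => exact RCA0.lt_irrefl _
  | lt_trans a b c => exact RCA0.lt_trans _ _ _
  | lt_total a b => exact RCA0.lt_total _ _
  | add_lt_add a b c => exact RCA0.add_lt_add _ _ _
  | mul_lt_mul a b c => exact RCA0.mul_lt_mul _ _ _
  | zero_lt_one => exact RCA0.zero_lt_one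
  | not_lt_zero a => exact RCA0.not_lt_zero _
  | lt_add_one a b => exact RCA0.lt_add_one _ _
  | rec_zero f m => exact RCA0.rec_zero _ _
  | rec_succ f m n => exact RCA0.rec_succ _ _ _

theorem baseTheory_renClosed : baseTheory.RenClosed := by
  intro Γ Δ r A h
  rcases h with h | h
  · exact Or.inl (h.rename r)
  · exact Or.inr (h.rename r)

theorem baseTheory_hasExt : baseTheory.HasExt := fun x y f => Or.inl (RCA0.ext x y f)

/-! ### Ordered fields over an ordered semiring -/

section DiffRing

variable (N : Type) [CommSemiring N] [LinearOrder N] [IsStrictOrderedRing N]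

/-- Formal differences `a - b` of elements of `N`, up to equality of differences. -/
def diffSetoid : Setoid (N × N) where
  r x y := x.1 + y.2 = y.1 + x.2
  iseqv := by
    refine ⟨fun x => rfl, fun h => h.symm, ?_⟩
    intro x y z h1 h2
    apply add_right_cancel (b := y.2 + y.1)
    calc x.1 + z.2 + (y.2 + y.1) = (x.1 + y.2) + (y.1 + z.2) := by ring
      _ = (y.1 + x.2) + (z.1 + y.2) := by rw [h1, h2]
      _ = z.1 + x.2 + (y.2 + y.1) := by ring

/-- The ring of differences of elements of `N`. -/
def DiffRing : Type := Quotient (diffSetoid N)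

variable {N}

namespace DiffRing

/-- The difference `a - b`. -/
def mk (a b : N) : DiffRing N := Quotient.mk (diffSetoid N) (a, b)

theorem mk_eq {a b c d : N} : mk a b = mk c d ↔ a + d = c + b :=
  ⟨fun h => Quotient.exact h, fun h => Quotient.sound (s := diffSetoid N) h⟩

theorem ind {P : DiffRing N → Prop} (h : ∀ a b, P (mk a b)) (x : DiffRing N) : P x :=
  Quotient.ind (fun p => h p.1 p.2) x

instance : Zero (DiffRing N) := ⟨mk 0 0⟩
instance : One (DiffRing N) := ⟨mk 1 0⟩

instance : Neg (DiffRing N) := ⟨Quotient.map (sa := diffSetoid N) (sb := diffSetoid N)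
  (fun x => (x.2, x.1)) fun x y (h : x.1 + y.2 = y.1 + x.2) =>
    show x.2 + y.1 = y.2 + x.1 by rw [add_comm x.2, ← h, add_comm]⟩

instance : Add (DiffRing N) := ⟨Quotient.map₂ (sa := diffSetoid N) (sb := diffSetoid N)
  (sc := diffSetoid N) (fun x y => (x.1 + y.1, x.2 + y.2))
  fun x x' (h : x.1 + x'.2 = x'.1 + x.2) y y' (h' : y.1 + y'.2 = y'.1 + y.2) =>
    show x.1 + y.1 + (x'.2 + y'.2) = x'.1 + y'.1 + (x.2 + y.2) by
      rw [add_add_add_comm, h, h', add_add_add_comm]⟩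

instance : Mul (DiffRing N) := ⟨Quotient.map₂ (sa := diffSetoid N) (sb := diffSetoid N)
  (sc := diffSetoid N) (fun x y => (x.1 * y.1 + x.2 * y.2, x.1 * y.2 + x.2 * y.1))
  fun x x' (h : x.1 + x'.2 = x'.1 + x.2) y y' (h' : y.1 + y'.2 = y'.1 + y.2) =>
    show x.1 * y.1 + x.2 * y.2 + (x'.1 * y'.2 + x'.2 * y'.1) =
        x'.1 * y'.1 + x'.2 * y'.2 + (x.1 * y.2 + x.2 * y.1) by
      apply add_right_cancel (b := x'.2 * y.1 + x'.1 * y.2)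
      calc x.1 * y.1 + x.2 * y.2 + (x'.1 * y'.2 + x'.2 * y'.1) + (x'.2 * y.1 + x'.1 * y.2)
          = (x.1 + x'.2) * y.1 + (x'.1 + x.2) * y.2 + x'.1 * y'.2 + x'.2 * y'.1 := by ring
        _ = (x'.1 + x.2) * y.1 + (x.1 + x'.2) * y.2 + x'.1 * y'.2 + x'.2 * y'.1 := by rw [h]
        _ = x'.1 * (y.1 + y'.2) + x'.2 * (y'.1 + y.2) + x.2 * y.1 + x.1 * y.2 := by ring
        _ = x'.1 * (y'.1 + y.2) + x'.2 * (y.1 + y'.2) + x.2 * y.1 + x.1 * y.2 := by rw [h']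
        _ = _ := by ring⟩

theorem mk_add (a b c d : N) : mk a b + mk c d = mk (a + c) (b + d) := rfl
theorem mk_mul (a b c d : N) : mk a b * mk c d = mk (a * c + b * d) (a * d + b * c) := rfl
theorem neg_mk (a b : N) : -mk a b = mk b a := rfl
theorem zero_def : (0 : DiffRing N) = mk 0 0 := rfl
theorem one_def : (1 : DiffRing N) = mk 1 0 := rfl

instance : CommRing (DiffRing N) where
  add_assoc x y z := by
    induction x using ind; induction y using ind; induction z using ind
    simp only [mk_add, add_assoc]
  zero_add x := by induction x using ind; simp only [zero_def, mk_add, zero_add]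
  add_zero x := by induction x using ind; simp only [zero_def, mk_add, add_zero]
  add_comm x y := by
    induction x using ind; induction y using ind
    simp only [mk_add, add_comm]
  nsmul := nsmulRec
  zsmul := zsmulRec
  neg_add_cancel x := by
    induction x using ind
    simp only [neg_mk, mk_add, zero_def, mk_eq]; ring
  left_distrib x y z := by
    induction x using ind; induction y using ind; induction z using ind
    simp only [mk_add, mk_mul, mk_eq]; ring
  right_distrib x y z := by
    induction x using ind; induction y using ind; induction z using ind
    simp only [mk_add, mk_mul, mk_eq]; ring
  zero_mul x := by induction x using ind; simp only [zero_def, mk_mul, mk_eq]; ring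
  mul_zero x := by induction x using ind; simp only [zero_def, mk_mul, mk_eq]; ring
  mul_assoc x y z := by
    induction x using ind; induction y using ind; induction z using ind
    simp only [mk_mul, mk_eq]; ring
  one_mul x := by induction x using ind; simp only [one_def, mk_mul, mk_eq]; ring
  mul_one x := by induction x using ind; simp only [one_def, mk_mul, mk_eq]; ring
  mul_comm x y := by
    induction x using ind; induction y using ind
    simp only [mk_mul, mk_eq]; ring

/-- The inclusion of `N` in its ring of differences. -/
def of : N →+* DiffRing N where
  toFun a := mk a 0
  map_zero' := rfl
  map_one' := rfl
  map_add' a b := by simp only [mk_add, add_zero]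
  map_mul' a b := by simp only [mk_mul, mk_eq]; ring

theorem of_injective : Function.Injective (of : N →+* DiffRing N) := by
  intro a b h
  simpa using mk_eq.1 h

theorem exists_eq_or [CanonicallyOrderedAdd N] (x : DiffRing N) :
    ∃ a, x = of a ∨ x = -of a := by
  induction x using ind with | _ a b =>
  obtain h | h := le_total b a
  · obtain ⟨c, rfl⟩ := exists_add_of_le h
    exact ⟨c, Or.inl (mk_eq.2 (by ring))⟩
  · obtain ⟨c, rfl⟩ := exists_add_of_le h
    exact ⟨c, Or.inr (mk_eq.2 (by ring))⟩

instance [CanonicallyOrderedAdd N] : IsDomain (DiffRing N) := by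
  have h0 : (0 : DiffRing N) = of 0 := (map_zero of).symm
  have : NoZeroDivisors (DiffRing N) := ⟨by
    intro x y h
    obtain ⟨a, rfl | rfl⟩ := exists_eq_or x <;> obtain ⟨b, rfl | rfl⟩ := exists_eq_or y <;>
    · have h' : of (a * b) = of 0 := by
        rw [map_mul, map_zero]
        first | exact h | simpa using h
      have := mul_eq_zero.1 (of_injective h')
      rcases this with rfl | rfl <;> simp⟩
  have : Nontrivial (DiffRing N) := ⟨of 0, of 1, fun h => zero_ne_one (of_injective h)⟩
  exact NoZeroDivisors.to_isDomain _

end DiffRing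

variable (N) in
/-- The field of fractions of elements of `N`. -/
def FracField [CanonicallyOrderedAdd N] : Type := FractionRing (DiffRing N)

variable [CanonicallyOrderedAdd N]

namespace FracField

noncomputable instance : Field (FracField N) := inferInstanceAs (Field (FractionRing (DiffRing N)))

/-- The inclusion of `N` in its field of fractions. -/
noncomputable def of : N →+* FracField N :=
  (algebraMap (DiffRing N) (FractionRing (DiffRing N))).comp DiffRing.of

theorem of_injective : Function.Injective (of : N →+* FracField N) :=
  (IsFractionRing.injective (DiffRing N) (FractionRing (DiffRing N))).comp DiffRing.of_injective

theorem of_ne_zero {a : N} (h : a ≠ 0) : (of a : FracField N) ≠ 0 :=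
  fun h' => h (of_injective (h'.trans (map_zero of).symm))

theorem exists_eq_or (x : FracField N) :
    ∃ a d : N, d ≠ 0 ∧ (x = of a / of d ∨ x = -(of a / of d)) := by
  obtain ⟨y, z, hz, rfl⟩ :=
    IsFractionRing.div_surjective (A := DiffRing N) (K := FractionRing (DiffRing N)) x
  have hz : z ≠ 0 := nonZeroDivisors.ne_zero hz
  obtain ⟨a, ha⟩ := DiffRing.exists_eq_or y
  obtain ⟨d, hd⟩ := DiffRing.exists_eq_or z
  refine ⟨a, d, ?_, ?_⟩
  · rintro rfl
    apply hz
    rcases hd with rfl | rfl <;> simp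
  · rcases ha with rfl | rfl <;> rcases hd with rfl | rfl
    · exact Or.inl rfl
    · right; rw [map_neg, div_neg]; rfl
    · right; rw [map_neg, neg_div]; rfl
    · left; rw [map_neg, map_neg, neg_div_neg_eq]; rfl

variable (N) in
/-- The quotients of elements of `N`; they are the nonnegative elements of the field. -/
noncomputable def cone : RingCone (FracField N) where
  carrier := {x | ∃ a d : N, d ≠ 0 ∧ x = of a / of d}
  zero_mem' := ⟨0, 1, one_ne_zero, by simp⟩
  one_mem' := ⟨1, 1, one_ne_zero, by simp⟩
  add_mem' := by
    rintro _ _ ⟨a, d, hd, rfl⟩ ⟨a', d', hd', rfl⟩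
    refine ⟨a * d' + d * a', d * d', mul_ne_zero hd hd', ?_⟩
    rw [div_add_div _ _ (of_ne_zero hd) (of_ne_zero hd')]
    simp only [map_add, map_mul]
  mul_mem' := by
    rintro _ _ ⟨a, d, hd, rfl⟩ ⟨a', d', hd', rfl⟩
    exact ⟨a * a', d * d', mul_ne_zero hd hd', by simp only [map_mul, div_mul_div_comm]⟩
  eq_zero_of_mem_of_neg_mem' := by
    rintro _ ⟨a, d, hd, rfl⟩ ⟨a', d', hd', h⟩
    have h1 : of a * of d' + of d * of a' = (0 : FracField N) := by
      have h2 := of_ne_zero hd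
      have h3 := of_ne_zero hd'
      field_simp at h
      linear_combination -h
    rw [← map_mul, ← map_mul, ← map_add, ← map_zero of] at h1
    have h2 := (add_eq_zero.1 (of_injective h1)).1
    rcases mul_eq_zero.1 h2 with rfl | h3
    · simp
    · exact absurd h3 hd'

noncomputable instance : LinearOrder (FracField N) :=
  letI := Classical.decPred (· ∈ cone N)
  haveI : HasMemOrNegMem (cone N) := ⟨fun x => by
    obtain ⟨a, d, hd, rfl | rfl⟩ := exists_eq_or x
    · exact Or.inl ⟨a, d, hd, rfl⟩
    · exact Or.inr ⟨a, d, hd, neg_neg _⟩⟩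
  LinearOrder.mkOfAddGroupCone (cone N)

instance : IsStrictOrderedRing (FracField N) :=
  haveI : IsOrderedRing (FracField N) := IsOrderedRing.mkOfCone (cone N)
  IsOrderedRing.toIsStrictOrderedRing _

theorem of_nonneg (a : N) : (0 : FracField N) ≤ of a :=
  show of a - 0 ∈ cone N from ⟨a, 1, one_ne_zero, by simp⟩

theorem of_strictMono : StrictMono (of : N →+* FracField N) := by
  refine Monotone.strictMono_of_injective ?_ of_injective
  intro a b h
  obtain ⟨c, rfl⟩ := exists_add_of_le h
  rw [map_add]
  exact le_add_of_nonneg_right (of_nonneg c)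

end FracField

variable (N) in
/-- An ultrafilter on `N` that contains all final segments. -/
noncomputable def finalUltrafilter : Ultrafilter N := Ultrafilter.of Filter.atTop

variable (N) in
/-- An ordered field over `N` in which the sequences of fractions that are Cauchy with a modulus
from `N` have limits: an ultrapower of the field of fractions. -/
def LimitField : Type := Filter.Germ (finalUltrafilter N : Filter N) (FracField N)

namespace LimitField

noncomputable instance : Field (LimitField N) :=
  inferInstanceAs (Field (Filter.Germ (finalUltrafilter N : Filter N) (FracField N)))

noncomputable instance : LinearOrder (LimitField N) :=
  inferInstanceAs (LinearOrder (Filter.Germ (finalUltrafilter N : Filter N) (FracField N)))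

instance : IsStrictOrderedRing (LimitField N) :=
  inferInstanceAs (IsStrictOrderedRing (Filter.Germ (finalUltrafilter N : Filter N) (FracField N)))

/-- The inclusion of the fractions as constant sequences. -/
noncomputable def const : FracField N →+* LimitField N :=
  (Filter.Germ.coeRingHom (finalUltrafilter N : Filter N)).comp (Pi.constRingHom N (FracField N))

theorem const_strictMono : StrictMono (const : FracField N →+* LimitField N) :=
  fun _ _ h => Filter.Germ.const_lt (φ := finalUltrafilter N) h

theorem const_abs (a : FracField N) : (const |a| : LimitField N) = |const a| :=
  Filter.Germ.const_abs (φ := finalUltrafilter N) a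

/-- The inclusion of `N`. -/
noncomputable def of : N →+* LimitField N := const.comp FracField.of

theorem of_strictMono : StrictMono (of : N →+* LimitField N) :=
  const_strictMono.comp FracField.of_strictMono

/-- The class of a sequence of fractions in the ultrapower. -/
noncomputable def lim (q : N → FracField N) : LimitField N :=
  (q : Filter.Germ (finalUltrafilter N : Filter N) (FracField N))

theorem abs_sub_lim_le {q : N → FracField N} {n : N} {c : FracField N}
    (h : ∀ k, n ≤ k → |const (q n) - const (q k)| ≤ const c) : |const (q n) - lim q| ≤ const c := by
  have h1 : ∀ᶠ k in (finalUltrafilter N : Filter N), n ≤ k :=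
    (Ultrafilter.of_le Filter.atTop) (Filter.eventually_ge_atTop n)
  have h2 : |const (q n) - lim q| = ((fun k => |q n - q k| : N → FracField N) :
      Filter.Germ (finalUltrafilter N : Filter N) (FracField N)) :=
    Filter.Germ.abs_def (φ := finalUltrafilter N) _
  rw [h2]
  refine Filter.Germ.coe_le.2 (h1.mono fun k hk => ?_)
  have h3 := h k hk
  rwa [← map_sub, ← const_abs, const_strictMono.le_iff_le] at h3

end LimitField

end DiffRing

/-! ### Arithmetic in a model of the base theory -/

/-- Models of the base theory. -/
class Model.IsBase (𝓜 : Model) : Prop where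
  sat : 𝓜.Sat baseTheory

/-- The domain of type `0`. -/
abbrev Model.N (𝓜 : Model) : Type := 𝓜.M Ty.nat

section Arithmetic

variable {𝓜 : Model}

instance : Zero 𝓜.N := ⟨𝓜.con Con.zero⟩
instance : One 𝓜.N := ⟨𝓜.con Con.one⟩
instance : Add 𝓜.N := ⟨fun a b => 𝓜.app (𝓜.app (𝓜.con Con.add) a) b⟩
instance : Mul 𝓜.N := ⟨fun a b => 𝓜.app (𝓜.app (𝓜.con Con.mul) a) b⟩

section

variable {Γ : Ctx} (e : Env 𝓜 Γ)

@[simp] theorem eval_zero : eval e zero = 0 := rfl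
@[simp] theorem eval_one : eval e one = 1 := rfl
@[simp] theorem eval_add (s t : Tm Γ Ty.nat) : eval e (add s t) = eval e s + eval e t := rfl
@[simp] theorem eval_mul (s t : Tm Γ Ty.nat) : eval e (mul s t) = eval e s * eval e t := rfl
@[simp] theorem eval_succ (t : Tm Γ Ty.nat) : eval e (succ t) = eval e t + 1 := rfl

end

/-- The recursor at type `0`, for a step function given by a term: in `f`, the variable `v1` is the
argument and `v0` the previous value. -/
def recVal {Γ : Ctx} (e : Env 𝓜 Γ) (f : Tm (Ty.nat :: Ty.nat :: Γ) Ty.nat) (m n : 𝓜.N) : 𝓜.N :=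
  𝓜.app (𝓜.app (𝓜.app (𝓜.con (Con.recur Ty.nat)) (eval e (lam (lam f)))) m) n

theorem eval_primRec {Γ : Ctx} (e : Env 𝓜 Γ) (f : Tm (Ty.nat :: Ty.nat :: Γ) Ty.nat)
    (m n : Tm Γ Ty.nat) : eval e (primRec f m n) = recVal e f (eval e m) (eval e n) := rfl

/-! The values of the primitive recursive operations. -/

def nPred (n : 𝓜.N) : 𝓜.N := recVal Env.nil v1 0 n
def nSub (m n : 𝓜.N) : 𝓜.N := recVal Env.nil (pred v0) m n
def nPow2 (n : 𝓜.N) : 𝓜.N := recVal Env.nil (add v0 v0) 1 n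
def nParity (n : 𝓜.N) : 𝓜.N := recVal Env.nil (sub one v0) 0 n
def nHalf (n : 𝓜.N) : 𝓜.N := recVal Env.nil (sub v1 v0) 0 n
def nTri (n : 𝓜.N) : 𝓜.N := recVal Env.nil (add v0 (succ v1)) 0 n
def nTriRoot (n : 𝓜.N) : 𝓜.N :=
  recVal Env.nil (add v0 (sub one (sub (tri (succ v0)) (succ v1)))) 0 n

variable [h𝓜 : 𝓜.IsBase]

theorem sat_rca0 {Γ : Ctx} {A : Fm Γ} (h : RCA0 Γ A) (e : Env 𝓜 Γ) : sat e A :=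
  h𝓜.sat (Or.inl h) e

theorem sat_ax1 {A : Fm [Ty.nat]} (h : RCA0 _ A) (a : 𝓜.N) : sat (Env.cons a Env.nil) A :=
  sat_rca0 h _

theorem sat_ax2 {A : Fm [Ty.nat, Ty.nat]} (h : RCA0 _ A) (a b : 𝓜.N) :
    sat (Env.cons b (Env.cons a Env.nil)) A :=
  sat_rca0 h _

theorem sat_ax3 {A : Fm [Ty.nat, Ty.nat, Ty.nat]} (h : RCA0 _ A) (a b c : 𝓜.N) :
    sat (Env.cons c (Env.cons b (Env.cons a Env.nil))) A :=
  sat_rca0 h _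

instance : CommSemiring 𝓜.N where
  add_assoc a b c := sat_ax3 (RCA0.add_assoc v2 v1 v0) a b c
  add_comm a b := sat_ax2 (RCA0.add_comm v1 v0) a b
  add_zero a := sat_ax1 (RCA0.add_zero v0) a
  zero_add a := (sat_ax2 (RCA0.add_comm v1 v0) 0 a).trans (sat_ax1 (RCA0.add_zero v0) a)
  nsmul := nsmulRec
  mul_assoc a b c := sat_ax3 (RCA0.mul_assoc v2 v1 v0) a b c
  mul_comm a b := sat_ax2 (RCA0.mul_comm v1 v0) a b
  mul_one a := sat_ax1 (RCA0.mul_one v0) a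
  one_mul a := (sat_ax2 (RCA0.mul_comm v1 v0) 1 a).trans (sat_ax1 (RCA0.mul_one v0) a)
  mul_zero a := sat_ax1 (RCA0.mul_zero v0) a
  zero_mul a := (sat_ax2 (RCA0.mul_comm v1 v0) 0 a).trans (sat_ax1 (RCA0.mul_zero v0) a)
  left_distrib a b c := sat_ax3 (RCA0.mul_add v2 v1 v0) a b c
  right_distrib a b c := by
    have h (x y : 𝓜.N) : x * y = y * x := sat_ax2 (RCA0.mul_comm v1 v0) x y
    rw [h, h a, h b]
    exact sat_ax3 (RCA0.mul_add v2 v1 v0) c a b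

theorem lt_irrefl_N (a : 𝓜.N) : ¬ 𝓜.lt a a := sat_ax1 (RCA0.lt_irrefl v0) a

theorem lt_trans_N {a b c : 𝓜.N} : 𝓜.lt a b → 𝓜.lt b c → 𝓜.lt a c :=
  sat_ax3 (RCA0.lt_trans v2 v1 v0) a b c

theorem lt_total_N (a b : 𝓜.N) : 𝓜.lt a b ∨ a = b ∨ 𝓜.lt b a := by
  have := sat_ax2 (RCA0.lt_total v1 v0) a b
  rwa [sat_or, sat_or] at this

theorem add_lt_add_N {a b : 𝓜.N} (c : 𝓜.N) : 𝓜.lt a b → 𝓜.lt (a + c) (b + c) :=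
  sat_ax3 (RCA0.add_lt_add v2 v1 v0) a b c

theorem mul_lt_mul_N {a b c : 𝓜.N} : 𝓜.lt a b → 𝓜.lt 0 c → 𝓜.lt (a * c) (b * c) :=
  sat_ax3 (RCA0.mul_lt_mul v2 v1 v0) a b c

noncomputable instance : LinearOrder 𝓜.N where
  lt a b := 𝓜.lt a b
  le a b := 𝓜.lt a b ∨ a = b
  le_refl a := Or.inr rfl
  le_trans a b c := by
    rintro (h1 | rfl) (h2 | rfl)
    · exact Or.inl (lt_trans_N h1 h2)
    · exact Or.inl h1
    · exact Or.inl h2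
    · exact Or.inr rfl
  lt_iff_le_not_ge a b := by
    constructor
    · intro h
      refine ⟨Or.inl h, ?_⟩
      rintro (h' | rfl)
      · exact lt_irrefl_N _ (lt_trans_N h h')
      · exact lt_irrefl_N _ h
    · rintro ⟨h | rfl, h'⟩
      · exact h
      · exact absurd (Or.inr rfl) h'
  le_antisymm a b := by
    rintro (h | h) (h' | h')
    · exact absurd (lt_trans_N h h') (lt_irrefl_N _)
    · exact h'.symm
    · exact h
    · exact h
  le_total a b := by
    rcases lt_total_N a b with h | h | h
    · exact Or.inl (Or.inl h)
    · exact Or.inl (Or.inr h)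
    · exact Or.inr (Or.inl h)
  toDecidableLE := Classical.decRel _

@[simp] theorem sat_lt {Γ : Ctx} (e : Env 𝓜 Γ) (s t : Tm Γ Ty.nat) :
    sat e (Fm.lt s t) ↔ eval e s < eval e t := Iff.rfl

instance : IsStrictOrderedRing 𝓜.N where
  add_le_add_left a b h c := by
    rcases h with h | rfl
    · exact Or.inl (add_lt_add_N c h)
    · exact le_rfl
  le_of_add_le_add_left a b c h := by
    by_contra hbc
    have hbc : c < b := not_le.1 hbc
    have h1 : c + a < b + a := add_lt_add_N a hbc
    rw [add_comm c, add_comm b] at h1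
    exact absurd h (not_le.2 h1)
  zero_le_one := Or.inl (sat_rca0 (Γ := []) RCA0.zero_lt_one Env.nil)
  exists_pair_ne := by
    have : (0 : 𝓜.N) < 1 := sat_rca0 (Γ := []) RCA0.zero_lt_one Env.nil
    exact ⟨0, 1, this.ne⟩
  mul_lt_mul_of_pos_left a ha b c h := by
    have : b * a < c * a := mul_lt_mul_N h ha
    simpa [mul_comm] using this
  mul_lt_mul_of_pos_right a ha b c h := mul_lt_mul_N h ha

theorem not_lt_zero_N (a : 𝓜.N) : ¬ a < 0 := sat_ax1 (RCA0.not_lt_zero v0) a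

theorem zero_le_N (a : 𝓜.N) : 0 ≤ a := not_lt.1 (not_lt_zero_N a)

theorem lt_add_one_N {a b : 𝓜.N} : a < b + 1 ↔ a ≤ b := by
  constructor
  · have h := sat_ax2 (RCA0.lt_add_one v1 v0) a b
    rw [sat_imp, sat_or] at h
    exact h
  · exact fun h => lt_of_le_of_lt h (lt_add_one b)

/-- Induction for a predicate that is defined by a quantifier-free formula with parameters. -/
theorem qf_induction {P : 𝓜.N → Prop} {Γ : Ctx} (e : Env 𝓜 Γ) (A : Fm (Ty.nat :: Γ)) (hA : A.QF)
    (hP : ∀ n, P n ↔ sat (Env.cons n e) A) (h0 : P 0) (hs : ∀ n, P n → P (n + 1)) (n : 𝓜.N) :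
    P n := by
  have h := sat_rca0 (RCA0.ind A hA) e
  have e1 (a : 𝓜.N) : (fun τ x => eval (Env.cons a e) (succSub τ x)) = Env.cons (a + 1) e := by
    funext τ x; cases x <;> rfl
  simp only [sat_imp, sat_all, sat_inst, Fm.succ, sat_subst, e1, ← hP] at h
  exact h h0 hs n

theorem eval_lam {Γ : Ctx} (e : Env 𝓜 Γ) {σ τ : Ty} (t : Tm (σ :: Γ) τ) (a : 𝓜.M σ) :
    𝓜.app (eval e (lam t)) a = eval (Env.cons a e) t := by
  have hproj : ∀ {σ τ : Ty} (x : 𝓜.M σ) (y : 𝓜.M τ),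
      𝓜.app (𝓜.app (𝓜.con (Con.proj σ τ)) x) y = x := by
    intro σ τ x y
    exact (sat_eqT _ _ _ _).1 (sat_rca0 (RCA0.proj (Γ := [σ, τ]) v0 v1)
      (Env.cons x (Env.cons y Env.nil)))
  have hcomb : ∀ {ρ σ τ : Ty} (x : 𝓜.M (ρ ⇒ σ ⇒ τ)) (y : 𝓜.M (ρ ⇒ σ)) (z : 𝓜.M ρ),
      𝓜.app (𝓜.app (𝓜.app (𝓜.con (Con.comb ρ σ τ)) x) y) z =
        𝓜.app (𝓜.app x z) (𝓜.app y z) := by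
    intro ρ σ τ x y z
    exact (sat_eqT _ _ _ _).1 (sat_rca0
      (RCA0.comb (Γ := [ρ ⇒ σ ⇒ τ, ρ ⇒ σ, ρ]) v0 v1 v2)
      (Env.cons x (Env.cons y (Env.cons z Env.nil))))
  suffices h : ∀ {Δ : Ctx} {τ : Ty} (t : Tm Δ τ) (hΔ : Δ = σ :: Γ),
      𝓜.app (eval e (lam (hΔ ▸ t))) a = eval (Env.cons a e) (hΔ ▸ t) from h t rfl
  intro Δ τ t
  induction t with
  | var x =>
    rintro rfl
    cases x with
    | z => simp only [lam, eval, hcomb, hproj]; rfl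
    | s x => simp only [lam, eval, hproj]; rfl
  | con c => rintro rfl; simp only [lam, eval, hproj]
  | app f b ihf ihb =>
    rintro rfl
    have h1 := ihf rfl
    have h2 := ihb rfl
    simp only at h1 h2
    simp only [lam, eval, hcomb, h1, h2]

@[simp] theorem recVal_zero {Γ : Ctx} (e : Env 𝓜 Γ) (f : Tm (Ty.nat :: Ty.nat :: Γ) Ty.nat)
    (m : 𝓜.N) : recVal e f m 0 = m :=
  sat_rca0 (RCA0.rec_zero (Γ := [_, Ty.nat]) v0 v1)
    (Env.cons (eval e (lam (lam f))) (Env.cons m Env.nil))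

@[simp] theorem recVal_succ {Γ : Ctx} (e : Env 𝓜 Γ) (f : Tm (Ty.nat :: Ty.nat :: Γ) Ty.nat)
    (m n : 𝓜.N) :
    recVal e f m (n + 1) = eval (Env.cons (recVal e f m n) (Env.cons n e)) f := by
  have h : recVal e f m (n + 1) =
      𝓜.app (𝓜.app (eval e (lam (lam f))) n) (recVal e f m n) :=
    sat_rca0 (RCA0.rec_succ (Γ := [_, Ty.nat, Ty.nat]) v0 v1 v2)
      (Env.cons (eval e (lam (lam f))) (Env.cons m (Env.cons n Env.nil)))
  rw [h, eval_lam, eval_lam]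

/-- The recursor only depends on the values of the step function. -/
theorem recVal_congr {Γ Δ : Ctx} {e : Env 𝓜 Γ} {e' : Env 𝓜 Δ}
    {f : Tm (Ty.nat :: Ty.nat :: Γ) Ty.nat} {f' : Tm (Ty.nat :: Ty.nat :: Δ) Ty.nat}
    (h : ∀ a b, eval (Env.cons b (Env.cons a e)) f = eval (Env.cons b (Env.cons a e')) f')
    (m n : 𝓜.N) : recVal e f m n = recVal e' f' m n := by
  have : eval e (lam (lam f)) = eval e' (lam (lam f')) :=
    𝓜.ext fun a => 𝓜.ext fun b => by simp only [eval_lam, h]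
  rw [recVal, this, recVal]

section

variable {Γ : Ctx} (e : Env 𝓜 Γ) (s t : Tm Γ Ty.nat)

@[simp] theorem eval_pred : eval e (pred t) = nPred (eval e t) :=
  recVal_congr (fun _ _ => rfl) _ _
@[simp] theorem eval_sub : eval e (sub s t) = nSub (eval e s) (eval e t) :=
  recVal_congr (fun _ _ => by simp) _ _
@[simp] theorem eval_pow2 : eval e (pow2 t) = nPow2 (eval e t) :=
  recVal_congr (fun _ _ => by simp) _ _
@[simp] theorem eval_parity : eval e (parity t) = nParity (eval e t) :=
  recVal_congr (fun _ _ => by simp) _ _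
@[simp] theorem eval_half : eval e (half t) = nHalf (eval e t) :=
  recVal_congr (fun _ _ => by simp) _ _
@[simp] theorem eval_tri : eval e (tri t) = nTri (eval e t) :=
  recVal_congr (fun _ _ => by simp) _ _
@[simp] theorem eval_triRoot : eval e (triRoot t) = nTriRoot (eval e t) :=
  recVal_congr (fun _ _ => by simp) _ _

end

@[simp] theorem nPred_zero : nPred (0 : 𝓜.N) = 0 := recVal_zero _ _ _
@[simp] theorem nPred_succ (n : 𝓜.N) : nPred (n + 1) = n := recVal_succ _ _ _ _
@[simp] theorem nSub_zero (m : 𝓜.N) : nSub m 0 = m := recVal_zero _ _ _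
theorem nSub_succ (m n : 𝓜.N) : nSub m (n + 1) = nPred (nSub m n) :=
  (recVal_succ _ _ _ _).trans (eval_pred _ _)
@[simp] theorem nPow2_zero : nPow2 (0 : 𝓜.N) = 1 := recVal_zero _ _ _
theorem nPow2_succ (n : 𝓜.N) : nPow2 (n + 1) = nPow2 n + nPow2 n := recVal_succ _ _ _ _
@[simp] theorem nParity_zero : nParity (0 : 𝓜.N) = 0 := recVal_zero _ _ _
theorem nParity_succ (n : 𝓜.N) : nParity (n + 1) = nSub 1 (nParity n) :=
  (recVal_succ _ _ _ _).trans (eval_sub _ _ _)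
@[simp] theorem nHalf_zero : nHalf (0 : 𝓜.N) = 0 := recVal_zero _ _ _
theorem nHalf_succ (n : 𝓜.N) : nHalf (n + 1) = nSub n (nHalf n) :=
  (recVal_succ _ _ _ _).trans (eval_sub _ _ _)
@[simp] theorem nTri_zero : nTri (0 : 𝓜.N) = 0 := recVal_zero _ _ _
theorem nTri_succ (n : 𝓜.N) : nTri (n + 1) = nTri n + (n + 1) := recVal_succ _ _ _ _
@[simp] theorem nTriRoot_zero : nTriRoot (0 : 𝓜.N) = 0 := recVal_zero _ _ _
theorem nTriRoot_succ (n : 𝓜.N) : nTriRoot (n + 1) =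
    nTriRoot n + nSub 1 (nSub (nTri (nTriRoot n + 1)) (n + 1)) := by
  refine (recVal_succ _ _ _ _).trans ?_
  simp only [eval_add, eval_sub, eval_tri, eval_succ, eval_one, eval_var, Env.cons_z, Env.cons_s,
    nTriRoot]

end Arithmetic

/-! ### Truncated subtraction, powers of two and pairs -/

section Coding

variable {𝓜 : Model}

@[simp] theorem eval_two {Γ : Ctx} (e : Env 𝓜 Γ) : eval e two = 1 + 1 := rfl

variable [h𝓜 : 𝓜.IsBase]

theorem eq_zero_or_succ (n : 𝓜.N) : n = 0 ∨ n = nPred n + 1 := by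
  refine qf_induction (P := fun n : 𝓜.N => n = 0 ∨ n = nPred n + 1) Env.nil
    ((Fm.eq v0 zero).or (Fm.eq v0 (succ (pred v0)))) (by simp [Fm.QF, Fm.or, Fm.neg])
    (by intro n; simp) (Or.inl rfl) ?_ n
  intro n _
  right; simp

theorem nSub_spec (m n : 𝓜.N) : nSub m n + n = m ∨ (nSub m n = 0 ∧ m ≤ n) := by
  refine qf_induction (P := fun n : 𝓜.N => nSub m n + n = m ∨ (nSub m n = 0 ∧ m ≤ n))
    (Env.cons m Env.nil)
    ((Fm.eq (add (sub v1 v0) v0) v1).or ((Fm.eq (sub v1 v0) zero).and (Fm.lt v0 v1).neg))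
    (by simp [Fm.QF, Fm.or, Fm.neg, Fm.and]) (by intro n; simp) (Or.inl (by simp)) ?_ n
  · rintro n (h | ⟨h, h'⟩)
    · rw [nSub_succ]
      rcases eq_zero_or_succ (nSub m n) with h0 | h0
      · right
        rw [h0] at h ⊢
        rw [zero_add] at h
        exact ⟨nPred_zero, h ▸ (lt_add_one n).le⟩
      · left
        rw [h0] at h
        rw [← add_assoc, add_right_comm]
        exact h
    · right
      rw [nSub_succ, h]
      exact ⟨nPred_zero, h'.trans (lt_add_one n).le⟩

theorem nSub_add_cancel {m n : 𝓜.N} (h : n ≤ m) : nSub m n + n = m := by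
  rcases nSub_spec m n with h' | ⟨h1, h2⟩
  · exact h'
  · rw [h1, zero_add]; exact le_antisymm h h2

theorem nSub_eq_zero {m n : 𝓜.N} (h : m ≤ n) : nSub m n = 0 := by
  rcases nSub_spec m n with h' | ⟨h1, h2⟩
  · refine le_antisymm ?_ (zero_le_N _)
    by_contra h0
    have h0 := not_le.1 h0
    have : n < nSub m n + n := lt_add_of_pos_left n h0
    rw [h'] at this
    exact absurd h (not_le.2 this)
  · exact h1

instance : CanonicallyOrderedAdd 𝓜.N where
  exists_add_of_le {a b} h := ⟨nSub b a, by rw [add_comm]; exact (nSub_add_cancel h).symm⟩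
  le_add_self a b := le_add_of_nonneg_left (zero_le_N b)
  le_self_add a b := le_add_of_nonneg_right (zero_le_N b)

theorem nSub_add_right (a b : 𝓜.N) : nSub (a + b) b = a :=
  add_right_cancel (nSub_add_cancel le_add_self)

theorem nSub_add_left (a b : 𝓜.N) : nSub (a + b) a = b := by rw [add_comm, nSub_add_right]

theorem nPow2_add (n m : 𝓜.N) : nPow2 (n + m) = nPow2 n * nPow2 m := by
  refine qf_induction (P := fun m : 𝓜.N => nPow2 (n + m) = nPow2 n * nPow2 m)
    (Env.cons n Env.nil) (Fm.eq (pow2 (add v1 v0)) (mul (pow2 v1) (pow2 v0))) trivial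
    (by intro n; simp) (by simp) ?_ m
  intro m h
  rw [← add_assoc, nPow2_succ, nPow2_succ, h, mul_add]

theorem lt_nPow2 (n : 𝓜.N) : n < nPow2 n := by
  refine qf_induction (P := fun n : 𝓜.N => n < nPow2 n) Env.nil (Fm.lt v0 (pow2 v0)) trivial
    (by intro n; simp) (by simp) ?_ n
  intro n h
  rw [nPow2_succ]
  have h1 : 1 ≤ nPow2 n := by
    have := lt_of_le_of_lt (zero_le_N n) h
    rwa [← zero_add (1 : 𝓜.N), ← not_lt, lt_add_one_N, not_le]
  exact add_lt_add_of_lt_of_le h h1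

theorem nPow2_pos (n : 𝓜.N) : 0 < nPow2 n := lt_of_le_of_lt (zero_le_N n) (lt_nPow2 n)

theorem nHalf_nParity_double (n : 𝓜.N) : nParity (n + n) = 0 ∧ nHalf (n + n) = n := by
  refine qf_induction (P := fun n : 𝓜.N => nParity (n + n) = 0 ∧ nHalf (n + n) = n) Env.nil
    ((Fm.eq (parity (add v0 v0)) zero).and (Fm.eq (half (add v0 v0)) v0))
    (by simp [Fm.QF, Fm.neg, Fm.and]) (by intro n; simp) (by simp) ?_ n
  rintro n ⟨h1, h2⟩
  have e : n + 1 + (n + 1) = n + n + 1 + 1 := by ring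
  have e1 : nSub (1 : 𝓜.N) 1 = 0 := nSub_eq_zero le_rfl
  rw [e, nParity_succ, nParity_succ, nHalf_succ, nHalf_succ, h1, h2, nSub_zero, e1, nSub_add_left,
    add_assoc, nSub_add_left]
  exact ⟨rfl, rfl⟩

theorem nParity_double_succ (n : 𝓜.N) : nParity (n + n + 1) = 1 := by
  rw [nParity_succ, (nHalf_nParity_double n).1, nSub_zero]

theorem nHalf_double_succ (n : 𝓜.N) : nHalf (n + n + 1) = n := by
  rw [nHalf_succ, (nHalf_nParity_double n).2, nSub_add_left]

theorem nTri_double (n : 𝓜.N) : nTri n + nTri n = n * (n + 1) := by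
  refine qf_induction (P := fun n : 𝓜.N => nTri n + nTri n = n * (n + 1)) Env.nil
    (Fm.eq (add (tri v0) (tri v0)) (mul v0 (succ v0))) trivial (by intro n; simp) (by simp) ?_ n
  intro n h
  rw [nTri_succ, add_add_add_comm, h]
  ring

theorem nTri_mono {a b : 𝓜.N} (h : a ≤ b) : nTri a ≤ nTri b := by
  by_contra hlt
  have hlt := not_le.1 hlt
  have h1 := add_lt_add hlt hlt
  rw [nTri_double, nTri_double] at h1
  exact absurd (mul_le_mul h (by gcongr) (zero_le_N _) (zero_le_N _)) (not_le.2 h1)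

theorem nTriRoot_spec (z : 𝓜.N) : nTri (nTriRoot z) ≤ z ∧ z < nTri (nTriRoot z + 1) := by
  refine qf_induction (P := fun z : 𝓜.N => nTri (nTriRoot z) ≤ z ∧ z < nTri (nTriRoot z + 1))
    Env.nil ((Fm.lt v0 (tri (triRoot v0))).neg.and (Fm.lt v0 (tri (succ (triRoot v0)))))
    (by simp [Fm.QF, Fm.neg, Fm.and]) (by intro n; simp) ?_ ?_ z
  · rw [nTriRoot_zero, nTri_succ]
    simp
  · rintro z ⟨h1, h2⟩
    have h3 : z + 1 ≤ nTri (nTriRoot z + 1) := by rwa [← lt_add_one_N, add_lt_add_iff_right]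
    rcases h3.eq_or_lt with h4 | h4
    · have h5 : nTriRoot (z + 1) = nTriRoot z + 1 := by
        rw [nTriRoot_succ, ← h4, nSub_eq_zero le_rfl, nSub_zero]
      rw [h5]
      refine ⟨h4.ge, ?_⟩
      rw [nTri_succ, ← h4]
      exact lt_add_of_pos_right _ (by positivity)
    · have h5 : nTriRoot (z + 1) = nTriRoot z := by
        rw [nTriRoot_succ]
        have : 1 ≤ nSub (nTri (nTriRoot z + 1)) (z + 1) := by
          rw [← not_lt]
          intro h
          have h6 := nSub_add_cancel h3
          have h7 : nSub (nTri (nTriRoot z + 1)) (z + 1) = 0 := by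
            refine le_antisymm ?_ (zero_le_N _)
            rwa [← lt_add_one_N, zero_add]
          rw [h7, zero_add] at h6
          exact h4.ne h6
        rw [nSub_eq_zero this, add_zero]
      rw [h5]
      exact ⟨h1.trans (lt_add_one z).le, h4⟩

theorem nTriRoot_eq {z w : 𝓜.N} (h1 : nTri w ≤ z) (h2 : z < nTri (w + 1)) : nTriRoot z = w := by
  obtain ⟨h3, h4⟩ := nTriRoot_spec z
  refine le_antisymm ?_ ?_
  · rw [← lt_add_one_N]
    by_contra h
    exact absurd (nTri_mono (not_lt.1 h)) (not_le.2 (lt_of_le_of_lt h3 h2))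
  · rw [← lt_add_one_N]
    by_contra h
    exact absurd (nTri_mono (not_lt.1 h)) (not_le.2 (lt_of_le_of_lt h1 h4))

/-- The value of the pairing function. -/
def nPair (x y : 𝓜.N) : 𝓜.N := nTri (x + y) + x

/-- The value of the first projection. -/
def nFst (z : 𝓜.N) : 𝓜.N := nSub z (nTri (nTriRoot z))

/-- The value of the second projection. -/
def nSnd (z : 𝓜.N) : 𝓜.N := nSub (nTriRoot z) (nFst z)

section

variable {Γ : Ctx} (e : Env 𝓜 Γ) (s t : Tm Γ Ty.nat)

@[simp] theorem eval_pair : eval e (pair s t) = nPair (eval e s) (eval e t) := by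
  simp [pair, nPair]

@[simp] theorem eval_fst : eval e (fst t) = nFst (eval e t) := by
  simp [fst, nFst]

@[simp] theorem eval_snd : eval e (snd t) = nSnd (eval e t) := by
  simp [snd, nSnd]

end

theorem nTriRoot_nPair (x y : 𝓜.N) : nTriRoot (nPair x y) = x + y := by
  refine nTriRoot_eq le_self_add ?_
  rw [nTri_succ, nPair, add_lt_add_iff_left, lt_add_one_N]
  exact le_self_add

@[simp] theorem nFst_nPair (x y : 𝓜.N) : nFst (nPair x y) = x := by
  rw [nFst, nTriRoot_nPair, nPair, nSub_add_left]

@[simp] theorem nSnd_nPair (x y : 𝓜.N) : nSnd (nPair x y) = y := by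
  rw [nSnd, nTriRoot_nPair, nFst_nPair, nSub_add_left]

/-! ### Rational numbers in the model -/

/-- The positive part of the numerator. -/
def nNumPos (q : 𝓜.N) : 𝓜.N := nSub 1 (nParity (nFst q)) * nHalf (nFst q)

/-- The negative part of the numerator. -/
def nNumNeg (q : 𝓜.N) : 𝓜.N := nParity (nFst q) * (nHalf (nFst q) + 1)

/-- The denominator. -/
def nDen (q : 𝓜.N) : 𝓜.N := nSnd q + 1

theorem nDen_pos (q : 𝓜.N) : 0 < nDen q := lt_of_le_of_lt (zero_le_N _) (lt_add_one _)

/-- The value of the code of a rational. -/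
def nMkRat (p m d : 𝓜.N) : 𝓜.N :=
  nPair ((1 + 1) * nSub p m + nPred ((1 + 1) * nSub m p)) (nPred d)

section

variable {Γ : Ctx} (e : Env 𝓜 Γ) (s t u : Tm Γ Ty.nat)

@[simp] theorem eval_numPos : eval e (numPos t) = nNumPos (eval e t) := by
  simp [numPos, nNumPos]
@[simp] theorem eval_numNeg : eval e (numNeg t) = nNumNeg (eval e t) := by
  simp [numNeg, nNumNeg]
@[simp] theorem eval_den : eval e (den t) = nDen (eval e t) := by
  simp [den, nDen]
@[simp] theorem eval_mkRat :
    eval e (mkRat s t u) = nMkRat (eval e s) (eval e t) (eval e u) := by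
  simp [mkRat, nMkRat]

end

/-- The rational with code `q`, as an element of the field of fractions of the domain of numbers. -/
noncomputable def fracVal (q : 𝓜.N) : FracField 𝓜.N :=
  (FracField.of (nNumPos q) - FracField.of (nNumNeg q)) / FracField.of (nDen q)

variable (𝓜) in
/-- The ordered field in which the rationals and the reals of the model take their values. -/
def Model.F : Type := LimitField 𝓜.N

noncomputable instance : Field 𝓜.F := inferInstanceAs (Field (LimitField 𝓜.N))
noncomputable instance : LinearOrder 𝓜.F := inferInstanceAs (LinearOrder (LimitField 𝓜.N))
instance : IsStrictOrderedRing 𝓜.F := inferInstanceAs (IsStrictOrderedRing (LimitField 𝓜.N))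
instance : IsOrderedRing 𝓜.F := IsStrictOrderedRing.toIsOrderedRing
instance : IsOrderedAddMonoid 𝓜.F := IsOrderedRing.toIsOrderedAddMonoid
instance : AddLeftMono 𝓜.F := IsOrderedAddMonoid.toAddLeftMono
instance : AddRightMono 𝓜.F := IsOrderedAddMonoid.toAddRightMono

/-- The inclusion of the fractions of numbers of the model. -/
noncomputable def fracCast : FracField 𝓜.N →+* 𝓜.F := LimitField.const

/-- The inclusion of the numbers of the model. -/
noncomputable def nCast : 𝓜.N →+* 𝓜.F := LimitField.of

theorem fracCast_of (a : 𝓜.N) : fracCast (FracField.of a) = nCast a := rfl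

theorem nCast_lt {a b : 𝓜.N} : (nCast a : 𝓜.F) < nCast b ↔ a < b :=
  LimitField.of_strictMono.lt_iff_lt

theorem nCast_le {a b : 𝓜.N} : (nCast a : 𝓜.F) ≤ nCast b ↔ a ≤ b :=
  LimitField.of_strictMono.le_iff_le

theorem nCast_nonneg (a : 𝓜.N) : (0 : 𝓜.F) ≤ nCast a := by
  rw [← map_zero nCast, nCast_le]; exact zero_le_N a

theorem nCast_pos {a : 𝓜.N} : (0 : 𝓜.F) < nCast a ↔ 0 < a := by
  rw [← map_zero nCast, nCast_lt]

/-- The rational with code `q`. -/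
noncomputable def ratVal (q : 𝓜.N) : 𝓜.F := fracCast (fracVal q)

theorem ratVal_eq (q : 𝓜.N) :
    ratVal q = (nCast (nNumPos q) - nCast (nNumNeg q)) / nCast (nDen q) := by
  simp only [ratVal, fracVal, map_div₀, map_sub, fracCast_of]

theorem nMkRat_spec (p m d : 𝓜.N) (hd : 0 < d) :
    nNumPos (nMkRat p m d) = nSub p m ∧ nNumNeg (nMkRat p m d) = nSub m p ∧
      nDen (nMkRat p m d) = d := by
  have hd' : nDen (nMkRat p m d) = d := by
    rw [nDen, nMkRat, nSnd_nPair]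
    exact ((eq_zero_or_succ d).resolve_left hd.ne').symm
  have e (a : 𝓜.N) : (1 + 1) * a = a + a := by ring
  have e1 : nSub (1 : 𝓜.N) 1 = 0 := nSub_eq_zero le_rfl
  refine ⟨?_, ?_, hd'⟩ <;> simp only [nNumPos, nNumNeg, nMkRat, nFst_nPair, e]
  all_goals
    rcases le_total m p with h | h
    · rw [nSub_eq_zero h, add_zero, nPred_zero, add_zero, (nHalf_nParity_double _).1,
        (nHalf_nParity_double _).2]
      simp
    · rw [nSub_eq_zero h, add_zero, zero_add]
      rcases eq_zero_or_succ (nSub m p) with h' | h'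
      · rw [h']; simp
      · rw [h']
        set k := nPred (nSub m p)
        have : k + 1 + (k + 1) = (k + k + 1) + 1 := by ring
        rw [this, nPred_succ, nParity_double_succ, nHalf_double_succ]
        simp [e1]

theorem nCast_nSub_sub (p m : 𝓜.N) :
    (nCast (nSub p m) - nCast (nSub m p) : 𝓜.F) = nCast p - nCast m := by
  rcases le_total m p with h | h
  · rw [nSub_eq_zero h]
    conv_rhs => rw [← nSub_add_cancel h]
    simp
  · rw [nSub_eq_zero h]
    conv_rhs => rw [← nSub_add_cancel h]
    simp

theorem ratVal_nMkRat (p m : 𝓜.N) {d : 𝓜.N} (hd : 0 < d) :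
    ratVal (nMkRat p m d) = (nCast p - nCast m) / nCast d := by
  obtain ⟨h1, h2, h3⟩ := nMkRat_spec p m d hd
  rw [ratVal_eq, h1, h2, h3, nCast_nSub_sub]

theorem nNumPos_or_nNumNeg (q : 𝓜.N) : nNumPos q = 0 ∨ nNumNeg q = 0 := by
  have : nParity (nFst q) = 0 ∨ nParity (nFst q) = 1 := by
    refine qf_induction (P := fun n : 𝓜.N => nParity n = 0 ∨ nParity n = 1) Env.nil
      ((Fm.eq (parity v0) zero).or (Fm.eq (parity v0) one))
      (by simp [Fm.QF, Fm.or, Fm.neg]) (by intro n; simp) (by simp) ?_ _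
    rintro n (h | h)
    · right; rw [nParity_succ, h, nSub_zero]
    · left; rw [nParity_succ, h, nSub_eq_zero le_rfl]
  rcases this with h | h
  · right; rw [nNumNeg, h, zero_mul]
  · left; rw [nNumPos, h, nSub_eq_zero le_rfl, zero_mul]

theorem nCast_nDen_pos (q : 𝓜.N) : (0 : 𝓜.F) < nCast (nDen q) := nCast_pos.2 (nDen_pos q)

section

variable {Γ : Ctx} (e : Env 𝓜 Γ) (q r s t : Tm Γ Ty.nat)

@[simp] theorem ratVal_ratAdd : ratVal (eval e (ratAdd q r)) =
    ratVal (eval e q) + ratVal (eval e r) := by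
  have h1 := nCast_nDen_pos (eval e q)
  have h2 := nCast_nDen_pos (eval e r)
  simp only [ratAdd, eval_mkRat, eval_add, eval_mul, eval_numPos, eval_den, eval_numNeg]
  rw [ratVal_nMkRat _ _ (mul_pos (nDen_pos _) (nDen_pos _)), ratVal_eq, ratVal_eq]
  simp only [map_add, map_mul]
  field_simp
  ring

@[simp] theorem ratVal_ratNeg : ratVal (eval e (ratNeg q)) = -ratVal (eval e q) := by
  simp only [ratNeg, eval_mkRat, eval_numPos, eval_den, eval_numNeg]
  rw [ratVal_nMkRat _ _ (nDen_pos _), ratVal_eq]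
  ring

@[simp] theorem ratVal_ratSub : ratVal (eval e (ratSub q r)) =
    ratVal (eval e q) - ratVal (eval e r) := by
  simp only [ratSub, ratVal_ratAdd, ratVal_ratNeg]; ring

@[simp] theorem ratVal_ratAbs : ratVal (eval e (ratAbs q)) = |ratVal (eval e q)| := by
  simp only [ratAbs, eval_mkRat, eval_numPos, eval_den, eval_numNeg, eval_add, eval_zero]
  rw [ratVal_nMkRat _ _ (nDen_pos _), ratVal_eq, abs_div, abs_of_pos (nCast_nDen_pos (eval e q))]
  congr 1
  have h1 := nCast_nonneg (nNumPos (eval e q))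
  have h2 := nCast_nonneg (nNumNeg (eval e q))
  rcases nNumPos_or_nNumNeg (eval e q) with h | h
  · rw [h]; simp [abs_of_nonneg h2]
  · rw [h]; simp [abs_of_nonneg h1]

@[simp] theorem sat_ratLt : sat e (ratLt q r) ↔ ratVal (eval e q) < ratVal (eval e r) := by
  have h1 := nCast_nDen_pos (eval e q)
  have h2 := nCast_nDen_pos (eval e r)
  simp only [ratLt, sat_lt, eval_add, eval_mul, eval_numPos, eval_den, eval_numNeg]
  rw [ratVal_eq, ratVal_eq, div_lt_div_iff₀ h1 h2, ← nCast_lt]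
  simp only [map_add, map_mul, sub_mul]
  constructor <;> intro h <;> linarith

@[simp] theorem sat_ratLe : sat e (ratLe q r) ↔ ratVal (eval e q) ≤ ratVal (eval e r) := by
  simp [ratLe]

end

/-- The rational `2 ^ (-n)`. -/
noncomputable def twoNeg (n : 𝓜.N) : 𝓜.F := 1 / nCast (nPow2 n)

theorem twoNeg_pos (n : 𝓜.N) : 0 < twoNeg n := one_div_pos.2 (nCast_pos.2 (nPow2_pos n))

theorem twoNeg_succ (n : 𝓜.N) : twoNeg (n + 1) = twoNeg n / 2 := by
  have := nCast_pos.2 (nPow2_pos n)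
  rw [twoNeg, twoNeg, nPow2_succ, map_add]
  field_simp
  ring

theorem twoNeg_anti {m n : 𝓜.N} (h : m ≤ n) : twoNeg n ≤ twoNeg m := by
  obtain ⟨k, rfl⟩ := exists_add_of_le h
  refine one_div_le_one_div_of_le (nCast_pos.2 (nPow2_pos m)) ?_
  rw [nCast_le, nPow2_add]
  refine le_mul_of_one_le_right (zero_le_N _) ?_
  rw [← not_lt, ← zero_add (1 : 𝓜.N), lt_add_one_N, not_le]
  exact nPow2_pos k

@[simp] theorem ratVal_dyadic {Γ : Ctx} (e : Env 𝓜 Γ) (s t : Tm Γ Ty.nat) :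
    ratVal (eval e (dyadic s t)) = nCast (eval e s) * twoNeg (eval e t) := by
  simp only [dyadic, eval_mkRat, eval_zero, eval_pow2]
  rw [ratVal_nMkRat _ _ (nPow2_pos _), twoNeg, map_zero, sub_zero, mul_one_div]

end Coding

section Reals

variable {𝓜 : Model} [h𝓜 : 𝓜.IsBase]

/-! ### Separation and nearness in the limit field -/

/-- `a` is less than `b` by at least some `2 ^ (-n)`, for a number `n` of the model. -/
def FarLt (a b : 𝓜.F) : Prop := ∃ n : 𝓜.N, a + twoNeg n < b

/-- `a` and `b` differ by at most `2 ^ (-n)`, for all numbers `n` of the model. -/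
def Near (a b : 𝓜.F) : Prop := ∀ n : 𝓜.N, |a - b| ≤ twoNeg n

theorem fracCast_abs (a : FracField 𝓜.N) : fracCast |a| = |fracCast a| :=
  LimitField.const_abs a

/-- The rationals of the model are Archimedean with respect to the numbers of the model. -/
theorem exists_twoNeg_lt {a : FracField 𝓜.N} (h : 0 < fracCast a) :
    ∃ n : 𝓜.N, twoNeg n < fracCast a := by
  obtain ⟨p, d, hd, ha⟩ := FracField.exists_eq_or a
  have e : fracCast (FracField.of p / FracField.of d : FracField 𝓜.N) =
      nCast p / nCast d := by rw [map_div₀, fracCast_of, fracCast_of]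
  have hd' : (0 : 𝓜.F) < nCast d := nCast_pos.2 (pos_iff_ne_zero.2 hd)
  rcases ha with rfl | rfl
  · rw [e] at h ⊢
    refine ⟨d, ?_⟩
    have hp : 0 < p := nCast_pos.1 ((div_pos_iff_of_pos_right hd').1 h)
    have hp' : (1 : 𝓜.F) ≤ nCast p := by
      rw [← map_one nCast, nCast_le, ← not_lt, ← zero_add (1 : 𝓜.N), lt_add_one_N, not_le]
      exact hp
    calc twoNeg d < 1 / nCast d := one_div_lt_one_div_of_lt hd' (nCast_lt.2 (lt_nPow2 d))
      _ ≤ nCast p / nCast d := by gcongr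
  · rw [map_neg, e] at h
    have : (0 : 𝓜.F) ≤ nCast p / nCast d := div_nonneg (nCast_nonneg p) hd'.le
    linarith

theorem FarLt.lt {a b : 𝓜.F} (h : FarLt a b) : a < b := by
  obtain ⟨n, h⟩ := h
  have := twoNeg_pos n
  linarith

theorem FarLt.trans_le {a b c : 𝓜.F} (h : FarLt a b) (h' : b ≤ c) : FarLt a c := by
  obtain ⟨n, h⟩ := h
  exact ⟨n, h.trans_le h'⟩

theorem FarLt.of_near {a a' b b' : 𝓜.F} (ha : Near a a') (hb : Near b b') (h : FarLt a b) :
    FarLt a' b' := by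
  obtain ⟨n, h⟩ := h
  have h1 := abs_le.1 (ha (n + 2))
  have h2 := abs_le.1 (hb (n + 2))
  have e : n + 2 = n + 1 + 1 := by ring
  rw [e, twoNeg_succ, twoNeg_succ] at h1 h2
  refine ⟨n + 1 + 1, ?_⟩
  rw [twoNeg_succ, twoNeg_succ]
  have := twoNeg_pos n
  linarith [h1.1, h1.2, h2.1, h2.2]

theorem not_farLt {a b : 𝓜.F} : ¬ FarLt a b ↔ ∀ n, b ≤ a + twoNeg n := by
  simp [FarLt]

theorem near_refl (a : 𝓜.F) : Near a a := fun n => by simpa using (twoNeg_pos n).le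

theorem Near.symm {a b : 𝓜.F} (h : Near a b) : Near b a := fun n => by
  rw [abs_sub_comm]; exact h n

theorem near_of_le {a b : 𝓜.F} (h : ∀ n, |a - b| ≤ 8 * twoNeg n) : Near a b := fun n => by
  have := h (n + 1 + 1 + 1)
  rw [twoNeg_succ, twoNeg_succ, twoNeg_succ] at this
  linarith

theorem Near.trans {a b c : 𝓜.F} (h1 : Near a b) (h2 : Near b c) : Near a c :=
  near_of_le fun n => by
    have := abs_sub_le a b c
    linarith [h1 n, h2 n, twoNeg_pos n]

theorem Near.farLt_iff {a a' b b' : 𝓜.F} (ha : Near a a') (hb : Near b b') :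
    FarLt a b ↔ FarLt a' b' :=
  ⟨FarLt.of_near ha hb, FarLt.of_near ha.symm hb.symm⟩

theorem Near.add {a a' b b' : 𝓜.F} (ha : Near a a') (hb : Near b b') :
    Near (a + b) (a' + b') :=
  near_of_le fun n => by
    have := abs_add_le (a - a') (b - b')
    rw [add_sub_add_comm]
    linarith [ha n, hb n, twoNeg_pos n]

theorem Near.neg {a a' : 𝓜.F} (ha : Near a a') : Near (-a) (-a') := fun n => by
  rw [neg_sub_neg, abs_sub_comm]; exact ha n

theorem Near.sub {a a' b b' : 𝓜.F} (ha : Near a a') (hb : Near b b') :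
    Near (a - b) (a' - b') := by
  rw [sub_eq_add_neg, sub_eq_add_neg]; exact ha.add hb.neg

theorem Near.abs {a a' : 𝓜.F} (ha : Near a a') : Near |a| |a'| := fun n =>
  (abs_abs_sub_abs_le a a').trans (ha n)

/-! ### Real numbers in the model -/

/-- The rational `x(n)`. -/
noncomputable def seqVal (x : 𝓜.M Ty.one) (n : 𝓜.N) : 𝓜.F := ratVal (𝓜.app x n)

/-- The sequence `x` represents a real. -/
def IsReal (x : 𝓜.M Ty.one) : Prop := ∀ n i : 𝓜.N, |seqVal x n - seqVal x (n + i)| < twoNeg n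

/-- The limit of a sequence of rationals in the limit field; if the sequence represents a real, the
limit is determined up to nearness. -/
noncomputable def limVal (x : 𝓜.M Ty.one) : 𝓜.F :=
  LimitField.lim fun n => fracVal (𝓜.app x n)

theorem IsReal.abs_seqVal_sub_le {x : 𝓜.M Ty.one} (h : IsReal x) {m n : 𝓜.N} (hmn : m ≤ n) :
    |seqVal x m - seqVal x n| < twoNeg m := by
  obtain ⟨i, rfl⟩ := exists_add_of_le hmn
  exact h m i

theorem IsReal.abs_sub_limVal {x : 𝓜.M Ty.one} (h : IsReal x) (n : 𝓜.N) :
    |seqVal x n - limVal x| ≤ twoNeg n := by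
  have e : fracCast (1 / FracField.of (nPow2 n) : FracField 𝓜.N) = twoNeg n := by
    rw [map_div₀, map_one, fracCast_of]; rfl
  rw [← e]
  refine LimitField.abs_sub_lim_le (q := fun n => fracVal (𝓜.app x n)) fun k hk => ?_
  change |seqVal x n - seqVal x k| ≤ fracCast _
  rw [e]
  exact (h.abs_seqVal_sub_le hk).le

theorem IsReal.limVal_near {x : 𝓜.M Ty.one} (h : IsReal x) {a : 𝓜.F}
    (ha : ∀ n, |seqVal x n - a| ≤ 4 * twoNeg n) : Near (limVal x) a :=
  near_of_le fun n => by
    have h1 := abs_le.1 (h.abs_sub_limVal n)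
    have h2 := abs_le.1 (ha n)
    have := twoNeg_pos n
    rw [abs_le]
    constructor <;> linarith [h1.1, h1.2, h2.1, h2.2]

theorem IsReal.farLt_iff {x y : 𝓜.M Ty.one} (hx : IsReal x) (hy : IsReal y) :
    (∃ n, 2 * twoNeg n < seqVal y n - seqVal x n) ↔ FarLt (limVal x) (limVal y) := by
  constructor
  · rintro ⟨n, h⟩
    have e : fracCast (fracVal (𝓜.app y n) - fracVal (𝓜.app x n) -
        2 * (1 / FracField.of (nPow2 n)) : FracField 𝓜.N) =
          seqVal y n - seqVal x n - 2 * twoNeg n := by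
      simp only [map_sub, map_mul, map_div₀, map_one, map_ofNat]; rfl
    obtain ⟨m, hm⟩ := exists_twoNeg_lt (a := fracVal (𝓜.app y n) - fracVal (𝓜.app x n) -
        2 * (1 / FracField.of (nPow2 n))) (by rw [e]; linarith)
    rw [e] at hm
    have h1 := abs_le.1 (hx.abs_sub_limVal n)
    have h2 := abs_le.1 (hy.abs_sub_limVal n)
    exact ⟨m, by linarith [h1.1, h1.2, h2.1, h2.2]⟩
  · rintro ⟨n, h⟩
    refine ⟨n + 1 + 1 + 1, ?_⟩
    have h1 := abs_le.1 (hx.abs_sub_limVal (n + 1 + 1 + 1))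
    have h2 := abs_le.1 (hy.abs_sub_limVal (n + 1 + 1 + 1))
    simp only [twoNeg_succ] at h1 h2 ⊢
    have := twoNeg_pos n
    linarith [h1.1, h1.2, h2.1, h2.2]

theorem IsReal.near_iff {x y : 𝓜.M Ty.one} (hx : IsReal x) (hy : IsReal y) :
    (∀ n, |seqVal x n - seqVal y n| ≤ 2 * twoNeg n) ↔ Near (limVal x) (limVal y) := by
  constructor
  · intro h
    refine near_of_le fun n => ?_
    have h1 := abs_le.1 (hx.abs_sub_limVal n)
    have h2 := abs_le.1 (hy.abs_sub_limVal n)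
    have h3 := abs_le.1 (h n)
    have := twoNeg_pos n
    rw [abs_le]
    constructor <;> linarith [h1.1, h1.2, h2.1, h2.2, h3.1, h3.2]
  · intro h n
    by_contra hn
    have e : fracCast (|fracVal (𝓜.app x n) - fracVal (𝓜.app y n)| -
        2 * (1 / FracField.of (nPow2 n)) : FracField 𝓜.N) =
          |seqVal x n - seqVal y n| - 2 * twoNeg n := by
      simp only [map_sub, map_mul, map_div₀, map_one, map_ofNat, fracCast_abs]; rfl
    obtain ⟨m, hm⟩ := exists_twoNeg_lt (a := |fracVal (𝓜.app x n) - fracVal (𝓜.app y n)| -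
        2 * (1 / FracField.of (nPow2 n))) (by rw [e]; linarith)
    rw [e] at hm
    have h1 := abs_le.1 (hx.abs_sub_limVal n)
    have h2 := abs_le.1 (hy.abs_sub_limVal n)
    have h3 := abs_le.1 (h m)
    have h4 : |seqVal x n - seqVal y n| ≤ twoNeg m + 2 * twoNeg n := by
      rw [abs_le]
      constructor <;> linarith [h1.1, h1.2, h2.1, h2.2, h3.1, h3.2]
    linarith

/-- The sequence `x` represents a real in `[0, 1]`. Its limit in the limit field may exceed these
bounds by an amount that is at most `2 ^ (-n)` for all `n`. -/
def InUnit (x : 𝓜.M Ty.one) : Prop :=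
  IsReal x ∧ ¬ FarLt (limVal x) 0 ∧ ¬ FarLt 1 (limVal x)

theorem isReal_const {x : 𝓜.M Ty.one} {a : 𝓜.F} (h : ∀ n, seqVal x n = a) : IsReal x := by
  intro n i
  rw [h, h, sub_self, abs_zero]
  exact twoNeg_pos n

theorem limVal_const {x : 𝓜.M Ty.one} {a : 𝓜.F} (h : ∀ n, seqVal x n = a) :
    Near (limVal x) a :=
  (isReal_const h).limVal_near fun n => by
    rw [h, sub_self, abs_zero]
    linarith [twoNeg_pos n]

section

variable {Γ : Ctx} (e : Env 𝓜 Γ)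

@[simp] theorem seqVal_lam (t : Tm (Ty.nat :: Γ) Ty.nat) (n : 𝓜.N) :
    seqVal (eval e (lam t)) n = ratVal (eval (Env.cons n e) t) := by
  rw [seqVal, eval_lam]

@[simp] theorem seqVal_realAdd (x y : Tm Γ Ty.one) (n : 𝓜.N) :
    seqVal (eval e (realAdd x y)) n =
      seqVal (eval e x) (n + 1) + seqVal (eval e y) (n + 1) := by
  rw [realAdd, seqVal_lam]; simp [seqVal]

@[simp] theorem seqVal_realNeg (x : Tm Γ Ty.one) (n : 𝓜.N) :
    seqVal (eval e (realNeg x)) n = -seqVal (eval e x) n := by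
  rw [realNeg, seqVal_lam]; simp [seqVal]

@[simp] theorem seqVal_realOfNat (t : Tm Γ Ty.nat) (n : 𝓜.N) :
    seqVal (eval e (realOfNat t)) n = nCast (eval e t) := by
  rw [realOfNat, seqVal_lam]
  simp only [eval_mkRat, eval_wk, eval_zero, eval_one]
  rw [ratVal_nMkRat _ _ zero_lt_one]
  simp

@[simp] theorem sat_isReal (x : Tm Γ Ty.one) : sat e (isReal x) ↔ IsReal (eval e x) := by
  simp [isReal, IsReal, seqVal]

theorem sat_realEq {x y : Tm Γ Ty.one} (hx : IsReal (eval e x)) (hy : IsReal (eval e y)) :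
    sat e (realEq x y) ↔ Near (limVal (eval e x)) (limVal (eval e y)) := by
  rw [← hx.near_iff hy]
  simp [realEq, seqVal, one_add_one_eq_two, map_ofNat]

theorem sat_realLt {x y : Tm Γ Ty.one} (hx : IsReal (eval e x)) (hy : IsReal (eval e y)) :
    sat e (realLt x y) ↔ FarLt (limVal (eval e x)) (limVal (eval e y)) := by
  rw [← hx.farLt_iff hy]
  simp [realLt, seqVal, one_add_one_eq_two, map_ofNat]

@[simp] theorem sat_inI (x : Tm Γ Ty.one) : sat e (inI x) ↔ InUnit (eval e x) := by
  simp only [inI, sat_and, sat_isReal, InUnit, realLe, sat_neg]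
  refine and_congr_right fun hx => ?_
  have h (t : Tm Γ Ty.nat) (n : 𝓜.N) := seqVal_realOfNat e t n
  rw [sat_realLt e hx (isReal_const (h zero)), sat_realLt e (isReal_const (h one)) hx]
  refine and_congr (not_congr ?_) (not_congr ?_)
  · refine Near.farLt_iff (near_refl _) ?_
    simpa using limVal_const (h zero)
  · refine Near.farLt_iff ?_ (near_refl _)
    simpa using limVal_const (h one)

end

/-- The shift by one in the definition of the sum makes up for the sum of the errors. -/
theorem isReal_of_seqVal_add {x y z : 𝓜.M Ty.one} (hx : IsReal x) (hy : IsReal y)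
    (hz : ∀ n, seqVal z n = seqVal x (n + 1) + seqVal y (n + 1)) : IsReal z := by
  intro n i
  have h1 := abs_lt.1 (hx (n + 1) i)
  have h2 := abs_lt.1 (hy (n + 1) i)
  rw [twoNeg_succ] at h1 h2
  rw [hz, hz, add_right_comm n i 1, abs_lt]
  constructor <;> linarith [h1.1, h1.2, h2.1, h2.2]

theorem limVal_of_seqVal_add {x y z : 𝓜.M Ty.one} (hx : IsReal x) (hy : IsReal y)
    (hz : ∀ n, seqVal z n = seqVal x (n + 1) + seqVal y (n + 1)) :
    Near (limVal z) (limVal x + limVal y) := by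
  refine (isReal_of_seqVal_add hx hy hz).limVal_near fun n => ?_
  have h1 := abs_le.1 (hx.abs_sub_limVal (n + 1))
  have h2 := abs_le.1 (hy.abs_sub_limVal (n + 1))
  have := twoNeg_pos n
  rw [twoNeg_succ] at h1 h2
  rw [hz, abs_le]
  constructor <;> linarith [h1.1, h1.2, h2.1, h2.2]

theorem isReal_of_seqVal_neg {x z : 𝓜.M Ty.one} (hx : IsReal x)
    (hz : ∀ n, seqVal z n = -seqVal x n) : IsReal z := by
  intro n i
  rw [hz, hz, neg_sub_neg, abs_sub_comm]
  exact hx n i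

theorem limVal_of_seqVal_neg {x z : 𝓜.M Ty.one} (hx : IsReal x)
    (hz : ∀ n, seqVal z n = -seqVal x n) : Near (limVal z) (-limVal x) := by
  refine (isReal_of_seqVal_neg hx hz).limVal_near fun n => ?_
  rw [hz, neg_sub_neg, abs_sub_comm]
  linarith [hx.abs_sub_limVal n, twoNeg_pos n]

theorem sat_inBall {Γ : Ctx} (e : Env 𝓜 Γ) {F : Tm Γ Ty.fn} {y x : Tm Γ Ty.one}
    (hx : IsReal (eval e x)) (hy : IsReal (eval e y)) (hF : IsReal (eval e (Tm.app F y))) :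
    sat e (inBall F y x) ↔
      FarLt |limVal (eval e x) - limVal (eval e y)| (limVal (𝓜.app (eval e F) (eval e y))) := by
  have hn := isReal_of_seqVal_neg hF (seqVal_realNeg e (Tm.app F y))
  have hn' := limVal_of_seqVal_neg hF (seqVal_realNeg e (Tm.app F y))
  have h1 := isReal_of_seqVal_add hy hn (seqVal_realAdd e y (realNeg (Tm.app F y)))
  have h1' := limVal_of_seqVal_add hy hn (seqVal_realAdd e y (realNeg (Tm.app F y)))
  have h2 := isReal_of_seqVal_add hy hF (seqVal_realAdd e y (Tm.app F y))
  have h2' := limVal_of_seqVal_add hy hF (seqVal_realAdd e y (Tm.app F y))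
  rw [inBall, sat_and, realSub, sat_realLt e h1 hx, sat_realLt e hx h2,
    (h1'.trans ((near_refl _).add hn')).farLt_iff (near_refl _),
    (near_refl _).farLt_iff h2', eval_app]
  constructor
  · rintro ⟨⟨n, h⟩, m, h'⟩
    refine ⟨max n m, ?_⟩
    have e1 := twoNeg_anti (le_max_left n m)
    have e2 := twoNeg_anti (le_max_right n m)
    rw [← lt_sub_iff_add_lt, abs_lt]
    constructor <;> linarith
  · rintro ⟨n, h⟩
    rw [← lt_sub_iff_add_lt, abs_lt] at h
    exact ⟨⟨n, by linarith [h.1]⟩, n, by linarith [h.2]⟩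

/-! ### The covering principles in the model -/

/-- `F` represents a function to `ℝ` from the set of reals given by `D`. -/
def IsFun (D : 𝓜.M Ty.one → Prop) (F : 𝓜.M Ty.fn) : Prop :=
  (∀ x, D x → IsReal (𝓜.app F x)) ∧ ∀ x y, D x → D y → Near (limVal x) (limVal y) →
    Near (limVal (𝓜.app F x)) (limVal (𝓜.app F y))

/-- `x` lies in the interval around `y` given by `F`. -/
def InBall (F : 𝓜.M Ty.fn) (y x : 𝓜.M Ty.one) : Prop :=
  FarLt |limVal x - limVal y| (limVal (𝓜.app F y))

/-- Finitely many of the intervals given by `F` cover the unit interval. -/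
def HasFiniteSubcover (F : 𝓜.M Ty.fn) : Prop :=
  ∃ (k : 𝓜.N) (y : 𝓜.M (Ty.nat ⇒ Ty.one)), (∀ i, i < k → InUnit (𝓜.app y i)) ∧
    ∀ x, InUnit x → ∃ i, i < k ∧ InBall F (𝓜.app y i) x

theorem sat_isFunOn {D : ∀ {Δ : Ctx}, Tm Δ Ty.one → Fm Δ} {P : 𝓜.M Ty.one → Prop}
    (hD : ∀ {Δ : Ctx} (e : Env 𝓜 Δ) (x : Tm Δ Ty.one), sat e (D x) ↔ P (eval e x))
    (hP : ∀ x, P x → IsReal x) {Γ : Ctx} (e : Env 𝓜 Γ) (F : Tm Γ Ty.fn) :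
    sat e (isFunOn D F) ↔ IsFun P (eval e F) := by
  simp only [isFunOn, sat_and, sat_all, sat_imp, sat_isReal, hD, IsFun, eval_app, eval_wk,
    eval_var, Env.cons_z, Env.cons_s]
  refine and_congr_right fun h => forall₄_congr fun x y hx hy => ?_
  have h1 := sat_realEq (Env.cons y (Env.cons x e)) (x := v1) (y := v0) (hP x hx) (hP y hy)
  have h2 := sat_realEq (Env.cons y (Env.cons x e)) (x := Tm.app F.wk.wk v1)
    (y := Tm.app F.wk.wk v0) (by simpa using h x hx) (by simpa using h y hy)
  simp only [eval_app, eval_wk, eval_var, Env.cons_z, Env.cons_s] at h1 h2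
  rw [h1, h2]

theorem sat_isPos {Γ : Ctx} (e : Env 𝓜 Γ) (F : Tm Γ Ty.fn)
    (hF : ∀ x, IsReal x → IsReal (𝓜.app (eval e F) x)) :
    sat e (isPos F) ↔ ∀ x, IsReal x → FarLt 0 (limVal (𝓜.app (eval e F) x)) := by
  simp only [isPos, sat_all, sat_imp, sat_isReal, eval_var, Env.cons_z]
  refine forall₂_congr fun x hx => ?_
  have h (n : 𝓜.N) := seqVal_realOfNat (Env.cons x e) zero n
  rw [sat_realLt _ (isReal_const h) (by simpa using hF x hx)]
  refine Near.farLt_iff ?_ ?_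
  · simpa using limVal_const h
  · simpa using near_refl _

theorem sat_covers {Γ : Ctx} (e : Env 𝓜 Γ) (F : Tm Γ Ty.fn)
    (hF : ∀ x, InUnit x → IsReal (𝓜.app (eval e F) x)) :
    sat e (covers F) ↔ ∀ x, InUnit x → ∃ y, InUnit y ∧ InBall (eval e F) y x := by
  simp only [covers, sat_all, sat_imp, sat_inI, sat_ex, sat_and, eval_var, Env.cons_z]
  refine forall₂_congr fun x hx => exists_congr fun y => and_congr_right fun hy => ?_
  rw [sat_inBall _ (by simpa using hx.1) (by simpa using hy.1) (by simpa using hF y hy)]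
  simp [InBall]

theorem sat_finiteSubcover {Γ : Ctx} (e : Env 𝓜 Γ) (F : Tm Γ Ty.fn)
    (hF : ∀ x, InUnit x → IsReal (𝓜.app (eval e F) x)) :
    sat e (finiteSubcover F) ↔ HasFiniteSubcover (eval e F) := by
  simp only [finiteSubcover, sat_all, sat_imp, sat_inI, sat_ex, sat_and, sat_lt, eval_var,
    Env.cons_z, Env.cons_s, eval_app, HasFiniteSubcover]
  refine exists₂_congr fun k y => and_congr_right fun hy => forall₂_congr fun x hx =>
    exists_congr fun i => and_congr_right fun hi => ?_
  have hyi := hy i hi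
  rw [sat_inBall _ (by simpa using hx.1) (by simpa using hyi.1) (by simpa using hF _ hyi)]
  simp [InBall]

theorem sat_HBU : sat (Env.nil : Env 𝓜 []) HBU ↔
    ∀ F : 𝓜.M Ty.fn, IsFun IsReal F → (∀ x, IsReal x → FarLt 0 (limVal (𝓜.app F x))) →
      HasFiniteSubcover F := by
  simp only [HBU, sat_all, sat_imp, sat_and, and_imp]
  refine forall_congr' fun F => ?_
  rw [sat_isFunOn (P := IsReal) sat_isReal (fun _ h => h)]
  refine forall_congr' fun hF => ?_
  rw [sat_isPos _ _ (by simpa using hF.1), sat_finiteSubcover _ _ fun x hx => hF.1 x hx.1]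
  simp

theorem sat_HBT : sat (Env.nil : Env 𝓜 []) HBT ↔
    ∀ F : 𝓜.M Ty.fn, IsFun InUnit F → (∀ x, InUnit x → ∃ y, InUnit y ∧ InBall F y x) →
      HasFiniteSubcover F := by
  simp only [HBT, sat_all, sat_imp]
  refine forall_congr' fun F => ?_
  rw [sat_isFunOn (P := InUnit) sat_inI (fun _ h => h.1)]
  refine forall_congr' fun hF => ?_
  rw [sat_covers _ _ (by simpa using hF.1), sat_finiteSubcover _ _ (by simpa using hF.1)]
  simp

theorem sat_HBU_of_sat_HBT (h : sat (Env.nil : Env 𝓜 []) HBT) : sat (Env.nil : Env 𝓜 []) HBU := by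
  rw [sat_HBU]
  rw [sat_HBT] at h
  intro F hF hpos
  refine h F ⟨fun x hx => hF.1 x hx.1, fun x y hx hy => hF.2 x y hx.1 hy.1⟩ fun x hx =>
    ⟨x, hx, ?_⟩
  rw [InBall, sub_self, abs_zero]
  exact hpos x hx.1

end Reals

/-! ### Choice principles in the model -/

section Choice

variable {𝓜 : Model}

theorem env_choiceSub {Γ : Ctx} {σ τ : Ty} (e : Env 𝓜 Γ) (Y : 𝓜.M (σ ⇒ τ)) (x : 𝓜.M σ) :
    (fun ρ v => eval (Env.cons x (Env.cons Y e)) (choiceSub ρ v)) =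
      Env.cons (𝓜.app Y x) (Env.cons x e) := by
  funext ρ v
  rcases v with _ | v
  · rfl
  rcases v with _ | v <;> rfl

/-- The model satisfies the schema `QF-AC^{σ,τ}`. -/
def Model.HasChoice (𝓜 : Model) (σ τ : Ty) : Prop :=
  ∀ {Γ : Ctx} (e : Env 𝓜 Γ) (A : Fm (τ :: σ :: Γ)), A.QF →
    (∀ x, ∃ y, sat (Env.cons y (Env.cons x e)) A) →
    ∃ Y : 𝓜.M (σ ⇒ τ), ∀ x, sat (Env.cons (𝓜.app Y x) (Env.cons x e)) A

theorem hasChoice_of_sat {σ τ : Ty} (h : ∀ {Γ : Ctx} {A : Fm Γ}, QFAC σ τ Γ A →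
    ∀ e : Env 𝓜 Γ, sat e A) : 𝓜.HasChoice σ τ := by
  intro Γ e A hA hx
  have := h (QFAC.mk A hA) e
  simp only [sat_imp, sat_all, sat_ex, Fm.choiceInst, sat_subst, env_choiceSub] at this
  exact this hx

variable [h𝓜 : 𝓜.IsBase]

theorem hasChoice_one_nat : 𝓜.HasChoice Ty.one Ty.nat :=
  hasChoice_of_sat fun h e => sat_rca0 (RCA0.choice _ h) e

theorem hasChoice_one_one : 𝓜.HasChoice Ty.one Ty.one :=
  hasChoice_of_sat fun h e => h𝓜.sat (Or.inr h) e

/-- The number `x` is passed to `QF-AC^{1,0}` as the first value of a sequence. -/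
theorem hasChoice_nat_nat : 𝓜.HasChoice Ty.nat Ty.nat := by
  intro Γ e A hA hx
  let θ : Sub (Ty.nat :: Ty.nat :: Γ) (Ty.nat :: Ty.one :: Γ) := fun
    | _, Var.z => v0
    | _, Var.s Var.z => Tm.app v1 zero
    | _, Var.s (Var.s x) => Tm.var (Var.s (Var.s x))
  have hθ (x : 𝓜.M Ty.one) (y : 𝓜.N) :
      (fun ρ v => eval (Env.cons y (Env.cons x e)) (θ ρ v)) =
        Env.cons y (Env.cons (𝓜.app x 0) e) := by
    funext ρ v
    rcases v with _ | v
    · rfl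
    rcases v with _ | v <;> rfl
  have hQ : ∀ {Γ Δ : Ctx} (A : Fm Γ) (θ : Sub Γ Δ), A.QF → (A.subst θ).QF := by
    intro Γ Δ A
    induction A generalizing Δ with
    | imp A B ihA ihB => exact fun θ h => ⟨ihA θ h.1, ihB θ h.2⟩
    | all σ A => exact fun θ h => h.elim
    | _ => exact fun θ h => trivial
  obtain ⟨Y, hY⟩ := hasChoice_one_nat e (A.subst θ) (hQ A θ hA) fun x => by
    obtain ⟨y, hy⟩ := hx (𝓜.app x 0)
    exact ⟨y, by rwa [sat_subst, hθ]⟩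
  refine ⟨eval (Env.cons Y Env.nil) (lam (Tm.app v1 (lam v1))), fun x => ?_⟩
  have := hY (eval (Env.cons x (Env.cons Y Env.nil)) (lam v1))
  rw [sat_subst, hθ, eval_lam] at this
  rw [eval_lam]
  exact this

/-- Formulas all of whose quantifiers range over numbers. -/
def Fm.Arith : ∀ {Γ : Ctx}, Fm Γ → Prop
  | _, Fm.eq _ _ => True
  | _, Fm.lt _ _ => True
  | _, Fm.bot => True
  | _, Fm.imp A B => A.Arith ∧ B.Arith
  | _, Fm.all σ A => σ = Ty.nat ∧ A.Arith

theorem Fm.Arith.rename {Γ Δ : Ctx} {A : Fm Γ} (h : A.Arith) (r : Ren Γ Δ) :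
    (A.rename r).Arith := by
  induction A generalizing Δ with
  | imp A B ihA ihB => exact ⟨ihA h.1 r, ihB h.2 r⟩
  | all σ A ih => exact ⟨h.1, ih h.2 _⟩
  | _ => trivial

/-- `s` is a functional of type `2` that finds a zero of every sequence that has one. -/
def IsMu (s : 𝓜.M (Ty.one ⇒ Ty.nat)) : Prop :=
  ∀ f : 𝓜.M Ty.one, (∃ k, 𝓜.app f k = 0) → 𝓜.app f (𝓜.app s f) = 0

/-- With a functional that finds zeros, arithmetical formulas have characteristic terms. -/
theorem exists_charTerm : ∀ {Γ : Ctx} (A : Fm Γ), A.Arith → ∀ S : Var Γ (Ty.one ⇒ Ty.nat),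
    ∃ t : Tm Γ Ty.nat, ∀ e : Env 𝓜 Γ, IsMu (e _ S) →
      (eval e t = 0 ∧ sat e A) ∨ (eval e t = 1 ∧ ¬ sat e A)
  | _, Fm.eq s t, _, _ => by
      refine ⟨sub one (sub one (add (sub s t) (sub t s))), fun e _ => ?_⟩
      simp only [eval_sub, eval_add, eval_one, sat_eq]
      by_cases h : eval e s = eval e t
      · left; rw [h, nSub_eq_zero le_rfl]; simp [nSub_eq_zero]
      · right
        refine ⟨?_, h⟩
        have : (1 : 𝓜.N) ≤ nSub (eval e s) (eval e t) + nSub (eval e t) (eval e s) := by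
          rw [← not_lt, ← zero_add (1 : 𝓜.N), lt_add_one_N, not_le, pos_iff_ne_zero]
          intro h0
          obtain ⟨h1, h2⟩ := add_eq_zero.1 h0
          rcases le_total (eval e s) (eval e t) with h3 | h3
          · have := nSub_add_cancel h3
            rw [h2, zero_add] at this
            exact h this
          · have := nSub_add_cancel h3
            rw [h1, zero_add] at this
            exact h this.symm
        rw [nSub_eq_zero this, nSub_zero]
  | _, Fm.lt s t, _, _ => by
      refine ⟨sub one (sub t s), fun e _ => ?_⟩
      simp only [eval_sub, eval_one, sat_lt]
      rcases lt_or_ge (eval e s) (eval e t) with h | h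
      · left
        refine ⟨nSub_eq_zero ?_, h⟩
        rw [← not_lt, ← zero_add (1 : 𝓜.N), lt_add_one_N, not_le, pos_iff_ne_zero]
        intro h0
        have := nSub_add_cancel h.le
        rw [h0, zero_add] at this
        exact h.ne this
      · right
        rw [nSub_eq_zero h, nSub_zero]
        exact ⟨rfl, not_lt.2 h⟩
  | _, Fm.bot, _, _ => ⟨one, fun e _ => Or.inr ⟨rfl, fun h => h⟩⟩
  | _, Fm.imp A B, h, S => by
      obtain ⟨t, ht⟩ := exists_charTerm A h.1 S
      obtain ⟨u, hu⟩ := exists_charTerm B h.2 S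
      refine ⟨mul (sub one t) u, fun e he => ?_⟩
      simp only [eval_mul, eval_sub, eval_one, sat_imp]
      rcases ht e he with ⟨h1, h2⟩ | ⟨h1, h2⟩ <;> rcases hu e he with ⟨h3, h4⟩ | ⟨h3, h4⟩ <;>
        rw [h1, h3] <;> simp [h2, h4, nSub_eq_zero]
  | _, Fm.all σ A, h, S => by
      obtain ⟨t, ht⟩ := exists_charTerm A h.2 (Var.s S)
      obtain ⟨rfl, h⟩ := h
      let g := lam (sub one t)
      refine ⟨sub one (Tm.app g (Tm.app (Tm.var S) g)), fun e he => ?_⟩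
      have hg (k : 𝓜.N) : 𝓜.app (eval e g) k = nSub 1 (eval (Env.cons k e) t) := by
        simp only [g, eval_lam, eval_sub, eval_one]
      simp only [eval_sub, eval_one, eval_app, eval_var, sat_all]
      by_cases hA : ∀ k, sat (Env.cons k e) A
      · left
        refine ⟨?_, hA⟩
        rcases ht (Env.cons (𝓜.app (e _ S) (eval e g)) e) he with ⟨h1, h2⟩ | ⟨h1, h2⟩
        · rw [hg, h1, nSub_zero, nSub_eq_zero le_rfl]
        · exact absurd (hA _) h2
      · right
        refine ⟨?_, hA⟩
        obtain ⟨k, hk⟩ := not_forall.1 hA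
        have h0 := he (eval e g) ⟨k, by
          rw [hg, ((ht (Env.cons k e) he).resolve_left fun h => hk h.2).1, nSub_eq_zero le_rfl]⟩
        rw [h0, nSub_zero]

/-- With a functional that finds zeros, choice holds for arithmetical formulas. -/
theorem Model.HasChoice.arith {σ τ : Ty} (hc : 𝓜.HasChoice σ τ) {s : 𝓜.M (Ty.one ⇒ Ty.nat)}
    (hs : IsMu s) {Γ : Ctx} (e : Env 𝓜 Γ) (A : Fm (τ :: σ :: Γ)) (hA : A.Arith)
    (hx : ∀ x, ∃ y, sat (Env.cons y (Env.cons x e)) A) :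
    ∃ Y : 𝓜.M (σ ⇒ τ), ∀ x, sat (Env.cons (𝓜.app Y x) (Env.cons x e)) A := by
  let r : Ren (τ :: σ :: Γ) (τ :: σ :: (Ty.one ⇒ Ty.nat) :: Γ) :=
    liftRen (liftRen (fun _ x => Var.s x) σ) τ
  have hr (x : 𝓜.M σ) (y : 𝓜.M τ) :
      (fun ρ v => Env.cons y (Env.cons x (Env.cons s e)) ρ (r ρ v)) =
        Env.cons y (Env.cons x e) := by
    rw [Env.cons_liftRen, Env.cons_liftRen]; rfl
  obtain ⟨t, ht⟩ := exists_charTerm (𝓜 := 𝓜) (A.rename r) (hA.rename r)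
    (Var.s (Var.s Var.z))
  have key (x : 𝓜.M σ) (y : 𝓜.M τ) :
      sat (Env.cons y (Env.cons x (Env.cons s e))) (Fm.eq t zero) ↔
        sat (Env.cons y (Env.cons x e)) A := by
    have := ht (Env.cons y (Env.cons x (Env.cons s e))) hs
    rw [sat_rename, hr] at this
    rw [sat_eq, eval_zero]
    rcases this with ⟨h1, h2⟩ | ⟨h1, h2⟩
    · exact ⟨fun _ => h2, fun _ => h1⟩
    · exact ⟨fun h => absurd (h1.symm.trans h) one_ne_zero, fun h => absurd h h2⟩
  simp only [← key] at hx ⊢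
  exact hc (Env.cons s e) (Fm.eq t zero) trivial hx

end Choice

/-! ### Operations on rationals and reals -/

section Operations

variable {Γ : Ctx}

/-- A code of the positive part `max q 0` of a rational. -/
def ratPos (q : Tm Γ Ty.nat) : Tm Γ Ty.nat := mkRat (numPos q) zero (den q)

def ratMin (q r : Tm Γ Ty.nat) : Tm Γ Ty.nat := ratSub q (ratPos (ratSub q r))
def ratMax (q r : Tm Γ Ty.nat) : Tm Γ Ty.nat := ratAdd q (ratPos (ratSub r q))

def ratHalf (q : Tm Γ Ty.nat) : Tm Γ Ty.nat := mkRat (numPos q) (numNeg q) (add (den q) (den q))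

/-- The rational in `[0, 1]` that is nearest to `q`. -/
def ratClamp (q : Tm Γ Ty.nat) : Tm Γ Ty.nat := ratMin (ratPos q) (mkRat one zero one)

/-- The rational `q` as a real. -/
def constReal (q : Tm Γ Ty.nat) : Tm Γ Ty.one := lam q.wk

/-- The real in `[0, 1]` that is nearest to `x`. -/
def realClamp (x : Tm Γ Ty.one) : Tm Γ Ty.one := lam (ratClamp (Tm.app x.wk v0))

/-- The real `F(y) - |x - y|`; it is positive if and only if `x` lies in the interval around `y`
given by `F`. -/
def ballDist (F : Tm Γ Ty.fn) (y x : Tm Γ Ty.one) : Tm Γ Ty.one :=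
  lam (ratSub (Tm.app (Tm.app F.wk y.wk) (succ (succ v0)))
    (ratAbs (ratSub (Tm.app x.wk (succ (succ v0))) (Tm.app y.wk (succ (succ v0))))))

variable {𝓜 : Model} [h𝓜 : 𝓜.IsBase] (e : Env 𝓜 Γ) (q r : Tm Γ Ty.nat)

@[simp] theorem ratVal_ratPos : ratVal (eval e (ratPos q)) = max (ratVal (eval e q)) 0 := by
  simp only [ratPos, eval_mkRat, eval_numPos, eval_den, eval_zero]
  rw [ratVal_nMkRat _ _ (nDen_pos _), ratVal_eq]
  have h1 := nCast_nonneg (nNumPos (eval e q))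
  have h2 := nCast_nonneg (nNumNeg (eval e q))
  have h3 := nCast_nDen_pos (eval e q)
  rcases nNumPos_or_nNumNeg (eval e q) with h | h
  · rw [h, map_zero, sub_zero, zero_div, max_eq_right]
    rw [zero_sub, neg_div, neg_nonpos]
    exact div_nonneg h2 h3.le
  · rw [h, map_zero, sub_zero, max_eq_left]
    exact div_nonneg h1 h3.le

@[simp] theorem ratVal_ratMin : ratVal (eval e (ratMin q r)) =
    min (ratVal (eval e q)) (ratVal (eval e r)) := by
  simp only [ratMin, ratVal_ratSub, ratVal_ratPos]
  rcases le_total (ratVal (eval e q)) (ratVal (eval e r)) with h | h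
  · rw [min_eq_left h, max_eq_right (by linarith), sub_zero]
  · rw [min_eq_right h, max_eq_left (by linarith)]; ring

@[simp] theorem ratVal_ratMax : ratVal (eval e (ratMax q r)) =
    max (ratVal (eval e q)) (ratVal (eval e r)) := by
  simp only [ratMax, ratVal_ratSub, ratVal_ratPos, ratVal_ratAdd]
  rcases le_total (ratVal (eval e q)) (ratVal (eval e r)) with h | h
  · rw [max_eq_right h, max_eq_left (by linarith)]; ring
  · rw [max_eq_left h, max_eq_right (by linarith), add_zero]

@[simp] theorem ratVal_ratHalf : ratVal (eval e (ratHalf q)) = ratVal (eval e q) / 2 := by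
  simp only [ratHalf, eval_mkRat, eval_numPos, eval_den, eval_numNeg, eval_add]
  rw [ratVal_nMkRat _ _ (add_pos (nDen_pos _) (nDen_pos _)), ratVal_eq, map_add]
  have h3 := nCast_nDen_pos (eval e q)
  field_simp
  ring

/-- The element of `[0, 1]` that is nearest to `a`. -/
noncomputable def clampVal (a : 𝓜.F) : 𝓜.F := min (max a 0) 1

@[simp] theorem ratVal_ratClamp : ratVal (eval e (ratClamp q)) = clampVal (ratVal (eval e q)) := by
  have h : ratVal (eval e (mkRat one zero one)) = 1 := by
    rw [eval_mkRat, ratVal_nMkRat _ _ (by simp)]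
    simp
  rw [ratClamp, ratVal_ratMin, ratVal_ratPos, h, clampVal]

theorem clampVal_nonneg (a : 𝓜.F) : 0 ≤ clampVal a :=
  le_min (le_max_right _ _) zero_le_one

theorem clampVal_le_one (a : 𝓜.F) : clampVal a ≤ 1 := min_le_right _ _

theorem abs_clampVal_sub_le (a b : 𝓜.F) : |clampVal a - clampVal b| ≤ |a - b| := by
  have h1 := abs_min_sub_min_le_max (max a 0) 1 (max b 0) 1
  have h2 := abs_max_sub_max_le_max a 0 b 0
  simp only [sub_self, abs_zero, abs_nonneg, sup_of_le_left] at h1 h2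
  exact h1.trans h2

theorem Near.clampVal {a b : 𝓜.F} (h : Near a b) : Near (clampVal a) (clampVal b) :=
  fun n => (abs_clampVal_sub_le a b).trans (h n)

theorem clampVal_near {a : 𝓜.F} (h0 : ¬ FarLt a 0) (h1 : ¬ FarLt 1 a) : Near (clampVal a) a := by
  intro n
  have h0 := not_farLt.1 h0 n
  have h1 := not_farLt.1 h1 n
  have := twoNeg_pos n
  rw [abs_le, HOA.clampVal]
  rcases le_total a 0 with h | h
  · rw [max_eq_right h, min_eq_left zero_le_one]
    constructor <;> linarith
  · rw [max_eq_left h]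
    rcases le_total a 1 with h' | h'
    · rw [min_eq_left h']; constructor <;> linarith
    · rw [min_eq_right h']; constructor <;> linarith

@[simp] theorem seqVal_constReal (n : 𝓜.N) :
    seqVal (eval e (constReal q)) n = ratVal (eval e q) := by
  rw [constReal, seqVal_lam, eval_wk]

theorem isReal_constReal : IsReal (eval e (constReal q)) := isReal_const (seqVal_constReal e q)

theorem limVal_constReal : Near (limVal (eval e (constReal q))) (ratVal (eval e q)) :=
  limVal_const (seqVal_constReal e q)

theorem inUnit_of_near {x : 𝓜.M Ty.one} (hx : IsReal x) {a : 𝓜.F} (h : Near (limVal x) a)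
    (h0 : 0 ≤ a) (h1 : a ≤ 1) : InUnit x := by
  refine ⟨hx, ?_, ?_⟩
  · rw [h.farLt_iff (near_refl 0)]
    exact fun h' => absurd h'.lt (not_lt.2 h0)
  · rw [(near_refl 1).farLt_iff h]
    exact fun h' => absurd h'.lt (not_lt.2 h1)

theorem inUnit_constReal_ratClamp : InUnit (eval e (constReal (ratClamp q))) := by
  refine inUnit_of_near (isReal_constReal _ _) (limVal_constReal _ _) ?_ ?_ <;>
    rw [ratVal_ratClamp]
  · exact clampVal_nonneg _
  · exact clampVal_le_one _

theorem InUnit.of_near {x y : 𝓜.M Ty.one} (hx : InUnit x) (hy : IsReal y)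
    (h : Near (limVal x) (limVal y)) : InUnit y :=
  ⟨hy, by rw [← h.farLt_iff (near_refl 0)]; exact hx.2.1,
    by rw [← (near_refl 1).farLt_iff h]; exact hx.2.2⟩

variable {e} in
theorem isReal_realClamp {x : Tm Γ Ty.one} (hx : IsReal (eval e x)) :
    IsReal (eval e (realClamp x)) := by
  intro n i
  simp only [realClamp, seqVal_lam, ratVal_ratClamp]
  refine (abs_clampVal_sub_le _ _).trans_lt ?_
  simpa [seqVal] using hx n i

variable {e} in
theorem limVal_realClamp {x : Tm Γ Ty.one} (hx : IsReal (eval e x)) :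
    Near (limVal (eval e (realClamp x))) (clampVal (limVal (eval e x))) := by
  refine (isReal_realClamp hx).limVal_near fun n => ?_
  simp only [realClamp, seqVal_lam, ratVal_ratClamp]
  refine (abs_clampVal_sub_le _ _).trans ?_
  have := hx.abs_sub_limVal n
  simp only [seqVal] at this
  simp only [eval_app, eval_wk, eval_var, Env.cons_z]
  linarith [twoNeg_pos n]

variable {e} in
theorem inUnit_realClamp {x : Tm Γ Ty.one} (hx : IsReal (eval e x)) :
    InUnit (eval e (realClamp x)) :=
  inUnit_of_near (isReal_realClamp hx) (limVal_realClamp hx) (clampVal_nonneg _)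
    (clampVal_le_one _)

variable {e} in
theorem limVal_realClamp_of_inUnit {x : Tm Γ Ty.one} (hx : InUnit (eval e x)) :
    Near (limVal (eval e (realClamp x))) (limVal (eval e x)) :=
  (limVal_realClamp hx.1).trans (clampVal_near hx.2.1 hx.2.2)

theorem seqVal_ballDist (F : Tm Γ Ty.fn) (y x : Tm Γ Ty.one) (n : 𝓜.N) :
    seqVal (eval e (ballDist F y x)) n =
      seqVal (𝓜.app (eval e F) (eval e y)) (n + 1 + 1) -
        |seqVal (eval e x) (n + 1 + 1) - seqVal (eval e y) (n + 1 + 1)| := by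
  rw [ballDist, seqVal_lam]
  simp [seqVal]

variable {e} in
theorem isReal_ballDist {F : Tm Γ Ty.fn} {y x : Tm Γ Ty.one} (hx : IsReal (eval e x))
    (hy : IsReal (eval e y)) (hF : IsReal (𝓜.app (eval e F) (eval e y))) :
    IsReal (eval e (ballDist F y x)) := by
  intro n i
  have h1 := abs_lt.1 (hx (n + 1 + 1) i)
  have h2 := abs_lt.1 (hy (n + 1 + 1) i)
  have h3 := abs_lt.1 (hF (n + 1 + 1) i)
  have e1 : n + i + 1 + 1 = n + 1 + 1 + i := by ring
  rw [seqVal_ballDist, seqVal_ballDist, e1]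
  set a := seqVal (eval e x) (n + 1 + 1) - seqVal (eval e y) (n + 1 + 1) with ha
  set b := seqVal (eval e x) (n + 1 + 1 + i) - seqVal (eval e y) (n + 1 + 1 + i) with hb
  have h4 := abs_le.1 (abs_abs_sub_abs_le a b)
  have h5 : |a - b| ≤ 2 * twoNeg (n + 1 + 1) := by
    rw [abs_le]; constructor <;> linarith [h1.1, h1.2, h2.1, h2.2]
  simp only [twoNeg_succ] at h3 h5
  have := twoNeg_pos n
  rw [abs_lt]
  constructor <;> linarith [h3.1, h3.2, h4.1, h4.2]

variable {e} in
theorem abs_seqVal_ballDist_sub_le {F : Tm Γ Ty.fn} {y x : Tm Γ Ty.one} (hx : IsReal (eval e x))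
    (hy : IsReal (eval e y)) (hF : IsReal (𝓜.app (eval e F) (eval e y))) (n : 𝓜.N) :
    |seqVal (eval e (ballDist F y x)) n - (limVal (𝓜.app (eval e F) (eval e y)) -
      |limVal (eval e x) - limVal (eval e y)|)| ≤ twoNeg n := by
  have h1 := abs_le.1 (hx.abs_sub_limVal (n + 1 + 1))
  have h2 := abs_le.1 (hy.abs_sub_limVal (n + 1 + 1))
  have h3 := abs_le.1 (hF.abs_sub_limVal (n + 1 + 1))
  rw [seqVal_ballDist]
  set a := seqVal (eval e x) (n + 1 + 1) - seqVal (eval e y) (n + 1 + 1) with ha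
  set b := limVal (eval e x) - limVal (eval e y) with hb
  have h4 := abs_le.1 (abs_abs_sub_abs_le a b)
  have h5 : |a - b| ≤ 2 * twoNeg (n + 1 + 1) := by
    rw [abs_le]; constructor <;> linarith [h1.1, h1.2, h2.1, h2.2]
  simp only [twoNeg_succ] at h3 h5
  have := twoNeg_pos n
  rw [abs_le]
  constructor <;> linarith [h3.1, h3.2, h4.1, h4.2]

variable {e} in
theorem limVal_ballDist {F : Tm Γ Ty.fn} {y x : Tm Γ Ty.one} (hx : IsReal (eval e x))
    (hy : IsReal (eval e y)) (hF : IsReal (𝓜.app (eval e F) (eval e y))) :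
    Near (limVal (eval e (ballDist F y x))) (limVal (𝓜.app (eval e F) (eval e y)) -
      |limVal (eval e x) - limVal (eval e y)|) :=
  (isReal_ballDist hx hy hF).limVal_near fun n => by
    linarith [abs_seqVal_ballDist_sub_le hx hy hF n, twoNeg_pos n]

variable {e} in
theorem inBall_iff_ballDist {F : Tm Γ Ty.fn} {y x : Tm Γ Ty.one} (hx : IsReal (eval e x))
    (hy : IsReal (eval e y)) (hF : IsReal (𝓜.app (eval e F) (eval e y))) :
    InBall (eval e F) (eval e y) (eval e x) ↔ FarLt 0 (limVal (eval e (ballDist F y x))) := by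
  rw [(near_refl 0).farLt_iff (limVal_ballDist hx hy hF), InBall]
  refine exists_congr fun n => ?_
  constructor <;> intro h <;> linarith

theorem InBall.of_near {F : 𝓜.M Ty.fn} {y y' x x' : 𝓜.M Ty.one} (hx : Near (limVal x) (limVal x'))
    (hy : Near (limVal y) (limVal y'))
    (hF : Near (limVal (𝓜.app F y)) (limVal (𝓜.app F y'))) (h : InBall F y x) :
    InBall F y' x' :=
  FarLt.of_near (hx.sub hy).abs hF h

end Operations

section Refinement

variable {𝓜 : Model} [h𝓜 : 𝓜.IsBase]

/-! ### Finite subcovers by refinement -/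

/-- If every interval of the canonical cover given by `Ψ` lies in an interval given by `F`, with
centres depending on each other by an operation of the model, then a finite subcover passes from
`Ψ` to `F`. -/
theorem hasFiniteSubcover_of_refinement (hU : sat (Env.nil : Env 𝓜 []) HBU) {F Ψ : 𝓜.M Ty.fn}
    (hΨ : IsFun IsReal Ψ) (hpos : ∀ x, IsReal x → FarLt 0 (limVal (𝓜.app Ψ x)))
    (h : ∀ (k : 𝓜.N) (y : 𝓜.M (Ty.nat ⇒ Ty.one)), (∀ i, i < k → InUnit (𝓜.app y i)) →
      ∃ z : 𝓜.M (Ty.nat ⇒ Ty.one), ∀ i, i < k → InUnit (𝓜.app z i) ∧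
        ∀ x, InUnit x → InBall Ψ (𝓜.app y i) x → InBall F (𝓜.app z i) x) :
    HasFiniteSubcover F := by
  obtain ⟨k, y, hy, hcov⟩ := sat_HBU.1 hU Ψ hΨ hpos
  obtain ⟨z, hz⟩ := h k y hy
  refine ⟨k, z, fun i hi => (hz i hi).1, fun x hx => ?_⟩
  obtain ⟨i, hi, hxi⟩ := hcov x hx
  exact ⟨i, hi, (hz i hi).2 x hx hxi⟩

theorem InBall.of_le {F Ψ : 𝓜.M Ty.fn} {y c x : 𝓜.M Ty.one}
    (h : ¬ FarLt (limVal (𝓜.app F c) - |limVal y - limVal c|) (limVal (𝓜.app Ψ y)))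
    (hx : InBall Ψ y x) : InBall F c x := by
  obtain ⟨n, hn⟩ := hx
  have h1 := not_farLt.1 h (n + 1)
  have h2 := abs_sub_le (limVal x) (limVal y) (limVal c)
  rw [twoNeg_succ] at h1
  exact ⟨n + 1, by rw [twoNeg_succ]; linarith⟩

/-- If the centre `G(x)` of an interval around `x` is chosen so that equal reals have the same
centre, then the distance from `x` to the complement of this interval is a function on the reals,
and it gives a canonical cover that refines the intervals of `F`. -/
theorem hasFiniteSubcover_of_choice (hU : sat (Env.nil : Env 𝓜 []) HBU) {F : 𝓜.M Ty.fn}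
    (hF : IsFun InUnit F) (G : 𝓜.M Ty.fn)
    (hG : ∀ x, InUnit x → InUnit (𝓜.app G x) ∧ InBall F (𝓜.app G x) x)
    (hext : ∀ x y, InUnit x → InUnit y → Near (limVal x) (limVal y) →
      𝓜.app G x = 𝓜.app G y) : HasFiniteSubcover F := by
  let env (x : 𝓜.M Ty.one) : Env 𝓜 [Ty.one, Ty.fn, Ty.fn] :=
    Env.cons x (Env.cons G (Env.cons F Env.nil))
  let cl (x : 𝓜.M Ty.one) : 𝓜.M Ty.one := eval (env x) (realClamp v0)
  have hcl : ∀ x, IsReal x → InUnit (cl x) := fun x hx =>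
    inUnit_realClamp (e := env x) (x := v0) hx
  have hclv : ∀ x, IsReal x → Near (limVal (cl x)) (clampVal (limVal x)) := fun x hx =>
    limVal_realClamp (e := env x) (x := v0) hx
  let D : Tm [Ty.one, Ty.fn, Ty.fn] Ty.one :=
    ballDist v2 (Tm.app v1 (realClamp v0)) (realClamp v0)
  let Ψ : 𝓜.M Ty.fn := eval (Env.cons G (Env.cons F Env.nil)) (lam D)
  have hΨ (x : 𝓜.M Ty.one) : 𝓜.app Ψ x = eval (env x) D := eval_lam _ _ _
  have hreal : ∀ x, IsReal x → IsReal (𝓜.app Ψ x) := by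
    intro x hx
    rw [hΨ]
    have h1 := (hG _ (hcl x hx)).1
    exact isReal_ballDist (e := env x) (F := v2) (y := Tm.app v1 (realClamp v0))
      (x := realClamp v0) (hcl x hx).1 h1.1 (hF.1 _ h1)
  have hval : ∀ x, IsReal x → Near (limVal (𝓜.app Ψ x))
      (limVal (𝓜.app F (𝓜.app G (cl x))) - |limVal (cl x) - limVal (𝓜.app G (cl x))|) := by
    intro x hx
    rw [hΨ]
    have h1 := (hG _ (hcl x hx)).1
    exact limVal_ballDist (e := env x) (F := v2) (y := Tm.app v1 (realClamp v0))
      (x := realClamp v0) (hcl x hx).1 h1.1 (hF.1 _ h1)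
  refine hasFiniteSubcover_of_refinement hU (Ψ := Ψ) ⟨hreal, ?_⟩ ?_ ?_
  · intro x y hx hy hxy
    have h1 : Near (limVal (cl x)) (limVal (cl y)) :=
      (hclv x hx).trans (hxy.clampVal.trans (hclv y hy).symm)
    refine (hval x hx).trans (Near.trans ?_ (hval y hy).symm)
    rw [hext _ _ (hcl x hx) (hcl y hy) h1]
    exact (near_refl _).sub (h1.sub (near_refl _)).abs
  · intro x hx
    have h1 := hG _ (hcl x hx)
    rw [hΨ]
    exact (inBall_iff_ballDist (e := env x) (F := v2) (y := Tm.app v1 (realClamp v0))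
      (x := realClamp v0) (hcl x hx).1 h1.1.1 (hF.1 _ h1.1)).1 h1.2
  · intro k y hy
    let z := eval (Env.cons y (Env.cons G Env.nil))
      (lam (Tm.app v2 (realClamp (Tm.app v1 v0))))
    have hz (i : 𝓜.N) : 𝓜.app z i = 𝓜.app G (cl (𝓜.app y i)) := by
      simp only [z, eval_lam, eval_app, eval_var, Env.cons_z, Env.cons_s]
      congr 1
      refine 𝓜.ext fun n => ?_
      simp only [cl, realClamp, eval_lam, ratClamp, ratMin, ratPos, ratSub, ratAdd, ratNeg,
        eval_mkRat, eval_add, eval_mul, eval_numPos, eval_den, eval_numNeg, eval_app, eval_wk,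
        eval_var, Env.cons_z, Env.cons_s, eval_zero, eval_one, env]
    refine ⟨z, fun i hi => ?_⟩
    rw [hz]
    have hyi := hy i hi
    refine ⟨(hG _ (hcl _ hyi.1)).1, fun x hx => InBall.of_le ?_⟩
    have h2 : Near (limVal (cl (𝓜.app y i))) (limVal (𝓜.app y i)) :=
      limVal_realClamp_of_inUnit (e := env (𝓜.app y i)) (x := v0) hyi
    have h3 := (near_refl (limVal (𝓜.app F (𝓜.app G (cl (𝓜.app y i)))))).sub
      (h2.sub (near_refl (limVal (𝓜.app G (cl (𝓜.app y i)))))).abs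
    rw [((hval _ hyi.1).trans h3).symm.farLt_iff (near_refl _)]
    exact fun h => lt_irrefl _ h.lt

end Refinement

section Mu

variable {𝓜 : Model} [h𝓜 : 𝓜.IsBase]

/-! ### Canonical representatives of reals, from a functional that finds zeros -/

theorem sat_realLt_iff_seqVal {Γ : Ctx} (e : Env 𝓜 Γ) (x y : Tm Γ Ty.one) :
    sat e (realLt x y) ↔ ∃ n, 2 * twoNeg n < seqVal (eval e y) n - seqVal (eval e x) n := by
  simp [realLt, seqVal, one_add_one_eq_two, map_ofNat]

/-- The rational with code `q` is less than the real `x`. -/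
def RatLtReal (q : 𝓜.N) (x : 𝓜.M Ty.one) : Prop :=
  ∃ n, 2 * twoNeg n < seqVal x n - ratVal q

theorem sat_realLt_constReal {Γ : Ctx} (e : Env 𝓜 Γ) (q : Tm Γ Ty.nat) (x : Tm Γ Ty.one) :
    sat e (realLt (constReal q) x) ↔ RatLtReal (eval e q) (eval e x) := by
  simp [sat_realLt_iff_seqVal, RatLtReal]

theorem IsReal.ratLtReal_iff {x : 𝓜.M Ty.one} (hx : IsReal x) (q : 𝓜.N) :
    RatLtReal q x ↔ FarLt (ratVal q) (limVal x) := by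
  let e : Env 𝓜 [Ty.nat] := Env.cons q Env.nil
  have h := (isReal_constReal e v0).farLt_iff hx
  rw [(limVal_constReal e v0).farLt_iff (near_refl _)] at h
  simp only [seqVal_constReal] at h
  exact h

theorem Fm.arith_realLt {Γ : Ctx} (x y : Tm Γ Ty.one) : (realLt x y).Arith := by
  simp [Fm.Arith, realLt, Fm.ex, Fm.neg, ratLt]

theorem Fm.arith_inI {Γ : Ctx} (x : Tm Γ Ty.one) : (inI x).Arith := by
  simp [Fm.Arith, inI, realLe, isReal, Fm.and, Fm.neg, ratLt, Fm.arith_realLt]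

theorem Fm.arith_inBall {Γ : Ctx} (F : Tm Γ Ty.fn) (x y : Tm Γ Ty.one) : (inBall F y x).Arith := by
  simp [Fm.Arith, inBall, Fm.and, Fm.neg, Fm.arith_realLt]

/-- A functional that maps a real to the characteristic function of its lower cut, with the value
`0` for truth. -/
theorem exists_lowerCut {s : 𝓜.M (Ty.one ⇒ Ty.nat)} (hs : IsMu s) : ∃ D : 𝓜.M Ty.fn, ∀ x q,
    (𝓜.app (𝓜.app D x) q = 0 ∧ RatLtReal q x) ∨ (𝓜.app (𝓜.app D x) q = 1 ∧ ¬ RatLtReal q x) := by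
  let A : Fm [Ty.one, Ty.one] := Fm.all Ty.nat
    (((Fm.eq (Tm.app v1 v0) zero).and (realLt (constReal v0) v2)).or
      ((Fm.eq (Tm.app v1 v0) one).and (realLt (constReal v0) v2).neg))
  have hA : A.Arith := by simp [A, Fm.Arith, Fm.or, Fm.and, Fm.neg, Fm.arith_realLt]
  have hsat (x d : 𝓜.M Ty.one) : sat (Env.cons d (Env.cons x Env.nil)) A ↔
      ∀ q, (𝓜.app d q = 0 ∧ RatLtReal q x) ∨ (𝓜.app d q = 1 ∧ ¬ RatLtReal q x) := by
    simp [A, sat_realLt_constReal]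
  obtain ⟨D, hD⟩ := hasChoice_one_one.arith hs Env.nil A hA fun x => by
    let B : Fm [Ty.nat, Ty.nat, Ty.one] :=
      ((Fm.eq v0 zero).and (realLt (constReal v1) v2)).or
        ((Fm.eq v0 one).and (realLt (constReal v1) v2).neg)
    have hB : B.Arith := by simp [B, Fm.Arith, Fm.or, Fm.and, Fm.neg, Fm.arith_realLt]
    obtain ⟨d, hd⟩ := hasChoice_nat_nat.arith hs (Env.cons x Env.nil) B hB fun q => by
      by_cases h : RatLtReal q x
      · exact ⟨0, by simp [B, sat_realLt_constReal, h]⟩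
      · exact ⟨1, by simp [B, sat_realLt_constReal, h]⟩
    refine ⟨d, (hsat x d).2 fun q => ?_⟩
    simpa [B, sat_realLt_constReal] using hd q
  exact ⟨D, fun x => (hsat x _).1 (hD x)⟩

/-- The rational `q` belongs to the lower cut with characteristic function `d`, and
`q + 2 ^ (-n - 1)` does not. The value `0` of `d` stands for truth. -/
def cutApprox {Γ : Ctx} (d : Tm Γ Ty.one) (n q : Tm Γ Ty.nat) : Fm Γ :=
  (Fm.eq (Tm.app d q) zero).and
    (Fm.eq (Tm.app d (ratAdd q (dyadic one (succ n)))) one)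

/-- A functional that finds a real with a given lower cut, if there is one. -/
theorem exists_realOfCut {s : 𝓜.M (Ty.one ⇒ Ty.nat)} (hs : IsMu s) : ∃ C : 𝓜.M Ty.fn,
    ∀ (d : 𝓜.M Ty.one) (n : 𝓜.N),
      (∃ q : 𝓜.N, sat (Env.cons q (Env.cons n (Env.cons d Env.nil))) (cutApprox v2 v1 v0)) →
      sat (Env.cons (𝓜.app (𝓜.app C d) n) (Env.cons n (Env.cons d Env.nil)))
        (cutApprox v2 v1 v0) := by
  have har {Γ : Ctx} (d : Tm Γ Ty.one) (n q : Tm Γ Ty.nat) : (cutApprox d n q).Arith := by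
    simp [cutApprox, Fm.Arith, Fm.and, Fm.neg]
  have hsub {Γ : Ctx} (e : Env 𝓜 Γ) (d : Tm Γ Ty.one) (n q : Tm Γ Ty.nat) :
      sat e (cutApprox d n q) ↔
        sat (Env.cons (eval e q) (Env.cons (eval e n) (Env.cons (eval e d) Env.nil)))
          (cutApprox v2 v1 v0) := by
    simp [cutApprox, ratAdd, dyadic]
  let A : Fm [Ty.one, Ty.one] := Fm.all Ty.nat
    ((Fm.ex Ty.nat (cutApprox v3 v1 v0)).imp (cutApprox v2 v0 (Tm.app v1 v0)))
  have hA : A.Arith := by simp [A, Fm.Arith, Fm.ex, Fm.neg, har]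
  let B : Fm [Ty.nat, Ty.nat, Ty.one] :=
    (Fm.ex Ty.nat (cutApprox v3 v2 v0)).imp (cutApprox v2 v1 v0)
  have hB : B.Arith := by simp [B, Fm.Arith, Fm.ex, Fm.neg, har]
  obtain ⟨C, hC⟩ := hasChoice_one_one.arith hs Env.nil A hA fun d => by
    obtain ⟨c, hc⟩ := hasChoice_nat_nat.arith hs (Env.cons d Env.nil) B hB fun n => by
      by_cases h : ∃ q : 𝓜.N,
          sat (Env.cons q (Env.cons n (Env.cons d Env.nil))) (cutApprox v2 v1 v0)
      · obtain ⟨q, hq⟩ := h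
        exact ⟨q, fun _ => hq⟩
      · refine ⟨0, fun h' => absurd ?_ h⟩
        obtain ⟨q, hq⟩ := (sat_ex _ _).1 h'
        rw [hsub] at hq
        exact ⟨q, hq⟩
    refine ⟨c, fun n h => ?_⟩
    rw [hsub]
    refine hc n ?_
    rw [sat_ex] at h ⊢
    obtain ⟨q, hq⟩ := h
    rw [hsub] at hq
    refine ⟨q, ?_⟩
    rw [hsub]
    exact hq
  refine ⟨C, fun d n h => ?_⟩
  have := hC d n
  rw [sat_imp, hsub, sat_ex] at this
  refine this ?_
  obtain ⟨q, hq⟩ := h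
  refine ⟨q, ?_⟩
  rw [hsub]
  exact hq

/-- A functional that maps a real to a representative that only depends on the real. -/
theorem exists_canonicalRep {s : 𝓜.M (Ty.one ⇒ Ty.nat)} (hs : IsMu s) : ∃ R : 𝓜.M Ty.fn,
    (∀ x, IsReal x → IsReal (𝓜.app R x) ∧ Near (limVal x) (limVal (𝓜.app R x))) ∧
    ∀ x y, IsReal x → IsReal y → Near (limVal x) (limVal y) → 𝓜.app R x = 𝓜.app R y := by
  obtain ⟨D, hD⟩ := exists_lowerCut hs
  obtain ⟨C, hC⟩ := exists_realOfCut hs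
  let R := eval (Env.cons D (Env.cons C Env.nil)) (lam (Tm.app v2 (Tm.app v1 v0)))
  have hR (x : 𝓜.M Ty.one) : 𝓜.app R x = 𝓜.app C (𝓜.app D x) := by
    simp only [R, eval_lam]; rfl
  refine ⟨R, fun x hx => ?_, fun x y hx hy hxy => ?_⟩
  · rw [hR]
    have h0 (q : 𝓜.N) : 𝓜.app (𝓜.app D x) q = 0 ↔ FarLt (ratVal q) (limVal x) := by
      rw [← hx.ratLtReal_iff]
      rcases hD x q with ⟨h1, h2⟩ | ⟨h1, h2⟩
      · exact ⟨fun _ => h2, fun _ => h1⟩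
      · exact ⟨fun h => absurd (h1.symm.trans h) one_ne_zero, fun h => absurd h h2⟩
    have h1 (q : 𝓜.N) : 𝓜.app (𝓜.app D x) q = 1 ↔ ¬ FarLt (ratVal q) (limVal x) := by
      rw [← hx.ratLtReal_iff]
      rcases hD x q with ⟨h1, h2⟩ | ⟨h1, h2⟩
      · exact ⟨fun h => absurd (h1.symm.trans h) zero_ne_one, fun h => absurd h2 h⟩
      · exact ⟨fun _ => h2, fun _ => h1⟩
    have hsat (n q : 𝓜.N) :
        sat (Env.cons q (Env.cons n (Env.cons (𝓜.app D x) Env.nil))) (cutApprox v2 v1 v0) ↔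
          FarLt (ratVal q) (limVal x) ∧ ¬ FarLt (ratVal q + twoNeg n / 2) (limVal x) := by
      simp only [cutApprox, sat_and, sat_eq, eval_app, eval_var, Env.cons_z, Env.cons_s,
        eval_zero, eval_one, h0, h1, ratVal_ratAdd, ratVal_dyadic, eval_succ, map_one, one_mul,
        twoNeg_succ]
    have hc (n : 𝓜.N) := (hsat n _).1 (hC (𝓜.app D x) n (by
      -- a rational slightly less than the approximation `x(n + 3)`
      let e : Env 𝓜 [Ty.nat, Ty.one] := Env.cons (n + 1 + 1 + 1) (Env.cons x Env.nil)
      refine ⟨eval e (ratSub (Tm.app v1 v0) (dyadic two v0)), (hsat n _).2 ?_⟩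
      have h2 := abs_le.1 (hx.abs_sub_limVal (n + 1 + 1 + 1))
      have h3 := twoNeg_pos n
      have h4 : ratVal (eval e (ratSub (Tm.app v1 v0) (dyadic two v0))) =
          seqVal x (n + 1 + 1 + 1) - 2 * twoNeg (n + 1 + 1 + 1) := by
        simp [e, seqVal, one_add_one_eq_two, map_ofNat]
      simp only [twoNeg_succ] at h2 h4
      rw [h4]
      refine ⟨⟨n + 1 + 1 + 1 + 1, ?_⟩, fun h => ?_⟩
      · simp only [twoNeg_succ]
        linarith [h2.1, h2.2]
      · have := h.lt
        linarith [h2.1, h2.2]))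
    have hlow (n : 𝓜.N) : seqVal (𝓜.app C (𝓜.app D x)) n < limVal x := (hc n).1.lt
    have hupp (n k : 𝓜.N) :
        limVal x ≤ seqVal (𝓜.app C (𝓜.app D x)) n + twoNeg n / 2 + twoNeg k :=
      not_farLt.1 (hc n).2 k
    have hreal : IsReal (𝓜.app C (𝓜.app D x)) := by
      intro n i
      have h2 := hlow n
      have h3 := hlow (n + i)
      have h4 := hupp n (n + 1)
      have h5 := hupp (n + i) (n + 1)
      have h6 : twoNeg (n + i) ≤ twoNeg n := twoNeg_anti le_self_add
      rw [twoNeg_succ] at h4 h5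
      rw [abs_lt]
      constructor <;> linarith
    refine ⟨hreal, Near.symm (hreal.limVal_near fun n => ?_)⟩
    have h2 := hlow n
    have h3 := hupp n n
    have h4 := twoNeg_pos n
    rw [abs_le]
    constructor <;> linarith
  · rw [hR, hR]
    congr 1
    refine 𝓜.ext fun q => ?_
    have h : RatLtReal q x ↔ RatLtReal q y := by
      rw [hx.ratLtReal_iff, hy.ratLtReal_iff]
      exact (near_refl _).farLt_iff hxy
    rcases hD x q with ⟨h1, h2⟩ | ⟨h1, h2⟩ <;> rcases hD y q with ⟨h3, h4⟩ | ⟨h3, h4⟩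
    · rw [h1, h3]
    · exact absurd (h.1 h2) h4
    · exact absurd (h.2 h4) h2
    · rw [h1, h3]

/-- With a functional that finds zeros, `QF-AC^{1,1}` yields a choice of intervals that respects the
equality of reals. -/
theorem hasFiniteSubcover_of_isMu (hU : sat (Env.nil : Env 𝓜 []) HBU) {F : 𝓜.M Ty.fn}
    (hF : IsFun InUnit F) (hcov : ∀ x, InUnit x → ∃ y, InUnit y ∧ InBall F y x)
    {s : 𝓜.M (Ty.one ⇒ Ty.nat)} (hs : IsMu s) : HasFiniteSubcover F := by
  obtain ⟨R, hR, hRext⟩ := exists_canonicalRep hs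
  let A : Fm [Ty.one, Ty.one, Ty.fn] := (inI v1).imp ((inI v0).and (inBall v2 v0 v1))
  have hA : A.Arith := by
    simp [A, Fm.Arith, Fm.and, Fm.neg, Fm.arith_inI, Fm.arith_inBall]
  have hsat (x y : 𝓜.M Ty.one) : sat (Env.cons y (Env.cons x (Env.cons F Env.nil))) A ↔
      (InUnit x → InUnit y ∧ InBall F y x) := by
    simp only [A, sat_imp, sat_and, sat_inI, eval_var, Env.cons_z, Env.cons_s]
    refine forall_congr' fun hx => and_congr_right fun hy => ?_
    exact sat_inBall (Env.cons y (Env.cons x (Env.cons F Env.nil))) (F := v2) (y := v0) (x := v1)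
      hx.1 hy.1 (hF.1 y hy)
  obtain ⟨Y, hY⟩ := hasChoice_one_one.arith hs (Env.cons F Env.nil) A hA fun x => by
    by_cases hx : InUnit x
    · obtain ⟨y, hy⟩ := hcov x hx
      exact ⟨y, (hsat x y).2 fun _ => hy⟩
    · exact ⟨x, (hsat x x).2 fun h => absurd h hx⟩
  let G := eval (Env.cons R (Env.cons Y Env.nil)) (lam (Tm.app v2 (Tm.app v1 v0)))
  have hG (x : 𝓜.M Ty.one) : 𝓜.app G x = 𝓜.app Y (𝓜.app R x) := by
    simp only [G, eval_lam]; rfl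
  refine hasFiniteSubcover_of_choice hU hF G (fun x hx => ?_) fun x y hx hy hxy => ?_
  · have h1 := hR x hx.1
    have h2 := (hsat _ _).1 (hY (𝓜.app R x)) (hx.of_near h1.1 h1.2)
    rw [hG]
    exact ⟨h2.1, h2.2.of_near h1.2.symm (near_refl _) (near_refl _)⟩
  · rw [hG, hG, hRext x y hx.1 hy.1 hxy]

end Mu

/-! ### A functional that finds zeros, from a discontinuity -/

section Search

/-- The least zero of `f` below `m`, or `m` if there is none. -/
def search {Γ : Ctx} (f : Tm Γ Ty.one) (m : Tm Γ Ty.nat) : Tm Γ Ty.nat :=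
  primRec (add v0 (sub one (sub one (Tm.app f.wk.wk v0)))) zero m

/-- The sequence `y`, cut off at the least zero of `f`, and with values restricted to `[0, 1]`. -/
def searchReal {Γ : Ctx} (f y : Tm Γ Ty.one) : Tm Γ Ty.one :=
  lam (ratClamp (Tm.app y.wk (succ (search f.wk v0))))

variable {𝓜 : Model} [h𝓜 : 𝓜.IsBase]

/-- The value of `search`. -/
def searchVal (f : 𝓜.M Ty.one) (m : 𝓜.N) : 𝓜.N :=
  recVal (Env.cons f Env.nil) (add v0 (sub one (sub one (Tm.app v2 v0)))) 0 m

@[simp] theorem eval_search {Γ : Ctx} (e : Env 𝓜 Γ) (f : Tm Γ Ty.one) (m : Tm Γ Ty.nat) :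
    eval e (search f m) = searchVal (eval e f) (eval e m) :=
  recVal_congr (fun _ _ => by simp) _ _

theorem searchVal_zero (f : 𝓜.M Ty.one) : searchVal f 0 = 0 := recVal_zero _ _ _

theorem searchVal_succ (f : 𝓜.M Ty.one) (m : 𝓜.N) : searchVal f (m + 1) =
    searchVal f m + nSub 1 (nSub 1 (𝓜.app f (searchVal f m))) := by
  rw [searchVal, recVal_succ]
  simp [searchVal]

theorem searchVal_succ_of_eq {f : 𝓜.M Ty.one} {m : 𝓜.N} (h : 𝓜.app f (searchVal f m) = 0) :
    searchVal f (m + 1) = searchVal f m := by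
  rw [searchVal_succ, h, nSub_zero, nSub_eq_zero le_rfl, add_zero]

theorem searchVal_succ_of_ne {f : 𝓜.M Ty.one} {m : 𝓜.N} (h : 𝓜.app f (searchVal f m) ≠ 0) :
    searchVal f (m + 1) = searchVal f m + 1 := by
  have : (1 : 𝓜.N) ≤ 𝓜.app f (searchVal f m) := by
    rw [← not_lt, ← zero_add (1 : 𝓜.N), lt_add_one_N, not_le, pos_iff_ne_zero]
    exact h
  rw [searchVal_succ, nSub_eq_zero this, nSub_zero]

theorem searchVal_eq_or (f : 𝓜.M Ty.one) (m : 𝓜.N) :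
    searchVal f m = m ∨ 𝓜.app f (searchVal f m) = 0 := by
  refine qf_induction (P := fun m => searchVal f m = m ∨ 𝓜.app f (searchVal f m) = 0)
    (Env.cons f Env.nil) ((Fm.eq (search v1 v0) v0).or (Fm.eq (Tm.app v1 (search v1 v0)) zero))
    (by simp [Fm.QF, Fm.or, Fm.neg]) (fun n => by simp) (Or.inl (searchVal_zero f))
    (fun n h => ?_) m
  by_cases h0 : 𝓜.app f (searchVal f n) = 0
  · exact Or.inr (by rw [searchVal_succ_of_eq h0, h0])
  · exact Or.inl (by rw [searchVal_succ_of_ne h0, h.resolve_right h0])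

theorem searchVal_add_of_eq {f : 𝓜.M Ty.one} {m : 𝓜.N} (h : 𝓜.app f (searchVal f m) = 0)
    (i : 𝓜.N) : searchVal f (m + i) = searchVal f m := by
  refine qf_induction (P := fun i => searchVal f (m + i) = searchVal f m)
    (Env.cons m (Env.cons f Env.nil)) (Fm.eq (search v2 (add v1 v0)) (search v2 v1))
    trivial (fun n => by simp) (by rw [add_zero]) (fun n hn => ?_) i
  rw [← add_assoc, searchVal_succ_of_eq (by rw [hn, h]), hn]

theorem searchVal_le_add (f : 𝓜.M Ty.one) (m i : 𝓜.N) :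
    searchVal f m ≤ searchVal f (m + i) := by
  refine qf_induction (P := fun i => searchVal f m ≤ searchVal f (m + i))
    (Env.cons m (Env.cons f Env.nil)) (Fm.lt (search v2 (add v1 v0)) (search v2 v1)).neg
    (by simp [Fm.QF, Fm.neg]) (fun n => by simp) (by rw [add_zero]) (fun n hn => ?_) i
  rw [← add_assoc, searchVal_succ]
  exact hn.trans le_self_add

section

variable {Γ : Ctx} {e : Env 𝓜 Γ} {f y : Tm Γ Ty.one}

theorem seqVal_searchReal (m : 𝓜.N) : seqVal (eval e (searchReal f y)) m =
    clampVal (seqVal (eval e y) (searchVal (eval e f) m + 1)) := by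
  rw [searchReal, seqVal_lam]
  simp [seqVal]

theorem isReal_searchReal (hy : IsReal (eval e y)) : IsReal (eval e (searchReal f y)) := by
  intro m i
  rw [seqVal_searchReal, seqVal_searchReal]
  refine (abs_clampVal_sub_le _ _).trans_lt ?_
  rcases searchVal_eq_or (eval e f) m with h | h
  · refine (hy.abs_seqVal_sub_le
      (add_le_add_left (searchVal_le_add (eval e f) m i) 1)).trans_le ?_
    rw [h]
    exact twoNeg_anti le_self_add
  · rw [searchVal_add_of_eq h, sub_self, abs_zero]
    exact twoNeg_pos m

theorem limVal_searchReal_of_eq (hy : IsReal (eval e y)) {k : 𝓜.N}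
    (hk : 𝓜.app (eval e f) k = 0) : ∃ q : 𝓜.N,
      Near (limVal (eval e (searchReal f y))) (clampVal (ratVal q)) := by
  have h0 : 𝓜.app (eval e f) (searchVal (eval e f) k) = 0 := by
    rcases searchVal_eq_or (eval e f) k with h | h
    · rw [h, hk]
    · exact h
  refine ⟨𝓜.app (eval e y) (searchVal (eval e f) k + 1),
    (isReal_searchReal hy).limVal_near fun n => ?_⟩
  have h1 := isReal_searchReal (f := f) hy n k
  have h2 : seqVal (eval e (searchReal f y)) (n + k) =
      clampVal (ratVal (𝓜.app (eval e y) (searchVal (eval e f) k + 1))) := by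
    rw [seqVal_searchReal, add_comm n k, searchVal_add_of_eq h0]; rfl
  rw [h2] at h1
  linarith [twoNeg_pos n]

theorem limVal_searchReal_of_ne (hy : InUnit (eval e y)) (hf : ∀ k, 𝓜.app (eval e f) k ≠ 0) :
    Near (limVal (eval e (searchReal f y))) (limVal (eval e y)) := by
  refine ((isReal_searchReal hy.1).limVal_near (a := clampVal (limVal (eval e y)))
    fun n => ?_).trans (clampVal_near hy.2.1 hy.2.2)
  rw [seqVal_searchReal, (searchVal_eq_or _ n).resolve_right (hf _)]
  refine (abs_clampVal_sub_le _ _).trans ((hy.1.abs_sub_limVal _).trans ?_)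
  rw [twoNeg_succ]
  linarith [twoNeg_pos n]

end

/-- The rational in `[0, 1]` nearest to `q`, as a real. -/
def unitConst (q : 𝓜.N) : 𝓜.M Ty.one := eval (Env.cons q Env.nil) (constReal (ratClamp v0))

theorem inUnit_unitConst (q : 𝓜.N) : InUnit (unitConst q) :=
  inUnit_constReal_ratClamp (Env.cons q Env.nil) v0

theorem limVal_unitConst (q : 𝓜.N) : Near (limVal (unitConst q)) (clampVal (ratVal q)) := by
  have := limVal_constReal (Env.cons q Env.nil) (ratClamp v0)
  rw [ratVal_ratClamp] at this
  exact this

theorem inUnit_searchReal {Γ : Ctx} {e : Env 𝓜 Γ} {f y : Tm Γ Ty.one} (hy : InUnit (eval e y)) :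
    InUnit (eval e (searchReal f y)) := by
  by_cases h : ∃ k, 𝓜.app (eval e f) k = 0
  · obtain ⟨k, hk⟩ := h
    obtain ⟨q, hq⟩ := limVal_searchReal_of_eq hy.1 hk
    exact (inUnit_unitConst q).of_near (isReal_searchReal hy.1) ((limVal_unitConst q).trans hq.symm)
  · exact hy.of_near (isReal_searchReal hy.1)
      (limVal_searchReal_of_ne hy fun k hk => h ⟨k, hk⟩).symm

/-- Grilliot's trick: if `x` lies in an interval given by `F`, but in none with a rational centre,
then the distance from `x` to the complement of the interval is a discontinuous function of the
centre, and this yields a functional that finds zeros: `f` has a zero if and only if the centre that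
is cut off at the least zero of `f` has an interval without `x`. -/
theorem exists_isMu {F : 𝓜.M Ty.fn} (hF : IsFun InUnit F) {x y : 𝓜.M Ty.one} (hx : InUnit x)
    (hy : InUnit y) (hxy : InBall F y x) (hq : ∀ q : 𝓜.N, ¬ InBall F (unitConst q) x) :
    ∃ s : 𝓜.M (Ty.one ⇒ Ty.nat), IsMu s := by
  let e0 : Env 𝓜 [Ty.fn, Ty.one, Ty.one] := Env.cons F (Env.cons x (Env.cons y Env.nil))
  have hbv := limVal_ballDist (e := e0) (F := v0) (y := v2) (x := v1) hx.1 hy.1 (hF.1 y hy)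
  obtain ⟨N, hN⟩ := hxy
  let env (f : 𝓜.M Ty.one) (k : 𝓜.N) : Env 𝓜 [Ty.nat, Ty.one, Ty.nat, Ty.fn, Ty.one, Ty.one] :=
    Env.cons k (Env.cons f (Env.cons N e0))
  let vx : Tm [Ty.nat, Ty.one, Ty.nat, Ty.fn, Ty.one, Ty.one] Ty.one :=
    Tm.var (Var.s (Var.s (Var.s (Var.s Var.z))))
  let vy : Tm [Ty.nat, Ty.one, Ty.nat, Ty.fn, Ty.one, Ty.one] Ty.one :=
    Tm.var (Var.s (Var.s (Var.s (Var.s (Var.s Var.z)))))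
  let D := ballDist v3 (searchReal v1 vy) vx
  let A : Fm [Ty.nat, Ty.one, Ty.nat, Ty.fn, Ty.one, Ty.one] :=
    (ratLt (dyadic one (succ v2)) (Tm.app D (succ (succ v2)))).or (Fm.eq (Tm.app v1 v0) zero)
  have hA (f : 𝓜.M Ty.one) (k : 𝓜.N) : sat (env f k) A ↔
      (twoNeg (N + 1) < seqVal (eval (env f k) D) (N + 1 + 1) ∨ 𝓜.app f k = 0) := by
    simp [A, env, seqVal]
  have hz (f : 𝓜.M Ty.one) (k : 𝓜.N) : InUnit (eval (env f k) (searchReal v1 vy)) :=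
    inUnit_searchReal (e := env f k) (f := v1) (y := vy) hy
  have hD (f : 𝓜.M Ty.one) (k : 𝓜.N) : IsReal (eval (env f k) D) :=
    isReal_ballDist (e := env f k) (F := v3) (y := searchReal v1 vy) (x := vx)
      hx.1 (hz f k).1 (hF.1 _ (hz f k))
  have hDv (f : 𝓜.M Ty.one) (k : 𝓜.N) :=
    limVal_ballDist (e := env f k) (F := v3) (y := searchReal v1 vy) (x := vx)
      hx.1 (hz f k).1 (hF.1 _ (hz f k))
  obtain ⟨s, hs⟩ := hasChoice_one_nat (Env.cons N e0) A
    (by simp [A, Fm.QF, Fm.or, Fm.neg, ratLt]) fun f => by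
      by_cases h : ∃ k, 𝓜.app f k = 0
      · obtain ⟨k, hk⟩ := h
        exact ⟨k, (hA f k).2 (Or.inr hk)⟩
      · refine ⟨0, (hA f 0).2 (Or.inl ?_)⟩
        have h1 := limVal_searchReal_of_ne (e := env f 0) (f := v1) (y := vy) hy
          fun k hk => h ⟨k, hk⟩
        have h2 := (hDv f 0).trans
          ((hF.2 _ _ (hz f 0) hy h1).sub ((near_refl (limVal x)).sub h1).abs)
        have h3 := abs_le.1 (h2 (N + 1 + 1))
        have h4 := abs_le.1 ((hD f 0).abs_sub_limVal (N + 1 + 1))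
        have h5 : |limVal x - limVal y| + twoNeg N < limVal (𝓜.app F y) := hN
        have h6 : limVal (𝓜.app F y) - |limVal x - limVal y| - twoNeg (N + 1 + 1) ≤
            limVal (eval (env f 0) D) := by
          have := h3.1
          change -twoNeg (N + 1 + 1) ≤ limVal (eval (env f 0) D) -
            (limVal (𝓜.app F y) - |limVal x - limVal y|) at this
          linarith
        simp only [twoNeg_succ] at h4 h6 ⊢
        linarith [h4.1]
  refine ⟨s, fun f ⟨k, hk⟩ => ((hA f _).1 (hs f)).resolve_left fun h => ?_⟩
  obtain ⟨q, h1⟩ := limVal_searchReal_of_eq (e := env f (𝓜.app s f)) (f := v1) (y := vy) hy.1 hk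
  have h2 := h1.trans (limVal_unitConst q).symm
  have h3 := (inBall_iff_ballDist (e := env f (𝓜.app s f)) (F := v3) (y := searchReal v1 vy)
    (x := vx) hx.1 (hz f _).1 (hF.1 _ (hz f _))).2 ⟨N + 1 + 1 + 1, by
      have h4 := abs_le.1 ((hD f (𝓜.app s f)).abs_sub_limVal (N + 1 + 1))
      have h5 := twoNeg_pos N
      change 0 + twoNeg (N + 1 + 1 + 1) < limVal (eval (env f (𝓜.app s f)) D)
      simp only [twoNeg_succ] at h h4 ⊢
      linarith [h4.2]⟩
  exact hq q (InBall.of_near (near_refl _) h2 (hF.2 _ _ (hz f _) (inUnit_unitConst q) h2) h3)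

end Search

/-! ### Half of the supremum of a sequence that converges to zero -/

section HalfSup

/-- The maximum of `0` and the rationals `u(n)` for `n < k`. -/
def maxUpto {Γ : Ctx} (u : Tm Γ Ty.one) (k : Tm Γ Ty.nat) : Tm Γ Ty.nat :=
  primRec (ratMax v0 (Tm.app u.wk.wk v1)) zero k

variable {𝓜 : Model} [h𝓜 : 𝓜.IsBase]

/-- The value of `maxUpto`. -/
def maxVal (u : 𝓜.M Ty.one) (k : 𝓜.N) : 𝓜.N :=
  recVal (Env.cons u Env.nil) (ratMax v0 (Tm.app v2 v1)) 0 k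

@[simp] theorem eval_maxUpto {Γ : Ctx} (e : Env 𝓜 Γ) (u : Tm Γ Ty.one) (k : Tm Γ Ty.nat) :
    eval e (maxUpto u k) = maxVal (eval e u) (eval e k) :=
  recVal_congr (fun _ _ => by simp [ratMax, ratPos, ratSub, ratAdd, ratNeg]) _ _

theorem ratVal_zero : ratVal (0 : 𝓜.N) = 0 := by
  simp [ratVal_eq, nNumPos, nNumNeg, nFst]

theorem ratVal_maxVal_zero (u : 𝓜.M Ty.one) : ratVal (maxVal u 0) = 0 := by
  rw [maxVal, recVal_zero, ratVal_zero]

theorem ratVal_maxVal_succ (u : 𝓜.M Ty.one) (k : 𝓜.N) :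
    ratVal (maxVal u (k + 1)) = max (ratVal (maxVal u k)) (seqVal u k) := by
  rw [maxVal, recVal_succ, ratVal_ratMax]
  simp [maxVal, seqVal]

theorem ratVal_maxVal_nonneg (u : 𝓜.M Ty.one) (k : 𝓜.N) : 0 ≤ ratVal (maxVal u k) := by
  refine qf_induction (P := fun k => 0 ≤ ratVal (maxVal u k))
    (Env.cons u Env.nil) (ratLe zero (maxUpto v1 v0)) (by simp [Fm.QF, ratLe, Fm.neg, ratLt])
    (fun n => by simp [ratVal_zero]) (ratVal_maxVal_zero u).ge (fun n h => ?_) k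
  rw [ratVal_maxVal_succ]
  exact h.trans (le_max_left _ _)

theorem seqVal_le_maxVal (u : 𝓜.M Ty.one) {n k : 𝓜.N} (h : n < k) :
    seqVal u n ≤ ratVal (maxVal u k) := by
  refine qf_induction (P := fun k => n < k → seqVal u n ≤ ratVal (maxVal u k))
    (Env.cons n (Env.cons u Env.nil))
    ((Fm.lt v1 v0).imp (ratLe (Tm.app v2 v1) (maxUpto v2 v0)))
    (by simp [Fm.QF, ratLe, Fm.neg, ratLt]) (fun n => by simp [seqVal])
    (fun h => absurd h (not_lt_zero_N n)) (fun m hm hn => ?_) k h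
  rw [ratVal_maxVal_succ]
  rcases (lt_add_one_N.1 hn).lt_or_eq with h | rfl
  · exact (hm h).trans (le_max_left _ _)
  · exact le_max_right _ _

theorem maxVal_le {u : 𝓜.M Ty.one} {k b : 𝓜.N} (hb : 0 ≤ ratVal b)
    (h : ∀ n, n < k → seqVal u n ≤ ratVal b) : ratVal (maxVal u k) ≤ ratVal b := by
  refine qf_induction (P := fun j => j ≤ k → ratVal (maxVal u j) ≤ ratVal b)
    (Env.cons k (Env.cons b (Env.cons u Env.nil)))
    ((Fm.lt v1 v0).neg.imp (ratLe (maxUpto v3 v0) v2))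
    (by simp [Fm.QF, ratLe, Fm.neg, ratLt]) (fun n => by simp)
    (fun _ => by rwa [ratVal_maxVal_zero]) (fun m hm hmk => ?_) k le_rfl
  have hlt : m < k := (lt_add_one m).trans_le hmk
  rw [ratVal_maxVal_succ]
  exact max_le (hm hlt.le) (h m hlt)

theorem exists_ratVal_eq_add_twoNeg (q n : 𝓜.N) : ∃ r : 𝓜.N, ratVal r = ratVal q + twoNeg n :=
  ⟨eval (Env.cons n (Env.cons q Env.nil)) (ratAdd v1 (dyadic one v0)), by simp⟩

theorem exists_ratVal_eq_half (q : 𝓜.N) : ∃ r : 𝓜.N, ratVal r = ratVal q / 2 :=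
  ⟨eval (Env.cons q Env.nil) (ratHalf v0), by simp⟩

/-- The sequence `z` represents half of the supremum of `0` and the numbers `w(n) ≤ 2 ^ (-n)`, by
means of rational approximations `u(m, n)` of `w(n)`. The bound on `w(n)` makes it sufficient for
`z(m)` to take into account the numbers `w(n)` with `n < m + 2`. -/
structure IsHalfSup (u : 𝓜.N → 𝓜.M Ty.one) (w : 𝓜.N → 𝓜.F) (z : 𝓜.M Ty.one) : Prop where
  approx : ∀ m n, |seqVal (u m) n - w n| ≤ twoNeg (m + 1 + 1)
  le : ∀ n, w n ≤ twoNeg n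
  seqVal_eq : ∀ m, seqVal z m = ratVal (maxVal (u m) (m + 1 + 1)) / 2

namespace IsHalfSup

variable {u u' : 𝓜.N → 𝓜.M Ty.one} {w w' : 𝓜.N → 𝓜.F} {z z' : 𝓜.M Ty.one}

theorem seqVal_le_add (h : IsHalfSup u w z) (h' : IsHalfSup u' w' z') {p : 𝓜.N}
    (hw : ∀ n, w n ≤ w' n + twoNeg p) (m m' : 𝓜.N) :
    seqVal z m ≤ seqVal z' m' + (twoNeg (m + 1 + 1) + twoNeg (m' + 1 + 1) + twoNeg p) / 2 := by
  obtain ⟨a, ha⟩ := exists_ratVal_eq_add_twoNeg (maxVal (u' m') (m' + 1 + 1)) (m + 1 + 1)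
  obtain ⟨b, hb⟩ := exists_ratVal_eq_add_twoNeg a (m' + 1 + 1)
  obtain ⟨c, hc⟩ := exists_ratVal_eq_add_twoNeg b p
  have h0 := ratVal_maxVal_nonneg (u' m') (m' + 1 + 1)
  have h1 := twoNeg_pos (m + 1 + 1)
  have h2 := twoNeg_pos (m' + 1 + 1)
  have h3 := twoNeg_pos p
  have := maxVal_le (u := u m) (k := m + 1 + 1) (b := c) (by linarith) fun n _ => by
    have h4 := abs_le.1 (h.approx m n)
    have h5 := abs_le.1 (h'.approx m' n)
    have h6 := hw n
    rcases lt_or_ge n (m' + 1 + 1) with hn | hn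
    · have h7 := seqVal_le_maxVal (u' m') hn
      linarith [h4.2, h5.1]
    · have h7 := (h'.le n).trans (twoNeg_anti hn)
      linarith [h4.2]
  rw [h.seqVal_eq, h'.seqVal_eq]
  linarith

theorem isReal (h : IsHalfSup u w z) : IsReal z := by
  intro m i
  have h0 (n : 𝓜.N) : w n ≤ w n + twoNeg (m + 1 + 1) := by
    linarith [twoNeg_pos (m + 1 + 1)]
  have h1 := h.seqVal_le_add h h0 m (m + i)
  have h2 := h.seqVal_le_add h h0 (m + i) m
  have h3 : twoNeg (m + i + 1 + 1) ≤ twoNeg (m + 1 + 1) := by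
    refine twoNeg_anti ?_
    gcongr
    exact le_self_add
  have h4 := twoNeg_pos m
  simp only [twoNeg_succ] at h1 h2 h3
  rw [abs_lt]
  constructor <;> linarith

theorem near (h : IsHalfSup u w z) (h' : IsHalfSup u' w' z') (hw : ∀ n, Near (w n) (w' n)) :
    Near (limVal z) (limVal z') := by
  rw [← h.isReal.near_iff h'.isReal]
  intro m
  have h1 := h.seqVal_le_add h' (p := m) (fun n => by linarith [(abs_le.1 (hw n m)).2]) m m
  have h2 := h'.seqVal_le_add h (p := m) (fun n => by linarith [(abs_le.1 (hw n m)).1]) m m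
  have h3 := twoNeg_pos m
  simp only [twoNeg_succ] at h1 h2
  rw [abs_le]
  constructor <;> linarith

theorem pos (h : IsHalfSup u w z) {n : 𝓜.N} (hn : FarLt 0 (w n)) : FarLt 0 (limVal z) := by
  obtain ⟨N, hN⟩ := hn
  let m := max n (N + 1 + 1 + 1)
  have h1 := seqVal_le_maxVal (u m) (n := n) (k := m + 1 + 1)
    ((lt_add_one_N.2 (le_max_left _ _)).trans (lt_add_one _))
  have h2 := abs_le.1 (h.approx m n)
  have h3 := abs_le.1 (h.isReal.abs_sub_limVal m)
  have h4 : twoNeg m ≤ twoNeg (N + 1 + 1 + 1) := twoNeg_anti (le_max_right _ _)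
  have h5 := twoNeg_pos N
  refine ⟨N + 1 + 1, ?_⟩
  rw [h.seqVal_eq] at h3
  simp only [twoNeg_succ] at h2 h4 ⊢
  linarith [h2.1, h3.2]

/-- If the supremum is positive, then some element is greater than half of the supremum, and this is
seen from the approximations. -/
theorem exists_lt (h : IsHalfSup u w z) (hz : FarLt 0 (limVal z)) :
    ∃ m n, seqVal z m + 2 * twoNeg m < seqVal (u m) n := by
  obtain ⟨N, hN⟩ := hz
  refine ⟨N + 1 + 1, ?_⟩
  by_contra! hc
  obtain ⟨a, ha⟩ := exists_ratVal_eq_half (maxVal (u (N + 1 + 1)) (N + 1 + 1 + 1 + 1))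
  obtain ⟨b, hb⟩ := exists_ratVal_eq_add_twoNeg a (N + 1)
  have h0 := ratVal_maxVal_nonneg (u (N + 1 + 1)) (N + 1 + 1 + 1 + 1)
  have h1 := h.seqVal_eq (N + 1 + 1)
  have h2 := abs_le.1 (h.isReal.abs_sub_limVal (N + 1 + 1))
  have h3 := twoNeg_pos N
  have h4 := maxVal_le (u := u (N + 1 + 1)) (k := N + 1 + 1 + 1 + 1) (b := b)
    (by rw [hb, ha, twoNeg_succ]; linarith) fun n _ => by
      have := hc n
      simp only [twoNeg_succ] at this hb
      linarith
  simp only [twoNeg_succ] at h2 h4 hb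
  linarith [h2.1]

theorem farLt_of_lt (h : IsHalfSup u w z) {m n : 𝓜.N}
    (hmn : seqVal z m + 2 * twoNeg m < seqVal (u m) n) : FarLt (limVal z) (w n) := by
  have h1 := abs_le.1 (h.isReal.abs_sub_limVal m)
  have h2 := abs_le.1 (h.approx m n)
  have h3 := twoNeg_pos m
  refine ⟨m + 1, ?_⟩
  simp only [twoNeg_succ] at h2 ⊢
  linarith [h1.1, h2.2]

end IsHalfSup

end HalfSup

/-! ### Covers by intervals with rational centres -/

section RationalCentres

/-- The sequence of the distances of `x` to the complements of the intervals that `F` gives around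
the rationals in `[0, 1]`; the `n`-th one is restricted to `[0, 2 ^ (-n)]`, and approximated with
accuracy `2 ^ (-m - 2)`. -/
def approxDist {Γ : Ctx} (F : Tm Γ Ty.fn) (x : Tm Γ Ty.one) (m : Tm Γ Ty.nat) : Tm Γ Ty.one :=
  lam (ratMin (dyadic one v0)
    (ratPos (Tm.app (ballDist F.wk (constReal (ratClamp v0)) x.wk) (succ (succ m.wk)))))

/-- Half of the supremum of the restricted distances of `x` to the complements of the intervals that
`F` gives around the rationals in `[0, 1]`. -/
def supReal {Γ : Ctx} (F : Tm Γ Ty.fn) (x : Tm Γ Ty.one) : Tm Γ Ty.one :=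
  lam (ratHalf (maxUpto (approxDist F.wk x.wk v0) (succ (succ v0))))

variable {𝓜 : Model} [h𝓜 : 𝓜.IsBase]

/-- The value of `approxDist`. -/
def approxVal (F : 𝓜.M Ty.fn) (x : 𝓜.M Ty.one) (m : 𝓜.N) : 𝓜.M Ty.one :=
  eval (Env.cons m (Env.cons x (Env.cons F Env.nil))) (approxDist v2 v1 v0)

/-- The value of `supReal`. -/
def supVal (F : 𝓜.M Ty.fn) (x : 𝓜.M Ty.one) : 𝓜.M Ty.one :=
  eval (Env.cons x (Env.cons F Env.nil)) (supReal v1 v0)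

/-- The value of `realClamp`. -/
def realClampVal (x : 𝓜.M Ty.one) : 𝓜.M Ty.one := eval (Env.cons x Env.nil) (realClamp v0)

section

variable {Γ : Ctx} (e : Env 𝓜 Γ) (F : Tm Γ Ty.fn) (x : Tm Γ Ty.one) (m : Tm Γ Ty.nat)

theorem eval_constReal_ratClamp : eval e (constReal (ratClamp m)) = unitConst (eval e m) :=
  𝓜.ext fun _ => by
    simp [unitConst, constReal, eval_lam, ratClamp, ratMin, ratPos, ratSub, ratAdd, ratNeg]

theorem eval_realClamp : eval e (realClamp x) = realClampVal (eval e x) :=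
  𝓜.ext fun _ => by
    simp [realClampVal, realClamp, eval_lam, ratClamp, ratMin, ratPos, ratSub, ratAdd, ratNeg]

theorem eval_approxDist : eval e (approxDist F x m) =
    approxVal (eval e F) (eval e x) (eval e m) :=
  𝓜.ext fun _ => by
    simp [approxVal, approxDist, eval_lam, eval_constReal_ratClamp, ballDist, dyadic, ratMin,
      ratPos, ratSub, ratAdd, ratNeg, ratAbs]

theorem eval_supReal : eval e (supReal F x) = supVal (eval e F) (eval e x) :=
  𝓜.ext fun _ => by simp [supVal, supReal, eval_lam, eval_approxDist, ratHalf]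

end

/-- The restricted distance of `x` to the complement of the interval that `F` gives around the
rational in `[0, 1]` nearest to `n`. -/
noncomputable def distVal (F : 𝓜.M Ty.fn) (x : 𝓜.M Ty.one) (n : 𝓜.N) : 𝓜.F :=
  min (twoNeg n)
    (max (limVal (𝓜.app F (unitConst n)) - |limVal x - limVal (unitConst n)|) 0)

theorem abs_min_max_sub_le (c a b : 𝓜.F) : |min c (max a 0) - min c (max b 0)| ≤ |a - b| := by
  have h1 := abs_min_sub_min_le_max c (max a 0) c (max b 0)
  have h2 := abs_max_sub_max_le_max a 0 b 0
  simp only [sub_self, abs_zero, abs_nonneg, sup_of_le_left, sup_of_le_right] at h1 h2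
  exact h1.trans h2

variable {F : 𝓜.M Ty.fn}

theorem abs_seqVal_approxDist_sub_le {Γ : Ctx} {e : Env 𝓜 Γ} {G : Tm Γ Ty.fn} {x : Tm Γ Ty.one}
    {m : Tm Γ Ty.nat} (hG : IsFun InUnit (eval e G)) (hx : IsReal (eval e x)) (n : 𝓜.N) :
    |seqVal (eval e (approxDist G x m)) n - distVal (eval e G) (eval e x) n| ≤
      twoNeg (eval e m + 1 + 1) := by
  have h : seqVal (eval e (approxDist G x m)) n = min (twoNeg n) (max
      (seqVal (eval (Env.cons n e) (ballDist G.wk (constReal (ratClamp v0)) x.wk))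
        (eval e m + 1 + 1)) 0) := by
    rw [approxDist, seqVal_lam]
    simp [seqVal]
  have h1 := abs_seqVal_ballDist_sub_le (e := Env.cons n e) (F := G.wk)
    (y := constReal (ratClamp v0)) (x := x.wk)
  simp only [eval_constReal_ratClamp, eval_wk, eval_var, Env.cons_z] at h1
  rw [h, distVal]
  exact (abs_min_max_sub_le _ _ _).trans
    (h1 hx (inUnit_unitConst n).1 (hG.1 _ (inUnit_unitConst n)) _)

theorem isHalfSup_supVal (hF : IsFun InUnit F) {x : 𝓜.M Ty.one} (hx : IsReal x) :
    IsHalfSup (approxVal F x) (distVal F x) (supVal F x) where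
  approx m n := abs_seqVal_approxDist_sub_le (e := Env.cons m (Env.cons x (Env.cons F Env.nil)))
    (G := v2) (x := v1) (m := v0) hF hx n
  le n := min_le_left _ _
  seqVal_eq m := by
    rw [supVal, supReal, seqVal_lam, ratVal_ratHalf, eval_maxUpto, eval_approxDist]
    simp

theorem near_distVal {x y : 𝓜.M Ty.one} (h : Near (limVal x) (limVal y)) (n : 𝓜.N) :
    Near (distVal F x n) (distVal F y n) := fun k =>
  (abs_min_max_sub_le _ _ _).trans
    (((near_refl _).sub (h.sub (near_refl (limVal (unitConst n)))).abs) k)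

theorem farLt_zero_distVal {x : 𝓜.M Ty.one} {n : 𝓜.N} (h : InBall F (unitConst n) x) :
    FarLt 0 (distVal F x n) := by
  obtain ⟨k, hk⟩ := h
  refine ⟨max n k + 1, ?_⟩
  have h1 : twoNeg (max n k) ≤ twoNeg n := twoNeg_anti (le_max_left n k)
  have h2 : twoNeg (max n k) ≤ twoNeg k := twoNeg_anti (le_max_right n k)
  have h3 := twoNeg_pos (max n k)
  rw [distVal, lt_min_iff, lt_max_iff, twoNeg_succ]
  exact ⟨by linarith, Or.inl (by linarith)⟩

/-- If every point lies in an interval with a rational centre, then half of the supremum of the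
distances to the complements of these intervals is a canonical cover, and for a given point a
rational centre whose interval contains the interval of this cover can be found by search. -/
theorem hasFiniteSubcover_of_unitConst (hU : sat (Env.nil : Env 𝓜 []) HBU)
    (hF : IsFun InUnit F) (hcov : ∀ x, InUnit x → ∃ q, InBall F (unitConst q) x) :
    HasFiniteSubcover F := by
  have hcl (x : 𝓜.M Ty.one) (hx : IsReal x) : InUnit (realClampVal x) :=
    inUnit_realClamp (e := Env.cons x Env.nil) (x := v0) hx
  have hclv (x : 𝓜.M Ty.one) (hx : IsReal x) :
      Near (limVal (realClampVal x)) (clampVal (limVal x)) :=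
    limVal_realClamp (e := Env.cons x Env.nil) (x := v0) hx
  have hsup (x : 𝓜.M Ty.one) (hx : IsReal x) := isHalfSup_supVal hF (hcl x hx).1
  have hpos (x : 𝓜.M Ty.one) (hx : IsReal x) : FarLt 0 (limVal (supVal F (realClampVal x))) := by
    obtain ⟨q, hq⟩ := hcov _ (hcl x hx)
    exact (hsup x hx).pos (farLt_zero_distVal hq)
  let Ψ : 𝓜.M Ty.fn := eval (Env.cons F Env.nil) (lam (supReal v1 (realClamp v0)))
  have hΨ (x : 𝓜.M Ty.one) : 𝓜.app Ψ x = supVal F (realClampVal x) := by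
    simp only [Ψ, eval_lam, eval_supReal, eval_realClamp, eval_var, Env.cons_z, Env.cons_s]
  refine hasFiniteSubcover_of_refinement hU (Ψ := Ψ) ⟨fun x hx => ?_, fun x y hx hy hxy => ?_⟩
    (fun x hx => ?_) fun k y hy => ?_
  · rw [hΨ]
    exact (hsup x hx).isReal
  · rw [hΨ, hΨ]
    exact (hsup x hx).near (hsup y hy) (near_distVal
      ((hclv x hx).trans (hxy.clampVal.trans (hclv y hy).symm)))
  · rw [hΨ]
    exact hpos x hx
  · let C := Env.cons k (Env.cons y (Env.cons F Env.nil))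
    let vF : Tm [Ty.nat, Ty.nat, Ty.nat, Ty.nat ⇒ Ty.one, Ty.fn] Ty.fn :=
      Tm.var (Var.s (Var.s (Var.s (Var.s Var.z))))
    let A : Fm [Ty.nat, Ty.nat, Ty.nat, Ty.nat ⇒ Ty.one, Ty.fn] :=
      (Fm.lt v1 v2).imp (ratLt
        (ratAdd (Tm.app (supReal vF (realClamp (Tm.app v3 v1))) (snd v0)) (dyadic two (snd v0)))
        (Tm.app (approxDist vF (realClamp (Tm.app v3 v1)) (snd v0)) (fst v0)))
    have hA (i p : 𝓜.N) : sat (Env.cons p (Env.cons i C)) A ↔ (i < k →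
        seqVal (supVal F (realClampVal (𝓜.app y i))) (nSnd p) + 2 * twoNeg (nSnd p) <
          seqVal (approxVal F (realClampVal (𝓜.app y i)) (nSnd p)) (nFst p)) := by
      simp [A, C, vF, eval_supReal, eval_approxDist, eval_realClamp, seqVal, one_add_one_eq_two,
        map_ofNat]
    obtain ⟨Y, hY⟩ := hasChoice_nat_nat C A (by simp [A, Fm.QF, ratLt]) fun i => by
      by_cases hi : i < k
      · have hyi := (hy i hi).1
        obtain ⟨m, n, hmn⟩ := (hsup _ hyi).exists_lt (hpos _ hyi)
        exact ⟨nPair n m, (hA _ _).2 fun _ => by rwa [nFst_nPair, nSnd_nPair]⟩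
      · exact ⟨0, (hA _ _).2 fun h => absurd h hi⟩
    let z := eval (Env.cons Y Env.nil) (lam (constReal (ratClamp (fst (Tm.app v1 v0)))))
    have hz (i : 𝓜.N) : 𝓜.app z i = unitConst (nFst (𝓜.app Y i)) := by
      simp only [z, eval_lam, eval_constReal_ratClamp, eval_fst, eval_app, eval_var, Env.cons_z,
        Env.cons_s]
    refine ⟨z, fun i hi => ?_⟩
    rw [hz]
    refine ⟨inUnit_unitConst _, fun x hx => InBall.of_le fun h => ?_⟩
    have hyi := hy i hi
    have h1 := (hsup _ hyi.1).farLt_of_lt ((hA i _).1 (hY i) hi)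
    have h2 := h1.trans_le (min_le_right _ _)
    have h3 := (hpos _ hyi.1).lt
    have h4 := hclv _ hyi.1
    have h5 := h4.trans (clampVal_near hyi.2.1 hyi.2.2)
    rw [hΨ] at h
    have h6 := h.of_near
      ((near_refl _).sub ((h5.sub (near_refl (limVal (unitConst _)))).abs)).symm (near_refl _)
    rcases lt_max_iff.1 h2.lt with h7 | h7
    · exact lt_asymm h7 h6.lt
    · exact lt_asymm h7 h3

end RationalCentres

/-! ### From canonical covers to covers with possibly empty intervals -/

theorem sat_HBT_of_sat_HBU {𝓜 : Model} [h𝓜 : 𝓜.IsBase] (hU : sat (Env.nil : Env 𝓜 []) HBU) :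
    sat (Env.nil : Env 𝓜 []) HBT := by
  refine sat_HBT.2 fun F hF hcov => ?_
  by_cases h : ∀ x, InUnit x → ∃ q, InBall F (unitConst q) x
  · exact hasFiniteSubcover_of_unitConst hU hF h
  · push Not at h
    obtain ⟨x, hx, hq⟩ := h
    obtain ⟨y, hy, hxy⟩ := hcov x hx
    obtain ⟨s, hs⟩ := exists_isMu hF hx hy hxy hq
    exact hasFiniteSubcover_of_isMu hU hF hcov hs

end HOA

theorem mainTheorem6 : HOA.baseTheory.Proves (HOA.HBU.iff HOA.HBT) :=
  HOA.Theory.proves_of_models HOA.baseTheory_renClosed HOA.baseTheory_hasExt fun 𝓜 h => by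
    have : 𝓜.IsBase := ⟨h⟩
    exact (HOA.sat_iff _ _ _).2 ⟨HOA.sat_HBT_of_sat_HBU, HOA.sat_HBU_of_sat_HBT⟩
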